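/- **Setting.** Let $\mathbb{Z}_+=\{0,1,2,\dots\}$ and let $\mathbf a=(a_x)_{x\in\mathbb{Z}_+}$ be real numbers with $\inf_x a_x>0$ and $\sup_x a_x<\infty$. Put $R(\mathbf a)=\sup_x a_x-\inf_x a_x$ and $p_x(z)=\prod_{k=0}^{x-1}(1-z/a_k)$, $p_0=1$. Let $M\ge 0$, $N\ge 1$, $\mathfrak p\ge 1$, $L\ge 2$, $R>R(\mathbf a)$, and let $\mathbf f_0,\dots,\mathbf f_{L-1}$ be $\mathfrak p\times\mathfrak p$ matrix-valued functions with entries holomorphic in $\mathbb H_{-R}=\{\Re z>-R\}$. Let $\mathsf C_{\mathbf a}\subset\mathbb H_{-R}$ be a positively oriented simple closed piecewise $C^1$ contour encircling all the points $a_x$. For a matrix symbol $\mathbf f$ and $x=k\mathfrak p+i$, $y=m\mathfrak p+j$ with $0\le i,j<\mathfrak p$, $k,m\in\mathbb{Z}_+$, set $$\mathsf T_{\mathbf f}(x,y)=-\frac{1}{2\pi\mathrm i}\frac1{a_m}\oint_{\mathsf C_{\mathbf a}}\frac{p_k(w)}{p_{m+1}(w)}\mathbf f(w)_{ij}\,dw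 .$$ Let $\mathbf f_{r,r'}=\mathbf f_r\mathbf f_{r+1}\cdots\mathbf f_{r'-1}$ for $r<r'$, $\mathbf M(z)=\mathbf f_{0,L}(z)/p_{M+N}(z)$, and let $\mathbb W_{n}$ be the set of $(x_0<x_1<\dots<x_{n-1})$ in $\mathbb{Z}_+^n$. Assume that, for some constant $Z>0$, $$\frac1Z\det\!\big(\mathsf T_{\mathbf f_0}(j,x^{(1)}_k)\big)_{j,k=0}^{\mathfrak pN-1}\prod_{r=1}^{L-2}\det\!\big(\mathsf T_{\mathbf f_r}(x^{(r)}_j,x^{(r+1)}_k)\big)_{j,k=0}^{\mathfrak pN-1}\det\!\big(\mathsf T_{\mathbf f_{L-1}}(x^{(L-1)}_j,\mathfrak pM+k)\big)_{j,k=0}^{\mathfrak pN-1}$$ defines a probability measure on $(x^{(1)},\dots,x^{(L-1)})\in(\mathbb W_{\mathfrak pN})^{L-1}$, and let $(\mathsf X_0(t),\dots,\mathsf X_{\mathfrak pN-1}(t))_{1\le t\le L-1}$ be a random element with this law (non-intersecting paths with fixed start $(0,1,\dots,\mathfrak pN-1)$ at time $0$ and fixed end $(\mathfrak pM,\dots,\mathfrak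 p(M+N)-1)$ at time $L$). **Theorem.** (1) The following Riemann–Hilbert problem has a unique solution $\mathbf Y:\mathbb C\setminus\mathsf C_{\mathbf a}\to\mathbb C^{2\mathfrak p\times2\mathfrak p}$, and $\mathbf Y(z)$ is invertible for every $z\notin\mathsf C_{\mathbf a}$: * $\mathbf Y$ is analytic; * on $\mathsf C_{\mathbf a}$ the limits $\mathbf Y_+$ from inside and $\mathbf Y_-$ from outside exist and $\mathbf Y_+(z)=\mathbf Y_-(z)\begin{pmatrix}\mathbf I_{\mathfrak p}&\mathbf M(z)\\ \mathbf 0_{\mathfrak p}&\mathbf I_{\mathfrak p}\end{pmatrix}$; * $\mathbf Y(z)=(\mathbf I_{2\mathfrak p}+\mathcal O(z^{-1}))\begin{pmatrix}z^N\mathbf I_{\mathfrak p}&\mathbf 0_{\mathfrak p}\\ \mathbf 0_{\mathfrak p}&z^{-N}\mathbf I_{\mathfrak p}\end{pmatrix}$ as $z\to\infty$. (2) The function $$\mathbf R_N(w,z)=\frac1{z-w}\begin{pmatrix}\mathbf 0_{\mathfrak p}&\mathbf I_{\mathfrak p}\end{pmatrix}\mathbf Y^{-1}(w)\mathbf Y(z)\begin{pmatrix}\mathbf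 I_{\mathfrak p}\\ \mathbf 0_{\mathfrak p}\end{pmatrix},\qquad w\ne z,\ w,z\notin\mathsf C_{\mathbf a},$$ extends (uniquely) to a continuous function on $\mathbb C\times\mathbb C$, also denoted $\mathbf R_N$. (3) For every $n\ge1$ and pairwise distinct $(t_1,x_1),\dots,(t_n,x_n)\in\{1,\dots,L-1\}\times\mathbb{Z}_+$, $$\mathbb P\big(\exists\,j_1,\dots,j_n:\ \mathsf X_{j_i}(t_i)=x_i,\ i=1,\dots,n\big)=\det\big(\mathsf K_N[(t_i,x_i);(t_j,x_j)]\big)_{i,j=1}^n,$$ where, for $m,k\in\mathbb{Z}_+$ and $1\le r,r'\le L-1$, $$\big[\mathsf K_N[(r,m\mathfrak p+j);(r',k\mathfrak p+i)]\big]_{i,j=0}^{\mathfrak p-1}=\mathbf 1_{r>r'}\frac1{2\pi\mathrm i}\frac1{a_m}\oint_{\mathsf C_{\mathbf a}}\mathbf f_{r',r}(z)\frac{p_k(z)}{p_{m+1}(z)}\,dz$$ $$\qquad-\frac1{(2\pi\mathrm i)^2}\frac1{a_m}\oint_{\mathsf C_{\mathbf a}}\oint_{\mathsf C_{\mathbf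 a}}\mathbf f_{r',L}(w)\,\mathbf R_N(w,z)\,\mathbf f_{0,r}(z)\frac{p_k(w)}{p_{M+N}(w)\,p_{m+1}(z)}\,dz\,dw .$$ -/

import Mathlib

namespace LineEnsemble

open MeasureTheory Filter Topology Matrix

noncomputable section

/-! ### Contours -/

/-- The image of a curve parametrised by `[0, 1]`. -/
def trace (γ : ℝ → ℂ) : Set ℂ := γ '' Set.Icc 0 1

/-- The contour integral `∮_γ F(z) dz` of a scalar function. -/
def contourIntegral (γ : ℝ → ℂ) (F : ℂ → ℂ) : ℂ :=
  ∫ t in (0 : ℝ)..1, F (γ t) * deriv γ t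

/-- The winding number `(2πi)⁻¹ ∮_γ dw / (w - z)`, for `z` off the curve. -/
def winding (γ : ℝ → ℂ) (z : ℂ) : ℂ :=
  (2 * Real.pi * Complex.I)⁻¹ * contourIntegral γ (fun w => (w - z)⁻¹)

/-- The points that a positively oriented contour encircles. -/
def inside (γ : ℝ → ℂ) : Set ℂ := {z | z ∉ trace γ ∧ winding γ z = 1}

/-- The points in the exterior of the contour. -/
def outside (γ : ℝ → ℂ) : Set ℂ := {z | z ∉ trace γ ∧ winding γ z = 0}

/-- A simple closed piecewise continuously differentiable curve, positively oriented: its winding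
numbers are `0` or `1` (a negatively oriented simple closed curve has winding numbers `0`, `-1`). -/
structure IsContour (γ : ℝ → ℂ) : Prop where
  closed : γ 0 = γ 1
  simple : Set.InjOn γ (Set.Ico 0 1)
  piecewise_C1 : ∃ (n : ℕ) (s : Fin (n + 1) → ℝ), StrictMono s ∧ s 0 = 0 ∧ s (Fin.last n) = 1 ∧
    ∀ i : Fin n, ContDiffOn ℝ 1 γ (Set.Icc (s i.castSucc) (s i.succ))
  positive : ∀ z, z ∉ trace γ → winding γ z = 0 ∨ winding γ z = 1

/-! ### Toeplitz-like matrices with a matrix symbol -/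

/-- The polynomial `p_x(z) = ∏_{k < x} (1 - z / a_k)`. -/
def charPoly (a : ℕ → ℝ) (x : ℕ) (z : ℂ) : ℂ := ∏ k ∈ Finset.range x, (1 - z / (a k : ℂ))

/-- The Toeplitz-like matrix `T_f(x, y)` of the matrix symbol `f`,
where `x = k p + i`, `y = m p + j` with `0 ≤ i, j < p`. -/
def toeplitz (a : ℕ → ℝ) (γ : ℝ → ℂ) {p : ℕ} [NeZero p] (f : ℂ → Matrix (Fin p) (Fin p) ℂ)
    (x y : ℕ) : ℂ :=
  -(2 * Real.pi * Complex.I)⁻¹ * (a (y / p) : ℂ)⁻¹ *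
    contourIntegral γ (fun w =>
      charPoly a (x / p) w / charPoly a (y / p + 1) w * f w (Fin.ofNat p x) (Fin.ofNat p y))

/-- `f_{r,r'} = f_r f_{r+1} ⋯ f_{r'-1}` for `r < r'`. -/
def symbolProd {p : ℕ} (f : ℕ → ℂ → Matrix (Fin p) (Fin p) ℂ) (r r' : ℕ) (z : ℂ) :
    Matrix (Fin p) (Fin p) ℂ :=
  ((List.range' r (r' - r)).map (fun s => f s z)).prod

/-! ### The measure on non-intersecting paths -/

/-- Strictly increasing configurations of `n` points of `ℤ₊`, with coordinates `x_0 < ⋯ < x_{n-1}`. -/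
abbrev WeylChamber (n : ℕ) : Type := {x : Fin n → ℕ // StrictMono x}

/-- The configuration at time `t`, for `0 ≤ t ≤ L`: `(0, 1, …, pN-1)` at time `0`,
`(pM, pM+1, …, p(N+M)-1)` at time `L`, and the given `x^{(t)}` at times `1, …, L-1`. -/
def pathAt (p N M L : ℕ) (x : Set.Icc 1 (L - 1) → WeylChamber (p * N)) (t : ℕ)
    (j : Fin (p * N)) : ℕ :=
  if h : t ∈ Set.Icc 1 (L - 1) then (x ⟨t, h⟩).1 j
  else if t = 0 then j else p * M + j

/-- The unnormalised weight `∏_{r=0}^{L-1} det (T_{f_r}(x^{(r)}_j, x^{(r+1)}_k))_{j,k=0}^{pN-1}`. -/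
def pathWeight (a : ℕ → ℝ) (γ : ℝ → ℂ) {p : ℕ} [NeZero p] (N M L : ℕ)
    (f : ℕ → ℂ → Matrix (Fin p) (Fin p) ℂ) (x : Set.Icc 1 (L - 1) → WeylChamber (p * N)) : ℂ :=
  ∏ r ∈ Finset.range L, Matrix.det (Matrix.of fun j k : Fin (p * N) =>
    toeplitz a γ (f r) (pathAt p N M L x r j) (pathAt p N M L x (r + 1) k))

/-! ### The Riemann-Hilbert problem and the kernels -/

/-- The matrix weight `M(z) = f_{0,L}(z) / p_{M+N}(z)`. -/
def matrixWeight (a : ℕ → ℝ) {p : ℕ} (N M L : ℕ) (f : ℕ → ℂ → Matrix (Fin p) (Fin p) ℂ) (z : ℂ) :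
    Matrix (Fin p) (Fin p) ℂ :=
  (charPoly a (M + N) z)⁻¹ • symbolProd f 0 L z

/-- `Y` solves, on the complement of the contour, the Riemann-Hilbert problem of size `2p × 2p` with
jump `(I, W; 0, I)` and normalisation `diag(z^N I, z^{-N} I)`.  The `+` side is the inside. -/
structure SolvesRHP (γ : ℝ → ℂ) {p : ℕ} (N : ℕ) (W : ℂ → Matrix (Fin p) (Fin p) ℂ)
    (Y : ℂ → Matrix (Fin p ⊕ Fin p) (Fin p ⊕ Fin p) ℂ) : Prop where
  analytic : ∀ i j, DifferentiableOn ℂ (fun z => Y z i j) (trace γ)ᶜ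
  jump : ∀ z ∈ trace γ, ∃ Yplus Yminus : Matrix (Fin p ⊕ Fin p) (Fin p ⊕ Fin p) ℂ,
    Tendsto Y (𝓝[inside γ] z) (𝓝 Yplus) ∧ Tendsto Y (𝓝[outside γ] z) (𝓝 Yminus) ∧
      Yplus = Yminus * Matrix.fromBlocks 1 (W z) 0 1
  atInfinity : ∃ E : ℂ → Matrix (Fin p ⊕ Fin p) (Fin p ⊕ Fin p) ℂ,
    (∀ i j, (fun z => E z i j) =O[Bornology.cobounded ℂ] (fun z : ℂ => z⁻¹)) ∧
    ∀ᶠ z in Bornology.cobounded ℂ,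
      Y z = (1 + E z) * Matrix.fromBlocks (z ^ N • 1) 0 0 ((z ^ N)⁻¹ • 1)

/-- `R(w, z) = (z - w)⁻¹ (0 I) Y(w)⁻¹ Y(z) (I; 0)` for `w ≠ z` off the contour, extended continuously
to all `(w, z)`.  As the complement of the contour is dense, `Y` determines `R`. -/
structure IsReproducingKernel (γ : ℝ → ℂ) {p : ℕ}
    (Y : ℂ → Matrix (Fin p ⊕ Fin p) (Fin p ⊕ Fin p) ℂ)
    (R : ℂ → ℂ → Matrix (Fin p) (Fin p) ℂ) : Prop where
  continuous : Continuous (fun q : ℂ × ℂ => R q.1 q.2)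
  formula : ∀ w z, w ∉ trace γ → z ∉ trace γ → w ≠ z →
    R w z = (z - w)⁻¹ • (Matrix.fromCols (0 : Matrix (Fin p) (Fin p) ℂ) (1 : Matrix (Fin p) (Fin p) ℂ) * (Y w)⁻¹ *
      Y z * Matrix.fromRows (1 : Matrix (Fin p) (Fin p) ℂ) (0 : Matrix (Fin p) (Fin p) ℂ))

/-- The correlation kernel `K_N[(r, x); (r', y)]`, where `x = m p + j`, `y = k p + i`. -/
def corrKernel (a : ℕ → ℝ) (γ : ℝ → ℂ) {p : ℕ} [NeZero p] (N M L : ℕ)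
    (f : ℕ → ℂ → Matrix (Fin p) (Fin p) ℂ) (R : ℂ → ℂ → Matrix (Fin p) (Fin p) ℂ)
    (r x r' y : ℕ) : ℂ :=
  (if r' < r then
    (2 * Real.pi * Complex.I)⁻¹ * (a (x / p) : ℂ)⁻¹ *
      contourIntegral γ (fun z => symbolProd f r' r z (Fin.ofNat p y) (Fin.ofNat p x) *
        (charPoly a (y / p) z / charPoly a (x / p + 1) z))
    else 0)
  - ((2 * Real.pi * Complex.I) ^ 2)⁻¹ * (a (x / p) : ℂ)⁻¹ *
      contourIntegral γ (fun w => contourIntegral γ (fun z =>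
        (symbolProd f r' L w * R w z * symbolProd f 0 r z) (Fin.ofNat p y) (Fin.ofNat p x) *
          (charPoly a (y / p) w / (charPoly a (M + N) w * charPoly a (x / p + 1) z))))

end

end LineEnsemble

open LineEnsemble MeasureTheory

namespace LineEnsemble

open MeasureTheory Filter Topology Matrix

/-! The entries `toeplitz a γ f x y` are coefficients of $p_m$ in the Newton expansion of $p_k
f_{ij}$ at the nodes $a_0, a_1, \dots$ (`newtonCoeff`, with biorthogonality in
`NodesIn.newtonCoeff_charPoly`). Hence $T_{fg} = T_f T_g$ (`NodesIn.toeplitz_mul`), and the matrices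
are block upper triangular. By triangularity, paths of nonzero weight never pass the block $M+N$, so
the process lives on finitely many sites and the one-step matrices compose exactly there.

On finitely many sites this is the Eynard-Mehta theorem. Cauchy-Binet turns the sum over paths,
weighted by $\prod (1+g)$ over the occupied points, into a minor of a product of weighted steps.
Expanding at the last use of $g$ rewrites this minor as $\det G\,\det(1+gK)$, where $G$ is the
matrix `gram` and $K$ the extended kernel (`det_chain_weightedStep`). With $g$ the indicator of a
set $B$, both sides are sums over subsets of $B$, and inversion over subsets gives every correlation
function. Total mass one forces $\det G = Z \ne 0$ (`NodesIn.det_gram`).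

Invertibility of $G$ is also what solves the Riemann-Hilbert problem. The rows of $G^{-1}$ give
polynomial rows dual to the `dualPoly`, which span the polynomials of degree below $N$. So any
functional on these polynomials is realised by integration against (polynomial matrix) times the
weight (`NodesIn.cint_dualCombo`). Three choices of functional give the monic orthogonal polynomial,
the second block row of $Y$, and the kernel $R(w,\cdot)$ reproducing evaluation at $w$. With Cauchy
transforms of these polynomials as second columns, the jump follows from the winding numbers and the
behaviour at infinity from the moments.

Uniqueness and the formula for $R$ are one argument: if a row $X$ has the jump of $Y$ and the right
growth, then $XY^{-1}$ has no jump and is bounded, hence is constant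
(`IsContour.exists_mul_adjugate_eq`). For $R$ the row is $((z-w)R(w,z), C)$, with $C$ the Cauchy
transform of $(\cdot-w)R(w,\cdot)$ times the weight; its value at $z=w$ is $(0, I)$. That a merely
continuous function across the contour is entire comes from Morera's theorem and a count of grid
squares met by a Lipschitz curve (`boundaryIntegral_eq_zero`). Finally, inserting $G^{-1}$ into the
double contour integral identifies `corrKernel` with $K$ (`NodesIn.corrKernel_eq`). -/

/-! ### Regularity of piecewise continuously differentiable contours -/

theorem exists_mem_Icc_of_subdivision {n : ℕ} (s : Fin (n + 1) → ℝ) (h0 : s 0 = 0)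
    (h1 : s (Fin.last n) = 1) {t : ℝ} (ht : t ∈ Set.Icc (0 : ℝ) 1) :
    ∃ i : Fin n, t ∈ Set.Icc (s i.castSucc) (s i.succ) := by
  have key : ∀ j : Fin (n + 1), t ≤ s j → t = 0 ∨ ∃ i : Fin n, t ∈ Set.Icc (s i.castSucc) (s i.succ) := by
    intro j
    induction j using Fin.induction with
    | zero => intro h; left; rw [h0] at h; exact le_antisymm h ht.1
    | succ i ih =>
      intro h
      by_cases h' : t ≤ s i.castSucc
      · exact ih h'
      · exact Or.inr ⟨i, (not_le.1 h').le, h⟩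
  rcases key (Fin.last n) (h1 ▸ ht.2) with h | h
  · obtain _ | n := n
    · exact absurd (h0.symm.trans h1) (by norm_num)
    -- Only the point 0 remains. Monotonicity of `s` is not assumed: if the second node is negative,
    -- the sequence must climb back across 0 before reaching 1.
    · rcases le_or_gt t (s (Fin.succ 0)) with h' | h'
      · exact ⟨0, by rw [Fin.castSucc_zero, h0]; exact ht.1, h'⟩
      · subst h
        have : ∀ j : Fin (n + 1), s j.succ < 0 ∨ ∃ i : Fin (n + 1), (0 : ℝ) ∈ Set.Icc (s i.castSucc) (s i.succ) := by
          intro j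
          induction j using Fin.induction with
          | zero => exact Or.inl h'
          | succ i ih =>
            rcases ih with ih | ih
            · rcases lt_or_ge (s i.succ.succ) 0 with h3 | h3
              · exact Or.inl h3
              · refine Or.inr ⟨i.succ, ?_, h3⟩
                rw [← Fin.succ_castSucc]; exact ih.le
            · exact Or.inr ih
        rcases this (Fin.last n) with h3 | h3
        · rw [Fin.succ_last, h1] at h3; linarith
        · exact h3
  · exact h

/-- The analytic facts about a piecewise continuously differentiable curve. -/
theorem IsContour.regularity {γ : ℝ → ℂ} (h : IsContour γ) :
    ContinuousOn γ (Set.Icc 0 1) ∧ ∃ S : Set ℝ, S.Finite ∧ ∃ C : ℝ, 0 ≤ C ∧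
      ∀ t ∈ Set.Icc (0 : ℝ) 1, t ∉ S → DifferentiableAt ℝ γ t ∧ ‖deriv γ t‖ ≤ C := by
  obtain ⟨n, s, hs, h0, h1, hc⟩ := h.piecewise_C1
  have hcov : Set.Icc (0 : ℝ) 1 ⊆ ⋃ i : Fin n, Set.Icc (s i.castSucc) (s i.succ) := fun t ht =>
    Set.mem_iUnion.2 (exists_mem_Icc_of_subdivision s h0 h1 ht)
  refine ⟨((locallyFinite_of_finite _).continuousOn_iUnion (fun i => isClosed_Icc)
    fun i => (hc i).continuousOn).mono hcov, Set.range s, Set.finite_range s, ?_⟩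
  have hb : ∀ i : Fin n, ∃ C, ∀ t ∈ Set.Icc (s i.castSucc) (s i.succ),
      ‖derivWithin γ (Set.Icc (s i.castSucc) (s i.succ)) t‖ ≤ C := fun i =>
    isCompact_Icc.exists_bound_of_continuousOn
      ((hc i).continuousOn_derivWithin (uniqueDiffOn_Icc (hs i.castSucc_lt_succ)) le_rfl)
  choose C hC using hb
  refine ⟨∑ i, |C i|, Finset.sum_nonneg fun i _ => abs_nonneg _, fun t ht htS => ?_⟩
  obtain ⟨i, hi⟩ := exists_mem_Icc_of_subdivision s h0 h1 ht
  -- Off the break points a closed piece is a neighbourhood of `t`, so the derivative within the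
  -- piece is the true derivative.
  have hnhds : Set.Icc (s i.castSucc) (s i.succ) ∈ 𝓝 t := by
    refine Icc_mem_nhds (lt_of_le_of_ne hi.1 fun e => htS ⟨_, e⟩)
      (lt_of_le_of_ne hi.2 fun e => htS ⟨_, e.symm⟩)
  have hd : DifferentiableAt ℝ γ t :=
    (((hc i).differentiableOn one_ne_zero) t hi).differentiableAt hnhds
  refine ⟨hd, ?_⟩
  have e : derivWithin γ (Set.Icc (s i.castSucc) (s i.succ)) t = deriv γ t :=
    derivWithin_of_mem_nhds hnhds
  rw [← e]
  exact (hC i t hi).trans ((le_abs_self _).trans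
    (Finset.single_le_sum (f := fun i => |C i|) (fun i _ => abs_nonneg _) (Finset.mem_univ i)))

theorem IsContour.continuousOn {γ : ℝ → ℂ} (h : IsContour γ) : ContinuousOn γ (Set.Icc 0 1) :=
  h.regularity.1

theorem IsContour.ae_deriv_le {γ : ℝ → ℂ} (h : IsContour γ) :
    ∃ C : ℝ, 0 ≤ C ∧ ∀ᵐ t, t ∈ Set.uIoc (0 : ℝ) 1 → ‖deriv γ t‖ ≤ C := by
  obtain ⟨-, S, hS, C, hC0, hC⟩ := h.regularity
  refine ⟨C, hC0, ?_⟩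
  filter_upwards [hS.countable.ae_notMem volume] with t ht ht'
  rw [Set.uIoc_of_le zero_le_one] at ht'
  exact (hC t ⟨ht'.1.le, ht'.2⟩ ht).2

theorem IsContour.intervalIntegrable_deriv {γ : ℝ → ℂ} (h : IsContour γ) :
    IntervalIntegrable (deriv γ) volume 0 1 := by
  obtain ⟨C, -, hC⟩ := h.ae_deriv_le
  refine (intervalIntegrable_const (c := C)).mono_fun'
    (stronglyMeasurable_deriv γ).aestronglyMeasurable ?_
  exact (ae_restrict_iff' measurableSet_uIoc).2 hC

theorem trace_mem {γ : ℝ → ℂ} {t : ℝ} (ht : t ∈ Set.Icc (0 : ℝ) 1) : γ t ∈ trace γ :=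
  Set.mem_image_of_mem _ ht

theorem IsContour.isCompact_trace {γ : ℝ → ℂ} (h : IsContour γ) : IsCompact (trace γ) :=
  isCompact_Icc.image_of_continuousOn h.continuousOn

theorem IsContour.isOpen_compl {γ : ℝ → ℂ} (h : IsContour γ) : IsOpen (trace γ)ᶜ :=
  h.isCompact_trace.isClosed.isOpen_compl

theorem IsContour.continuousOn_comp {γ : ℝ → ℂ} (h : IsContour γ) {F : ℂ → ℂ}
    (hF : ContinuousOn F (trace γ)) : ContinuousOn (fun t => F (γ t)) (Set.uIcc 0 1) := by
  rw [Set.uIcc_of_le zero_le_one]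
  exact hF.comp h.continuousOn fun t ht => trace_mem ht

theorem IsContour.intervalIntegrable {γ : ℝ → ℂ} (h : IsContour γ) {F : ℂ → ℂ}
    (hF : ContinuousOn F (trace γ)) :
    IntervalIntegrable (fun t => F (γ t) * deriv γ t) volume 0 1 :=
  h.intervalIntegrable_deriv.continuousOn_mul (h.continuousOn_comp hF)

/-- The fundamental theorem of calculus tolerates the finitely many break points, since
$g\circ\gamma$ is continuous throughout. -/
theorem IsContour.integral_eq_sub {γ : ℝ → ℂ} (h : IsContour γ) {g g' : ℂ → ℂ} {x y : ℝ}
    (hx : 0 ≤ x) (hxy : x ≤ y) (hy : y ≤ 1)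
    (hg : ∀ z ∈ trace γ, HasDerivAt g (g' z) z) (hg' : ContinuousOn g' (trace γ)) :
    ∫ t in x..y, g' (γ t) * deriv γ t = g (γ y) - g (γ x) := by
  obtain ⟨-, S, hS, C, hC0, hC⟩ := h.regularity
  have hsub : Set.Icc x y ⊆ Set.Icc 0 1 := Set.Icc_subset_Icc hx hy
  refine integral_eq_of_hasDerivAt_off_countable_of_le (fun t => g (γ t)) _ hxy
    hS.countable ?_ ?_ ?_
  · have hgc : ContinuousOn g (trace γ) := fun z hz => (hg z hz).continuousAt.continuousWithinAt
    exact (hgc.comp h.continuousOn fun t ht => trace_mem ht).mono hsub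
  · intro t ht
    have ht' := hsub ⟨ht.1.1.le, ht.1.2.le⟩
    exact (hg _ (trace_mem ht')).comp_of_eq t (hC t ht' ht.2).1.hasDerivAt rfl
  · refine (h.intervalIntegrable hg').mono_set ?_
    rw [Set.uIcc_of_le hxy, Set.uIcc_of_le zero_le_one]; exact hsub

theorem IsContour.exists_lipschitz {γ : ℝ → ℂ} (h : IsContour γ) :
    ∃ C : NNReal, LipschitzOnWith C γ (Set.Icc 0 1) := by
  obtain ⟨C, hC0, hC⟩ := h.ae_deriv_le
  have key : ∀ x y, 0 ≤ x → x ≤ y → y ≤ 1 → ‖γ y - γ x‖ ≤ C * |y - x| := by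
    intro x y hx hxy hy
    -- Taking the identity as primitive writes the chord as the integral of the velocity, which is
    -- bounded almost everywhere.
    have e := h.integral_eq_sub (g := fun z => z) (g' := fun _ => 1) hx hxy hy
      (fun z _ => hasDerivAt_id z) continuousOn_const
    rw [← e]
    refine intervalIntegral.norm_integral_le_of_norm_le_const_ae ?_
    filter_upwards [hC] with t ht ht'
    rw [one_mul]
    refine ht ?_
    rw [Set.uIoc_of_le hxy] at ht'
    rw [Set.uIoc_of_le zero_le_one]
    exact ⟨hx.trans_lt ht'.1, ht'.2.trans hy⟩
  refine ⟨⟨C, hC0⟩, LipschitzOnWith.of_dist_le_mul fun x hx y hy => ?_⟩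
  rw [dist_eq_norm, Real.dist_eq]
  rcases le_total x y with hxy | hxy
  · rw [norm_sub_rev, abs_sub_comm]; exact key x y hx.1 hxy hy.2
  · exact key y x hy.1 hxy hx.2

/-- A Lipschitz image of an interval has Hausdorff dimension at most 1, less than 2. -/
theorem IsContour.dense_compl {γ : ℝ → ℂ} (h : IsContour γ) : Dense (trace γ)ᶜ := by
  obtain ⟨C, hC⟩ := h.exists_lipschitz
  refine dense_compl_of_dimH_lt_finrank ?_
  refine (hC.dimH_image_le.trans (dimH_mono (Set.subset_univ _))).trans_lt ?_
  rw [Real.dimH_univ, Complex.finrank_real_complex]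
  norm_num

theorem IsContour.neBot {γ : ℝ → ℂ} (h : IsContour γ) (z : ℂ) : (𝓝[(trace γ)ᶜ] z).NeBot :=
  mem_closure_iff_nhdsWithin_neBot.1 (h.dense_compl z)

/-- This replaces the Jordan curve theorem: limits from the two sides decide limits along the whole
complement. -/
theorem IsContour.inside_union_outside {γ : ℝ → ℂ} (h : IsContour γ) :
    (trace γ)ᶜ = inside γ ∪ outside γ := by
  ext z
  constructor
  · intro hz
    rcases h.positive z hz with h0 | h1
    · exact Or.inr ⟨hz, h0⟩
    · exact Or.inl ⟨hz, h1⟩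
  · rintro (hz | hz) <;> exact hz.1

/-! ### The contour functional `(2πi)⁻¹ ∮` -/

/-- The normalised contour integral. -/
noncomputable def cint (γ : ℝ → ℂ) (F : ℂ → ℂ) : ℂ :=
  (2 * Real.pi * Complex.I)⁻¹ * contourIntegral γ F

theorem contourIntegral_congr {γ : ℝ → ℂ} {F G : ℂ → ℂ} (hFG : Set.EqOn F G (trace γ)) :
    contourIntegral γ F = contourIntegral γ G := by
  refine intervalIntegral.integral_congr fun t ht => ?_
  rw [Set.uIcc_of_le zero_le_one] at ht
  simp only [hFG (trace_mem ht)]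

theorem cint_congr {γ : ℝ → ℂ} {F G : ℂ → ℂ} (hFG : Set.EqOn F G (trace γ)) :
    cint γ F = cint γ G := by rw [cint, cint, contourIntegral_congr hFG]

theorem IsContour.cint_add {γ : ℝ → ℂ} (h : IsContour γ) {F G : ℂ → ℂ}
    (hF : ContinuousOn F (trace γ)) (hG : ContinuousOn G (trace γ)) :
    cint γ (fun z => F z + G z) = cint γ F + cint γ G := by
  simp only [cint, contourIntegral]
  rw [← mul_add, ← intervalIntegral.integral_add (h.intervalIntegrable hF) (h.intervalIntegrable hG)]
  simp only [add_mul]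

theorem cint_const_mul {γ : ℝ → ℂ} (c : ℂ) (F : ℂ → ℂ) :
    cint γ (fun z => c * F z) = c * cint γ F := by
  simp only [cint, contourIntegral, mul_assoc]
  rw [intervalIntegral.integral_const_mul]; ring

theorem cint_neg {γ : ℝ → ℂ} (F : ℂ → ℂ) : cint γ (fun z => -F z) = -cint γ F := by
  simpa using cint_const_mul (γ := γ) (-1) F

theorem IsContour.cint_sub {γ : ℝ → ℂ} (h : IsContour γ) {F G : ℂ → ℂ}
    (hF : ContinuousOn F (trace γ)) (hG : ContinuousOn G (trace γ)) :
    cint γ (fun z => F z - G z) = cint γ F - cint γ G := by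
  simp only [sub_eq_add_neg]
  rw [h.cint_add hF (G := fun z => -G z) hG.neg, cint_neg]

theorem cint_zero {γ : ℝ → ℂ} : cint γ (fun _ => 0) = 0 := by
  simpa using cint_const_mul (γ := γ) 0 (fun _ => 0)

theorem IsContour.cint_sum {γ : ℝ → ℂ} (h : IsContour γ) {ι : Type*} (s : Finset ι) {F : ι → ℂ → ℂ}
    (hF : ∀ i ∈ s, ContinuousOn (F i) (trace γ)) :
    cint γ (fun z => ∑ i ∈ s, F i z) = ∑ i ∈ s, cint γ (F i) := by
  classical
  induction s using Finset.induction_on with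
  | empty => simpa using cint_zero
  | insert a s ha ih =>
    simp only [Finset.sum_insert ha]
    rw [h.cint_add (hF a (Finset.mem_insert_self a s)), ih fun i hi => hF i (Finset.mem_insert_of_mem hi)]
    exact continuousOn_finsetSum _ fun i hi => hF i (Finset.mem_insert_of_mem hi)

theorem IsContour.cint_eq_zero_of_hasDerivAt {γ : ℝ → ℂ} (h : IsContour γ) {g g' : ℂ → ℂ}
    (hg : ∀ z ∈ trace γ, HasDerivAt g (g' z) z) (hg' : ContinuousOn g' (trace γ)) :
    cint γ g' = 0 := by
  rw [cint, contourIntegral, h.integral_eq_sub le_rfl zero_le_one le_rfl hg hg', h.closed]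
  simp

theorem IsContour.exists_norm_cint_le {γ : ℝ → ℂ} (h : IsContour γ) : ∃ K : ℝ, 0 ≤ K ∧
    ∀ (F : ℂ → ℂ) (B : ℝ), (∀ z ∈ trace γ, ‖F z‖ ≤ B) → ‖cint γ F‖ ≤ K * B := by
  obtain ⟨C, hC0, hC⟩ := h.ae_deriv_le
  simp only [cint]
  generalize (2 * Real.pi * Complex.I : ℂ)⁻¹ = c
  refine ⟨‖c‖ * C, by positivity, fun F B hB => ?_⟩
  rw [norm_mul, mul_assoc]
  refine mul_le_mul_of_nonneg_left ?_ (norm_nonneg c)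
  have := intervalIntegral.norm_integral_le_of_norm_le_const_ae (a := 0) (b := 1) (C := C * B)
    (f := fun t => F (γ t) * deriv γ t) ?_
  · simpa [contourIntegral] using this
  filter_upwards [hC] with t ht ht'
  rw [norm_mul, mul_comm]
  have h2 := ht'
  rw [Set.uIoc_of_le zero_le_one] at h2
  exact mul_le_mul (ht ht') (hB _ (trace_mem ⟨h2.1.le, h2.2⟩)) (norm_nonneg _) hC0

/-! ### Cauchy transforms -/

/-- The Cauchy transform of a function on the contour. -/
noncomputable def cauchy (γ : ℝ → ℂ) (h : ℂ → ℂ) (z : ℂ) : ℂ := cint γ (fun w => h w / (w - z))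

theorem continuousOn_div_sub {γ : ℝ → ℂ} {h : ℂ → ℂ} (hh : ContinuousOn h (trace γ)) {z : ℂ}
    (hz : z ∉ trace γ) : ContinuousOn (fun w => h w / (w - z)) (trace γ) :=
  hh.div (continuousOn_id.sub continuousOn_const) fun w hw e => hz (by
    rw [← sub_eq_zero.1 e]; exact hw)

/-- Differentiation under the integral; on half of a ball avoiding the contour, $|w-z|$ is bounded
below. -/
theorem IsContour.differentiableOn_cauchy {γ : ℝ → ℂ} (hγ : IsContour γ) {h : ℂ → ℂ}
    (hh : ContinuousOn h (trace γ)) : DifferentiableOn ℂ (cauchy γ h) (trace γ)ᶜ := by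
  intro z₀ hz₀
  obtain ⟨r, hr, hball⟩ := Metric.isOpen_iff.1 hγ.isOpen_compl z₀ hz₀
  obtain ⟨B, hB⟩ := hγ.isCompact_trace.exists_bound_of_continuousOn hh
  have hB0 : 0 ≤ B := (norm_nonneg (h (γ 0))).trans (hB _ (trace_mem ⟨le_rfl, zero_le_one⟩))
  have hfar : ∀ x ∈ Metric.ball z₀ (r / 2), ∀ w ∈ trace γ, r / 2 ≤ ‖w - x‖ := by
    intro x hx w hw
    by_contra! hlt
    refine hball (a := w) ?_ hw
    rw [Metric.mem_ball] at hx ⊢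
    calc dist w z₀ ≤ dist w x + dist x z₀ := dist_triangle _ _ _
      _ < r / 2 + r / 2 := by rw [dist_eq_norm w x]; exact add_lt_add hlt hx
      _ = r := by ring
  have hnot : ∀ x ∈ Metric.ball z₀ (r / 2), x ∉ trace γ := fun x hx =>
    hball (Metric.ball_subset_ball (by linarith) hx)
  have key := intervalIntegral.hasDerivAt_integral_of_dominated_loc_of_deriv_le (μ := volume)
    (a := 0) (b := 1) (F := fun x t => h (γ t) / (γ t - x) * deriv γ t)
    (F' := fun x t => h (γ t) / (γ t - x) ^ 2 * deriv γ t) (x₀ := z₀)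
    (s := Metric.ball z₀ (r / 2)) (bound := fun t => B / (r / 2) ^ 2 * ‖deriv γ t‖)
    (Metric.ball_mem_nhds _ (by positivity)) ?_ ?_ ?_ ?_ ?_ ?_
  · have := key.2.differentiableAt.const_mul ((2 * Real.pi * Complex.I)⁻¹)
    exact this.differentiableWithinAt
  · filter_upwards [Metric.ball_mem_nhds z₀ (show 0 < r / 2 by positivity)] with x hx
    exact (hγ.intervalIntegrable (continuousOn_div_sub hh (hnot x hx))).aestronglyMeasurable_restrict_uIoc
  · exact hγ.intervalIntegrable (continuousOn_div_sub hh hz₀)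
  · refine (hγ.intervalIntegrable (F := fun w => h w / (w - z₀) ^ 2) ?_).aestronglyMeasurable_restrict_uIoc
    refine hh.div ((continuousOn_id.sub continuousOn_const).pow 2) fun w hw e => hz₀ ?_
    rw [← sub_eq_zero.1 (pow_eq_zero_iff two_ne_zero |>.1 e)]; exact hw
  · refine Eventually.of_forall fun t ht x hx => ?_
    rw [Set.uIoc_of_le zero_le_one] at ht
    have hw := trace_mem (γ := γ) ⟨ht.1.le, ht.2⟩
    rw [norm_mul, norm_div, norm_pow]
    gcongr
    · exact hB _ hw
    · exact hfar x hx _ hw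
  · exact hγ.intervalIntegrable_deriv.norm.const_mul _
  · refine Eventually.of_forall fun t ht x hx => ?_
    rw [Set.uIoc_of_le zero_le_one] at ht
    have hw := trace_mem (γ := γ) ⟨ht.1.le, ht.2⟩
    have hne : γ t - x ≠ 0 := fun e => hnot x hx (by rw [← sub_eq_zero.1 e]; exact hw)
    have h1 : HasDerivAt (fun x => γ t - x) (-1) x := by
      simpa using (hasDerivAt_id x).const_sub (γ t)
    have h2 := ((h1.inv hne).const_mul (h (γ t))).mul_const (deriv γ t)
    simp only [div_eq_mul_inv]
    convert! h2 using 1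
    field_simp

/-- Subtracting $h(z)$ leaves a difference quotient that is harmless at the contour; the whole jump
is carried by the winding number. -/
theorem IsContour.cauchy_eq {γ : ℝ → ℂ} (hγ : IsContour γ) {h : ℂ → ℂ}
    (hh : ContinuousOn h (trace γ)) {z : ℂ} (hz : z ∉ trace γ) :
    cauchy γ h z = cint γ (fun w => (h w - h z) / (w - z)) + h z * winding γ z := by
  have e : winding γ z = cint γ (fun w => (w - z)⁻¹) := rfl
  rw [e, ← cint_const_mul, ← hγ.cint_add]
  · refine cint_congr fun w hw => ?_
    simp only [div_eq_mul_inv]; ring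
  · exact continuousOn_div_sub (hh.sub continuousOn_const) hz
  · simpa only [div_eq_mul_inv] using continuousOn_div_sub (continuousOn_const (c := h z)) hz

theorem IsContour.ae_ne {γ : ℝ → ℂ} (hγ : IsContour γ) (z : ℂ) :
    ∀ᵐ t, t ∈ Set.uIoc (0 : ℝ) 1 → γ t ≠ z := by
  have hs : ({t | t ∈ Set.Ico (0 : ℝ) 1 ∧ γ t = z} : Set ℝ).Subsingleton := fun x hx y hy =>
    hγ.simple hx.1 hy.1 (hx.2.trans hy.2.symm)
  filter_upwards [hs.countable.ae_notMem volume, (Set.countable_singleton (1 : ℝ)).ae_notMem volume]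
    with t ht ht1 hmem e
  rw [Set.uIoc_of_le zero_le_one] at hmem
  exact ht ⟨⟨hmem.1.le, lt_of_le_of_ne hmem.2 ht1⟩, e⟩

/-- Dominated convergence. Near $z_0$ the difference quotient is bounded by the mean value
inequality on a disc, elsewhere by the distance $|w-z|\ge r/2$. Pointwise convergence fails only
where $\gamma(t)=z_0$, a null set because the curve is simple. -/
theorem IsContour.tendsto_cint_slope {γ : ℝ → ℂ} (hγ : IsContour γ) {U : Set ℂ} (hU : IsOpen U)
    (hsub : trace γ ⊆ U) {h : ℂ → ℂ} (hh : DifferentiableOn ℂ h U) {z₀ : ℂ} (hz₀ : z₀ ∈ trace γ) :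
    Tendsto (fun z => cint γ (fun w => (h w - h z) / (w - z))) (𝓝[(trace γ)ᶜ] z₀)
      (𝓝 (cint γ (fun w => (h w - h z₀) / (w - z₀)))) := by
  obtain ⟨r, hr, hball⟩ := Metric.nhds_basis_closedBall.mem_iff.1 (hU.mem_nhds (hsub hz₀))
  obtain ⟨B, hB⟩ := hγ.isCompact_trace.exists_bound_of_continuousOn (hh.continuousOn.mono hsub)
  obtain ⟨B', hB'⟩ := (isCompact_closedBall z₀ r).exists_bound_of_continuousOn
    (hh.continuousOn.mono hball)
  obtain ⟨K, hK⟩ := (isCompact_closedBall z₀ r).exists_bound_of_continuousOn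
    ((hh.deriv hU).continuousOn.mono hball)
  have hB0 : 0 ≤ B := (norm_nonneg _).trans (hB _ hz₀)
  have hB'0 : 0 ≤ B' := (norm_nonneg _).trans (hB' _ (Metric.mem_closedBall_self hr.le))
  have hK0 : 0 ≤ K := (norm_nonneg _).trans (hK _ (Metric.mem_closedBall_self hr.le))
  have hbound : ∀ z ∈ Metric.ball z₀ (r / 2), ∀ w ∈ trace γ,
      ‖(h w - h z) / (w - z)‖ ≤ K + (B + B') / (r / 2) := by
    intro z hz w hw
    have hzc : z ∈ Metric.closedBall z₀ r :=
      Metric.ball_subset_closedBall (Metric.ball_subset_ball (by linarith) hz)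
    by_cases hwr : w ∈ Metric.closedBall z₀ r
    · have h1 : ‖h w - h z‖ ≤ K * ‖w - z‖ :=
        (convex_closedBall z₀ r).norm_image_sub_le_of_norm_deriv_le
          (fun x hx => hh.differentiableAt (hU.mem_nhds (hball hx))) hK hzc hwr
      have h2 : ‖(h w - h z) / (w - z)‖ ≤ K := by
        rw [norm_div]
        exact div_le_of_le_mul₀ (norm_nonneg _) hK0 h1
      have : 0 ≤ (B + B') / (r / 2) := by positivity
      linarith
    · have h1 : r / 2 ≤ ‖w - z‖ := by
        rw [Metric.mem_closedBall, not_le] at hwr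
        rw [Metric.mem_ball] at hz
        rw [← dist_eq_norm]
        have := dist_triangle w z z₀
        linarith
      have h2 : ‖(h w - h z) / (w - z)‖ ≤ (B + B') / (r / 2) := by
        rw [norm_div]
        gcongr
        exact (norm_sub_le _ _).trans (add_le_add (hB _ hw) (hB' _ hzc))
      linarith
  refine Tendsto.const_mul _ ?_
  refine intervalIntegral.tendsto_integral_filter_of_dominated_convergence
    (fun t => (K + (B + B') / (r / 2)) * ‖deriv γ t‖) ?_ ?_ ?_ ?_
  · filter_upwards [self_mem_nhdsWithin] with z hz
    exact (hγ.intervalIntegrable (continuousOn_div_sub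
      (h := fun w => h w - h z) ((hh.continuousOn.mono hsub).sub continuousOn_const) hz)).aestronglyMeasurable_restrict_uIoc
  · filter_upwards [mem_nhdsWithin_of_mem_nhds (Metric.ball_mem_nhds z₀ (show 0 < r / 2 by positivity))]
      with z hz
    refine Eventually.of_forall fun t ht => ?_
    rw [Set.uIoc_of_le zero_le_one] at ht
    rw [norm_mul]
    exact mul_le_mul_of_nonneg_right (hbound z hz _ (trace_mem ⟨ht.1.le, ht.2⟩)) (norm_nonneg _)
  · exact hγ.intervalIntegrable_deriv.norm.const_mul _
  · filter_upwards [hγ.ae_ne z₀] with t ht hmem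
    have hc : ContinuousAt h z₀ := (hh.differentiableAt (hU.mem_nhds (hsub hz₀))).continuousAt
    have : ContinuousAt (fun z => (h (γ t) - h z) / (γ t - z) * deriv γ t) z₀ :=
      ((continuousAt_const.sub hc).div (continuousAt_const.sub continuousAt_id)
        (sub_ne_zero.2 (ht hmem))).mul continuousAt_const
    exact this.tendsto.mono_left nhdsWithin_le_nhds

/-- Boundary values of the Cauchy transform of an analytic function. -/
theorem IsContour.exists_tendsto_cauchy {γ : ℝ → ℂ} (hγ : IsContour γ) {U : Set ℂ} (hU : IsOpen U)
    (hsub : trace γ ⊆ U) {h : ℂ → ℂ} (hh : DifferentiableOn ℂ h U) {z₀ : ℂ} (hz₀ : z₀ ∈ trace γ) :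
    ∃ d, Tendsto (cauchy γ h) (𝓝[inside γ] z₀) (𝓝 (d + h z₀)) ∧
      Tendsto (cauchy γ h) (𝓝[outside γ] z₀) (𝓝 d) := by
  have ht := hγ.tendsto_cint_slope hU hsub hh hz₀
  have hc : ContinuousAt h z₀ := (hh.differentiableAt (hU.mem_nhds (hsub hz₀))).continuousAt
  refine ⟨cint γ (fun w => (h w - h z₀) / (w - z₀)), ?_, ?_⟩
  · have h1 := (ht.mono_left (nhdsWithin_mono z₀ (fun z (hz : z ∈ inside γ) => hz.1))).add
      (hc.tendsto.mono_left (nhdsWithin_le_nhds (s := inside γ)))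
    refine h1.congr' ?_
    filter_upwards [self_mem_nhdsWithin] with z hz
    rw [hγ.cauchy_eq (hh.continuousOn.mono hsub) hz.1, hz.2, mul_one]
  · refine (ht.mono_left (nhdsWithin_mono z₀ (fun z (hz : z ∈ outside γ) => hz.1))).congr' ?_
    filter_upwards [self_mem_nhdsWithin] with z hz
    rw [hγ.cauchy_eq (hh.continuousOn.mono hsub) hz.1, hz.2, mul_zero, add_zero]

/-- $z/(w-z) = w/(w-z) - 1$. -/
theorem IsContour.mul_cauchy {γ : ℝ → ℂ} (hγ : IsContour γ) {h : ℂ → ℂ}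
    (hh : ContinuousOn h (trace γ)) {z : ℂ} (hz : z ∉ trace γ) :
    z * cauchy γ h z = cauchy γ (fun s => h s * s) z - cint γ h := by
  rw [cauchy, cauchy, ← cint_const_mul, ← hγ.cint_sub _ hh]
  · refine cint_congr fun w hw => ?_
    have : w - z ≠ 0 := sub_ne_zero.2 fun e => hz (e ▸ hw)
    field_simp
    ring
  · exact continuousOn_div_sub (hh.mul continuousOn_id) hz

/-- Each vanishing moment lets one more factor $z$ pass into the Cauchy transform; this converts
orthogonality into decay at infinity. -/
theorem IsContour.pow_mul_cauchy {γ : ℝ → ℂ} (hγ : IsContour γ) {h : ℂ → ℂ}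
    (hh : ContinuousOn h (trace γ)) {z : ℂ} (hz : z ∉ trace γ) (n : ℕ)
    (hmom : ∀ k < n, cint γ (fun s => h s * s ^ k) = 0) :
    z ^ n * cauchy γ h z = cauchy γ (fun s => h s * s ^ n) z := by
  induction n with
  | zero => simp
  | succ n ih =>
    rw [pow_succ', mul_assoc, ih fun k hk => hmom k (hk.trans n.lt_succ_self),
      hγ.mul_cauchy (h := fun s => h s * s ^ n) (hh.mul (continuousOn_id.pow n)) hz, hmom n n.lt_succ_self, sub_zero]
    simp only [pow_succ, mul_assoc]

theorem IsContour.cauchy_isBigO {γ : ℝ → ℂ} (hγ : IsContour γ) {h : ℂ → ℂ}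
    (hh : ContinuousOn h (trace γ)) :
    cauchy γ h =O[Bornology.cobounded ℂ] (fun z : ℂ => z⁻¹) := by
  obtain ⟨K, hK0, hK⟩ := hγ.exists_norm_cint_le
  obtain ⟨B, hB⟩ := hγ.isCompact_trace.exists_bound_of_continuousOn hh
  obtain ⟨A, hA⟩ := hγ.isCompact_trace.isBounded.exists_norm_le
  have hB0 : 0 ≤ B := (norm_nonneg (h (γ 0))).trans (hB _ (trace_mem ⟨le_rfl, zero_le_one⟩))
  refine Asymptotics.IsBigO.of_bound (K * (B * 2)) ?_
  filter_upwards [tendsto_norm_cobounded_atTop.eventually_ge_atTop (2 * A),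
    tendsto_norm_cobounded_atTop.eventually_gt_atTop 0] with z hz hz0
  have : ‖cauchy γ h z‖ ≤ K * (B * (2 * ‖z‖⁻¹)) := by
    refine hK _ _ fun w hw => ?_
    rw [div_eq_mul_inv, norm_mul, norm_inv]
    refine mul_le_mul (hB w hw) ?_ (by positivity) hB0
    have h1 : ‖z‖ / 2 ≤ ‖w - z‖ := by
      have := norm_sub_norm_le z w
      rw [norm_sub_rev] at this
      have := hA w hw
      linarith
    calc ‖w - z‖⁻¹ ≤ (‖z‖ / 2)⁻¹ := inv_anti₀ (by positivity) h1
      _ = 2 * ‖z‖⁻¹ := by rw [inv_div, div_eq_mul_inv]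
  rw [norm_inv]
  linarith

/-! ### Removability of the contour -/

/-- The integral of `f` over the boundary of the rectangle `[x₁, x₂] × [y₁, y₂]`. -/
noncomputable def boundaryIntegral (f : ℂ → ℂ) (x₁ x₂ y₁ y₂ : ℝ) : ℂ :=
  (∫ x : ℝ in x₁..x₂, f (x + y₁ * Complex.I)) - (∫ x : ℝ in x₁..x₂, f (x + y₂ * Complex.I)) +
    Complex.I * (∫ y : ℝ in y₁..y₂, f (x₂ + y * Complex.I)) -
    Complex.I * (∫ y : ℝ in y₁..y₂, f (x₁ + y * Complex.I))

theorem sum_boundaryIntegral_left {f : ℂ → ℂ} (hf : Continuous f) (x : ℕ → ℝ) (y₁ y₂ : ℝ) (n : ℕ) :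
    ∑ i ∈ Finset.range n, boundaryIntegral f (x i) (x (i + 1)) y₁ y₂ =
      boundaryIntegral f (x 0) (x n) y₁ y₂ := by
  have hi : ∀ y : ℝ, ∀ k < n, IntervalIntegrable (fun t : ℝ => f (t + y * Complex.I)) volume (x k) (x (k + 1)) :=
    fun y k _ => Continuous.intervalIntegrable (by fun_prop) _ _
  simp only [boundaryIntegral, add_sub_assoc, Finset.sum_add_distrib, Finset.sum_sub_distrib]
  rw [intervalIntegral.sum_integral_adjacent_intervals (hi y₁),
    intervalIntegral.sum_integral_adjacent_intervals (hi y₂), ← Finset.sum_sub_distrib,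
    Finset.sum_range_sub (fun i => Complex.I * ∫ t : ℝ in y₁..y₂, f (x i + t * Complex.I))]

theorem sum_boundaryIntegral_right {f : ℂ → ℂ} (hf : Continuous f) (y : ℕ → ℝ) (x₁ x₂ : ℝ) (n : ℕ) :
    ∑ i ∈ Finset.range n, boundaryIntegral f x₁ x₂ (y i) (y (i + 1)) =
      boundaryIntegral f x₁ x₂ (y 0) (y n) := by
  have hi : ∀ x : ℝ, ∀ k < n, IntervalIntegrable (fun t : ℝ => f (x + t * Complex.I)) volume (y k) (y (k + 1)) :=
    fun y k _ => Continuous.intervalIntegrable (by fun_prop) _ _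
  simp only [boundaryIntegral, add_sub_assoc, Finset.sum_add_distrib, Finset.sum_sub_distrib,
    ← Finset.mul_sum]
  rw [intervalIntegral.sum_integral_adjacent_intervals (hi x₁),
    intervalIntegral.sum_integral_adjacent_intervals (hi x₂), ← Finset.sum_sub_distrib,
    Finset.sum_range_sub' (fun i => ∫ t : ℝ in x₁..x₂, f (t + y i * Complex.I))]

/-- Opposite sides are paired, so only the oscillation of `f` enters. -/
theorem norm_boundaryIntegral_le {f : ℂ → ℂ} (hf : Continuous f) {x₁ x₂ y₁ y₂ ε : ℝ}
    (h : ∀ z ∈ Set.uIcc x₁ x₂ ×ℂ Set.uIcc y₁ y₂, ∀ w ∈ Set.uIcc x₁ x₂ ×ℂ Set.uIcc y₁ y₂,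
      ‖f z - f w‖ ≤ ε) :
    ‖boundaryIntegral f x₁ x₂ y₁ y₂‖ ≤ ε * (|x₂ - x₁| + |y₂ - y₁|) := by
  have e : boundaryIntegral f x₁ x₂ y₁ y₂ =
      (∫ x : ℝ in x₁..x₂, (f (x + y₁ * Complex.I) - f (x + y₂ * Complex.I))) +
        Complex.I * ∫ y : ℝ in y₁..y₂, (f (x₂ + y * Complex.I) - f (x₁ + y * Complex.I)) := by
    rw [intervalIntegral.integral_sub, intervalIntegral.integral_sub, boundaryIntegral]
    · ring
    all_goals exact Continuous.intervalIntegrable (by fun_prop) _ _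
  rw [e, mul_add]
  have hmem : ∀ x y : ℝ, x ∈ Set.uIcc x₁ x₂ → y ∈ Set.uIcc y₁ y₂ →
      (x + y * Complex.I : ℂ) ∈ Set.uIcc x₁ x₂ ×ℂ Set.uIcc y₁ y₂ := by
    intro x y hx hy
    rw [Complex.mem_reProdIm]
    simpa using ⟨hx, hy⟩
  refine (norm_add_le _ _).trans (add_le_add ?_ ?_)
  · refine intervalIntegral.norm_integral_le_of_norm_le_const fun x hx => ?_
    exact h _ (hmem _ _ (Set.uIoc_subset_uIcc hx) Set.left_mem_uIcc) _
      (hmem _ _ (Set.uIoc_subset_uIcc hx) Set.right_mem_uIcc)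
  · rw [norm_mul, Complex.norm_I, one_mul]
    refine intervalIntegral.norm_integral_le_of_norm_le_const fun y hy => ?_
    exact h _ (hmem _ _ Set.right_mem_uIcc (Set.uIoc_subset_uIcc hy)) _
      (hmem _ _ Set.left_mem_uIcc (Set.uIoc_subset_uIcc hy))

theorem card_filter_abs_sub_le (n : ℕ) (v κ : ℝ) (hκ : 0 ≤ κ) :
    ((Finset.range n).filter fun i : ℕ => |(i : ℝ) - v| ≤ κ).card ≤ 2 * κ + 1 := by
  have h1 : ((Finset.range n).filter fun i : ℕ => |(i : ℝ) - v| ≤ κ).card ≤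
      (Finset.Icc ⌈v - κ⌉ ⌊v + κ⌋).card := by
    refine Finset.card_le_card_of_injOn (fun i : ℕ => (i : ℤ)) ?_ (fun a _ b _ h => by simpa using h)
    intro i hi
    have := abs_le.1 (Finset.mem_filter.1 hi).2
    simp only [Finset.coe_Icc, Set.mem_Icc, Int.ceil_le, Int.le_floor, Int.cast_natCast]
    constructor <;> linarith
  rw [Int.card_Icc] at h1
  have h2 : ((⌊v + κ⌋ + 1 - ⌈v - κ⌉).toNat : ℝ) ≤ 2 * κ + 1 := by
    rcases le_total 0 (⌊v + κ⌋ + 1 - ⌈v - κ⌉) with h | h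
    · have : ((⌊v + κ⌋ + 1 - ⌈v - κ⌉).toNat : ℝ) = ((⌊v + κ⌋ + 1 - ⌈v - κ⌉ : ℤ) : ℝ) := by
        exact_mod_cast congrArg (Int.cast (R := ℝ)) (Int.toNat_of_nonneg h)
      rw [this]
      push_cast
      have := Int.floor_le (v + κ)
      have := Int.le_ceil (v - κ)
      linarith
    · rw [Int.toNat_of_nonpos h]; push_cast; linarith
  exact le_trans (by exact_mod_cast h1) h2

/-- Cut the rectangle into $n^2$ cells. Cells off the curve contribute 0 by Cauchy's theorem. The
Lipschitz curve meets $O(n)$ cells, each contributing at most $\varepsilon\cdot O(1/n)$ by uniform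
continuity, so the total is $O(\varepsilon)$. -/
theorem boundaryIntegral_eq_zero {γ : ℝ → ℂ} {C : NNReal} (hγ : LipschitzOnWith C γ (Set.Icc 0 1))
    {f : ℂ → ℂ} (hf : Continuous f) (hd : DifferentiableOn ℂ f (trace γ)ᶜ) (x₁ x₂ y₁ y₂ : ℝ) :
    boundaryIntegral f x₁ x₂ y₁ y₂ = 0 := by
  rcases eq_or_ne x₁ x₂ with rfl | hx
  · simp [boundaryIntegral]
  rcases eq_or_ne y₁ y₂ with rfl | hy
  · simp [boundaryIntegral]
  set X := |x₂ - x₁| with hX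
  set Y := |y₂ - y₁| with hY
  have hX0 : 0 < X := abs_pos.2 (sub_ne_zero.2 hx.symm)
  have hY0 : 0 < Y := abs_pos.2 (sub_ne_zero.2 hy.symm)
  -- In units of the mesh $X/n$: a point of the curve moves at most $C/n$ from the nearest earlier
  -- sample $\gamma(l/n)$, and a cell has width $X/n$.
  set κ := (C + X) / X with hκ
  set κ' := (C + Y) / Y with hκ'
  have hκ0 : 0 ≤ κ := by positivity
  have hκ'0 : 0 ≤ κ' := by positivity
  have hcomp : IsCompact (Set.uIcc x₁ x₂ ×ℂ Set.uIcc y₁ y₂) := isCompact_uIcc.reProdIm isCompact_uIcc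
  have huc := hcomp.uniformContinuousOn_of_continuous hf.continuousOn
  set A := 2 * ((2 * κ + 1) * (2 * κ' + 1)) * (X + Y) with hA
  have hA0 : 0 < A := by positivity
  have key : ∀ ε > 0, ‖boundaryIntegral f x₁ x₂ y₁ y₂‖ ≤ A * ε := by
    intro ε hε
    obtain ⟨δ, hδ, hfδ⟩ := Metric.uniformContinuousOn_iff.1 huc ε hε
    obtain ⟨n, hn⟩ := exists_nat_gt ((X + Y) / δ)
    have hn0 : (0 : ℝ) < n := lt_of_le_of_lt (by positivity) hn
    have hnδ : (X + Y) / n < δ := by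
      rw [div_lt_iff₀ hδ] at hn
      rw [div_lt_iff₀ hn0]; linarith
    let x : ℕ → ℝ := fun i => x₁ + i * ((x₂ - x₁) / n)
    let y : ℕ → ℝ := fun i => y₁ + i * ((y₂ - y₁) / n)
    have hx0 : x 0 = x₁ := by simp [x]
    have hxn : x n = x₂ := by simp only [x]; field_simp; ring
    have hy0 : y 0 = y₁ := by simp [y]
    have hyn : y n = y₂ := by simp only [y]; field_simp; ring
    have hxs : ∀ i, |x (i + 1) - x i| = X / n := by
      intro i
      have : x (i + 1) - x i = (x₂ - x₁) / n := by simp only [x]; push_cast; ring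
      rw [this, abs_div, abs_of_pos hn0]
    have hys : ∀ i, |y (i + 1) - y i| = Y / n := by
      intro i
      have : y (i + 1) - y i = (y₂ - y₁) / n := by simp only [y]; push_cast; ring
      rw [this, abs_div, abs_of_pos hn0]
    have hgrid : ∀ (a b : ℝ) (i : ℕ), i ≤ n → a + i * ((b - a) / n) ∈ Set.uIcc a b := by
      intro a b i hi
      have h1 : (i : ℝ) / n ∈ Set.Icc (0 : ℝ) 1 :=
        ⟨by positivity, (div_le_one hn0).2 (by exact_mod_cast hi)⟩
      have h2 := (convex_uIcc a b).add_smul_sub_mem (Set.left_mem_uIcc) (Set.right_mem_uIcc) h1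
      convert! h2 using 1
      rw [smul_eq_mul]; ring
    have hsum : boundaryIntegral f x₁ x₂ y₁ y₂ = ∑ q ∈ Finset.range n ×ˢ Finset.range n,
        boundaryIntegral f (x q.1) (x (q.1 + 1)) (y q.2) (y (q.2 + 1)) := by
      rw [Finset.sum_product]
      simp only [sum_boundaryIntegral_right hf y]
      rw [sum_boundaryIntegral_left hf x, hx0, hxn, hy0, hyn]
    let cell : ℕ × ℕ → Set ℂ := fun q =>
      Set.uIcc (x q.1) (x (q.1 + 1)) ×ℂ Set.uIcc (y q.2) (y (q.2 + 1))
    have hcellsub : ∀ q ∈ Finset.range n ×ˢ Finset.range n,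
        cell q ⊆ Set.uIcc x₁ x₂ ×ℂ Set.uIcc y₁ y₂ := by
      intro q hq z hz
      rw [Finset.mem_product, Finset.mem_range, Finset.mem_range] at hq
      exact ⟨Set.uIcc_subset_uIcc (hgrid _ _ _ hq.1.le) (hgrid _ _ _ hq.1) hz.1,
        Set.uIcc_subset_uIcc (hgrid _ _ _ hq.2.le) (hgrid _ _ _ hq.2) hz.2⟩
    have hbound : ∀ q ∈ Finset.range n ×ˢ Finset.range n,
        ‖boundaryIntegral f (x q.1) (x (q.1 + 1)) (y q.2) (y (q.2 + 1))‖ ≤ ε * ((X + Y) / n) := by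
      intro q hq
      have := norm_boundaryIntegral_le hf (x₁ := x q.1) (x₂ := x (q.1 + 1)) (y₁ := y q.2)
        (y₂ := y (q.2 + 1)) (ε := ε) ?_
      · rw [hxs, hys, ← add_div] at this; exact this
      intro z hz w hw
      rw [← dist_eq_norm]
      refine (hfδ z (hcellsub q hq hz) w (hcellsub q hq hw) ?_).le
      rw [dist_eq_norm]
      calc ‖z - w‖ ≤ |(z - w).re| + |(z - w).im| := Complex.norm_le_abs_re_add_abs_im _
        _ ≤ X / n + Y / n := by
          rw [Complex.sub_re, Complex.sub_im]
          refine add_le_add ?_ ?_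
          · rw [← hxs q.1]; exact Set.abs_sub_le_of_uIcc_subset_uIcc (Set.uIcc_subset_uIcc hw.1 hz.1)
          · rw [← hys q.2]; exact Set.abs_sub_le_of_uIcc_subset_uIcc (Set.uIcc_subset_uIcc hw.2 hz.2)
        _ < δ := by rw [← add_div]; exact hnδ
    have hzero : ∀ q, Disjoint (cell q) (trace γ) →
        boundaryIntegral f (x q.1) (x (q.1 + 1)) (y q.2) (y (q.2 + 1)) = 0 := by
      intro q hq
      have := Complex.integral_boundary_rect_eq_zero_of_differentiableOn f
        ⟨x q.1, y q.2⟩ ⟨x (q.1 + 1), y (q.2 + 1)⟩ (hd.mono hq.subset_compl_right)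
      simpa [boundaryIntegral] using this
    classical
    -- The cells that the piece of curve following the sample $\gamma(l/n)$ can meet; their number
    -- is bounded independently of `n`.
    let T : ℕ → Finset (ℕ × ℕ) := fun l =>
      ((Finset.range n).filter fun i : ℕ => |(i : ℝ) - ((γ (l / n)).re - x₁) / ((x₂ - x₁) / n)| ≤ κ) ×ˢ
      ((Finset.range n).filter fun i : ℕ => |(i : ℝ) - ((γ (l / n)).im - y₁) / ((y₂ - y₁) / n)| ≤ κ')
    have hT : ∀ q ∈ Finset.range n ×ˢ Finset.range n, ¬Disjoint (cell q) (trace γ) →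
        q ∈ (Finset.range (n + 1)).biUnion T := by
      intro q hq hq'
      obtain ⟨z, hz, t, ht, rfl⟩ := Set.not_disjoint_iff.1 hq'
      have hl : (⌊t * n⌋₊ : ℝ) ≤ t * n := Nat.floor_le (mul_nonneg ht.1 hn0.le)
      have hl' := Nat.lt_floor_add_one (t * n)
      have hln : ⌊t * n⌋₊ ≤ n := by
        refine Nat.floor_le_of_le ?_
        nlinarith [ht.2]
      rw [Finset.mem_biUnion]
      refine ⟨⌊t * n⌋₊, Finset.mem_range.2 (Nat.lt_succ_of_le hln), ?_⟩
      have hdist : ‖γ t - γ (⌊t * n⌋₊ / n)‖ ≤ C / n := by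
        rw [← dist_eq_norm]
        refine (hγ.dist_le_mul t ht _ ⟨by positivity, (div_le_one hn0).2 (by exact_mod_cast hln)⟩).trans ?_
        rw [div_eq_mul_inv (C : ℝ)]
        refine mul_le_mul_of_nonneg_left ?_ C.2
        rw [Real.dist_eq, abs_le]
        constructor
        · have : (⌊t * n⌋₊ : ℝ) / n ≤ t := by rw [div_le_iff₀ hn0]; exact hl
          have : (0 : ℝ) ≤ (n : ℝ)⁻¹ := by positivity
          linarith
        · have : t ≤ ((⌊t * n⌋₊ : ℝ) + 1) / n := by rw [le_div_iff₀ hn0]; exact hl'.le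
          rw [add_div, one_div] at this
          linarith
      have aux : ∀ (a b g g' : ℝ) (i : ℕ), b - a ≠ 0 → |g - g'| ≤ C / n →
          |a + i * ((b - a) / n) - g| ≤ |b - a| / n →
          |(i : ℝ) - (g' - a) / ((b - a) / n)| ≤ (C + |b - a|) / |b - a| := by
        intro a b g g' i hab h1 h2
        have e : (i : ℝ) - (g' - a) / ((b - a) / n) =
            ((a + i * ((b - a) / n) - g) + (g - g')) / ((b - a) / n) := by
          field_simp; ring
        rw [e, abs_div, abs_div, abs_of_pos hn0]
        rw [div_le_div_iff₀ (by positivity) (by positivity)]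
        have h3 := (abs_add_le (a + i * ((b - a) / n) - g) (g - g')).trans (add_le_add h2 h1)
        calc _ ≤ (|b - a| / n + C / n) * |b - a| := mul_le_mul_of_nonneg_right h3 (abs_nonneg _)
          _ = _ := by ring
      have hre := (Complex.abs_re_le_norm _).trans hdist
      have him := (Complex.abs_im_le_norm _).trans hdist
      rw [Complex.sub_re] at hre
      rw [Complex.sub_im] at him
      rw [Finset.mem_product] at hq
      refine Finset.mem_product.2 ⟨Finset.mem_filter.2 ⟨hq.1, ?_⟩, Finset.mem_filter.2 ⟨hq.2, ?_⟩⟩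
      · refine aux _ _ _ _ _ (sub_ne_zero.2 hx.symm) hre ?_
        rw [← hX, ← hxs q.1]
        exact Set.abs_sub_le_of_uIcc_subset_uIcc (Set.uIcc_subset_uIcc hz.1 Set.left_mem_uIcc)
      · refine aux _ _ _ _ _ (sub_ne_zero.2 hy.symm) him ?_
        rw [← hY, ← hys q.2]
        exact Set.abs_sub_le_of_uIcc_subset_uIcc (Set.uIcc_subset_uIcc hz.2 Set.left_mem_uIcc)
    set S := (Finset.range n ×ˢ Finset.range n).filter fun q => ¬Disjoint (cell q) (trace γ) with hS
    have hcard : (S.card : ℝ) ≤ (n + 1) * ((2 * κ + 1) * (2 * κ' + 1)) := by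
      have h1 : S.card ≤ ∑ l ∈ Finset.range (n + 1), (T l).card :=
        (Finset.card_le_card fun q hq => hT q (Finset.mem_filter.1 hq).1
          (Finset.mem_filter.1 hq).2).trans Finset.card_biUnion_le
      have h2 : ((∑ l ∈ Finset.range (n + 1), (T l).card : ℕ) : ℝ) ≤
          ∑ l ∈ Finset.range (n + 1), (2 * κ + 1) * (2 * κ' + 1) := by
        push_cast
        refine Finset.sum_le_sum fun l _ => ?_
        rw [Finset.card_product]
        push_cast
        exact mul_le_mul (card_filter_abs_sub_le _ _ _ hκ0) (card_filter_abs_sub_le _ _ _ hκ'0)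
          (by positivity) (by positivity)
      have h3 : (S.card : ℝ) ≤ ((∑ l ∈ Finset.range (n + 1), (T l).card : ℕ) : ℝ) := by
        exact_mod_cast h1
      refine h3.trans (h2.trans (le_of_eq ?_))
      rw [Finset.sum_const, Finset.card_range, nsmul_eq_mul]
      push_cast; ring
    have hn1 : (1 : ℝ) ≤ n := by exact_mod_cast Nat.one_le_iff_ne_zero.2 (by rintro rfl; simp at hn0)
    rw [hsum, ← Finset.sum_subset (Finset.filter_subset (fun q => ¬Disjoint (cell q) (trace γ)) _)]
    · calc _ ≤ ∑ q ∈ S, ε * ((X + Y) / n) := norm_sum_le_of_le _ fun q hq =>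
            hbound q (Finset.mem_filter.1 hq).1
        _ = S.card * (ε * ((X + Y) / n)) := by rw [Finset.sum_const, nsmul_eq_mul]
        _ ≤ ((n + 1) * ((2 * κ + 1) * (2 * κ' + 1))) * (ε * ((X + Y) / n)) :=
          mul_le_mul_of_nonneg_right hcard (by positivity)
        _ ≤ ((2 * n) * ((2 * κ + 1) * (2 * κ' + 1))) * (ε * ((X + Y) / n)) := by
          gcongr; linarith
        _ = A * ε := by rw [hA]; field_simp
    · intro q hq hq'
      refine hzero q ?_
      by_contra h
      exact hq' (Finset.mem_filter.2 ⟨hq, h⟩)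
  have h0 : ‖boundaryIntegral f x₁ x₂ y₁ y₂‖ ≤ 0 := by
    refine le_of_forall_pos_le_add fun ε hε => ?_
    have := key (ε / A) (by positivity)
    rwa [mul_div_cancel₀ _ hA0.ne', ← zero_add ε] at this
  exact norm_le_zero_iff.1 h0

/-- A continuous function that is analytic off a rectifiable curve is entire. -/
theorem IsContour.differentiable_of_continuous {γ : ℝ → ℂ} (hγ : IsContour γ) {f : ℂ → ℂ}
    (hf : Continuous f) (hd : DifferentiableOn ℂ f (trace γ)ᶜ) : Differentiable ℂ f := by
  obtain ⟨C, hC⟩ := hγ.exists_lipschitz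
  -- Morera: vanishing integrals over rectangles give a primitive.
  have hcons : Complex.IsConservativeOn f Set.univ := by
    intro z w _
    rw [← add_eq_zero_iff_eq_neg, Complex.wedgeIntegral_add_wedgeIntegral_eq]
    simpa [boundaryIntegral] using boundaryIntegral_eq_zero hC hf hd z.re w.re z.im w.im
  exact differentiableOn_univ.1 ((hcons.isExactOn_univ hf).differentiableOn isOpen_univ)

/-- A version of Liouville's theorem for functions without jump on the contour. -/
theorem IsContour.exists_eq_const {γ : ℝ → ℂ} (hγ : IsContour γ) {f : ℂ → ℂ}
    (hd : DifferentiableOn ℂ f (trace γ)ᶜ)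
    (hlim : ∀ z ∈ trace γ, ∃ l, Tendsto f (𝓝[(trace γ)ᶜ] z) (𝓝 l))
    (hb : f =O[Bornology.cobounded ℂ] (fun _ => (1 : ℂ))) :
    ∃ c, ∀ z ∉ trace γ, f z = c := by
  -- The values on the contour itself are irrelevant; they are replaced by the limits from the
  -- complement.
  have hcont : Continuous (extendFrom (trace γ)ᶜ f) := by
    refine continuous_extendFrom hγ.dense_compl fun z => ?_
    by_cases hz : z ∈ trace γ
    · exact hlim z hz
    · exact ⟨f z, (hd.continuousOn z hz).tendsto⟩
  have heq : ∀ z ∉ trace γ, extendFrom (trace γ)ᶜ f z = f z := fun z hz => by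
    have := hγ.neBot z
    exact extendFrom_eq (hγ.dense_compl z) (hd.continuousOn z hz).tendsto
  have hdiff : Differentiable ℂ (extendFrom (trace γ)ᶜ f) :=
    hγ.differentiable_of_continuous hcont (hd.congr heq)
  have hout : ∀ᶠ z in Bornology.cobounded ℂ, z ∉ trace γ :=
    hγ.isCompact_trace.isBounded
  have hbd : Bornology.IsBounded (Set.range (extendFrom (trace γ)ᶜ f)) := by
    obtain ⟨B, hB⟩ := hb.bound
    have hev : ∀ᶠ z in Bornology.cobounded ℂ, ‖extendFrom (trace γ)ᶜ f z‖ ≤ B := by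
      filter_upwards [hB, hout] with z h1 h2
      rw [heq z h2]; simpa using h1
    have hbs : Bornology.IsBounded {z | ‖extendFrom (trace γ)ᶜ f z‖ ≤ B}ᶜ :=
      Bornology.isBounded_compl_iff.2 hev
    obtain ⟨r, hr⟩ := hbs.subset_closedBall 0
    obtain ⟨B', hB'⟩ := (isCompact_closedBall (0 : ℂ) r).exists_bound_of_continuousOn hcont.continuousOn
    refine isBounded_iff_forall_norm_le.2 ⟨max B B', ?_⟩
    rintro _ ⟨z, rfl⟩
    by_cases hz : ‖extendFrom (trace γ)ᶜ f z‖ ≤ B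
    · exact hz.trans (le_max_left _ _)
    · exact (hB' z (hr hz)).trans (le_max_right _ _)
  obtain ⟨c, hc⟩ := hdiff.exists_eq_const_of_bounded hbd
  exact ⟨c, fun z hz => by rw [← heq z hz, hc]; rfl⟩

/-! ### Contour integrals with poles at the nodes -/

/-- The contour and the nodes it encircles lie in a common disc. -/
structure NodesIn (a : ℕ → ℝ) (γ : ℝ → ℂ) (U : Set ℂ) : Prop where
  contour : IsContour γ
  disc : ∃ c r, U = Metric.ball c r
  trace_subset : trace γ ⊆ U
  node_ne_zero : ∀ k, a k ≠ 0
  node_mem : ∀ k, (a k : ℂ) ∈ U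
  node_inside : ∀ k, (a k : ℂ) ∈ inside γ

/-- Discs tangent to the boundary line from inside exhaust the open half-plane. Working in a disc
gives holomorphic functions primitives, so no homological form of Cauchy's theorem is needed. -/
theorem exists_ball_of_isCompact {K : Set ℂ} (hK : IsCompact K) {R₀ : ℝ} (h : ∀ z ∈ K, -R₀ < z.re) :
    ∃ c r, K ⊆ Metric.ball c r ∧ Metric.ball c r ⊆ {z : ℂ | -R₀ < z.re} := by
  rcases K.eq_empty_or_nonempty with rfl | hne
  · exact ⟨0, 0, by simp, by simp⟩
  obtain ⟨z₀, hz₀, hmin⟩ := hK.exists_isMinOn hne Complex.continuous_re.continuousOn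
  obtain ⟨A, hA⟩ := hK.isBounded.exists_norm_le
  set δ := z₀.re + R₀ with hδ
  have hδ0 : 0 < δ := by have := h z₀ hz₀; linarith
  -- The first entry makes the radius positive; the second makes $A^2 < 2x(\Re z + R_0)$, which
  -- suffices for $|z-x|<x+R_0$.
  set x := max (|R₀| + 1) ((A ^ 2 + 1) / (2 * δ)) with hx
  have hx1 : |R₀| + 1 ≤ x := le_max_left _ _
  have hx2 : (A ^ 2 + 1) / (2 * δ) ≤ x := le_max_right _ _
  have hpos : 0 < x + R₀ := by have := neg_abs_le R₀; linarith
  have hx0 : 0 < x := by have := abs_nonneg R₀; linarith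
  refine ⟨(x : ℂ), x + R₀, fun z hz => ?_, fun z hz => ?_⟩
  · rw [Metric.mem_ball, dist_eq_norm]
    refine lt_of_pow_lt_pow_left₀ 2 hpos.le ?_
    have h1 : ‖z‖ ^ 2 = z.re ^ 2 + z.im ^ 2 := by
      rw [Complex.sq_norm, Complex.normSq_apply]; ring
    have h2 : ‖z - x‖ ^ 2 = (z.re - x) ^ 2 + z.im ^ 2 := by
      rw [Complex.sq_norm, Complex.normSq_apply]; simp; ring
    have h3 : ‖z‖ ^ 2 ≤ A ^ 2 := pow_le_pow_left₀ (norm_nonneg _) (hA z hz) 2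
    have h4 : z₀.re ≤ z.re := hmin hz
    rw [div_le_iff₀ (by positivity)] at hx2
    have h5 : x * δ ≤ x * (z.re + R₀) := mul_le_mul_of_nonneg_left (by linarith) hx0.le
    rw [h2]
    nlinarith [sq_nonneg R₀]
  · rw [Metric.mem_ball, dist_eq_norm] at hz
    have := (Complex.abs_re_le_norm _).trans_lt hz
    rw [Complex.sub_re, Complex.ofReal_re, abs_lt] at this
    simp only [Set.mem_ofPred_eq]; linarith [this.1]

theorem exists_nodesIn {a : ℕ → ℝ} (ha_inf : 0 < ⨅ k, a k) (ha_sup : BddAbove (Set.range a))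
    {R₀ : ℝ} (hR₀ : (⨆ k, a k) - (⨅ k, a k) < R₀) {γ : ℝ → ℂ} (hγ : IsContour γ)
    (hγ_half : ∀ z ∈ trace γ, -R₀ < z.re) (hγ_a : ∀ k, (a k : ℂ) ∈ inside γ) :
    ∃ U, NodesIn a γ U ∧ U ⊆ {z : ℂ | -R₀ < z.re} := by
  -- The real infimum of a set unbounded below is 0 by convention, so its positivity already forces
  -- a lower bound.
  have hbdd : BddBelow (Set.range a) := by
    by_contra h
    rw [Real.iInf_of_not_bddBelow h] at ha_inf
    exact lt_irrefl _ ha_inf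
  have hlow : ∀ k, (⨅ k, a k) ≤ a k := fun k => ciInf_le hbdd k
  have hup : ∀ k, a k ≤ ⨆ k, a k := fun k => le_ciSup ha_sup k
  have hR : 0 < R₀ := by have := (hlow 0).trans (hup 0); linarith
  set K := trace γ ∪ (fun x : ℝ => (x : ℂ)) '' Set.Icc (⨅ k, a k) (⨆ k, a k)
  have hK : IsCompact K :=
    hγ.isCompact_trace.union (isCompact_Icc.image Complex.continuous_ofReal)
  obtain ⟨c, r, h1, h2⟩ := exists_ball_of_isCompact hK (R₀ := R₀) (by
    rintro z (hz | ⟨x, hx, rfl⟩)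
    · exact hγ_half z hz
    · have := hx.1; simp only [Complex.ofReal_re]; linarith)
  exact ⟨_, ⟨hγ, ⟨c, r, rfl⟩, Set.subset_union_left.trans h1, fun k => (ha_inf.trans_le (hlow k)).ne',
    fun k => h1 (Or.inr ⟨a k, ⟨hlow k, hup k⟩, rfl⟩), hγ_a⟩, h2⟩

section

variable {a : ℕ → ℝ} {γ : ℝ → ℂ} {U : Set ℂ}

theorem NodesIn.isOpen (hU : NodesIn a γ U) : IsOpen U := by
  obtain ⟨c, r, rfl⟩ := hU.disc; exact Metric.isOpen_ball

theorem NodesIn.continuousOn (hU : NodesIn a γ U) {h : ℂ → ℂ} (hh : DifferentiableOn ℂ h U) :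
    ContinuousOn h (trace γ) := hh.continuousOn.mono hU.trace_subset

theorem NodesIn.cint_eq_zero (hU : NodesIn a γ U) {h : ℂ → ℂ} (hh : DifferentiableOn ℂ h U) :
    cint γ h = 0 := by
  obtain ⟨c, r, hcr⟩ := hU.disc
  obtain ⟨g, hg⟩ := (hcr ▸ hh).isExactOn_ball
  exact hU.contour.cint_eq_zero_of_hasDerivAt (fun z hz => hg z (hcr ▸ hU.trace_subset hz))
    (hU.continuousOn hh)

theorem cint_inv_sub {z : ℂ} (hz : z ∈ inside γ) : cint γ (fun w => (w - z)⁻¹) = 1 := hz.2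

/-- Partial fractions on two distinct poles lower the number of factors; two simple poles give
$1-1=0$. If all poles coincide, a power of order at least 2 has a primitive. -/
theorem IsContour.cint_multiset_prod_inv (hγ : IsContour γ) (s : Multiset ℂ)
    (hs : ∀ b ∈ s, b ∈ inside γ) (hcard : 2 ≤ s.card) :
    cint γ (fun w => (s.map fun b => (w - b)⁻¹).prod) = 0 := by
  have hsub : ∀ b ∈ inside γ, ∀ w ∈ trace γ, w - b ≠ 0 := fun b hb w hw e =>
    hb.1 (by rw [← sub_eq_zero.1 e]; exact hw)
  have hcont : ∀ s : Multiset ℂ, (∀ b ∈ s, b ∈ inside γ) →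
      ContinuousOn (fun w => (s.map fun b => (w - b)⁻¹).prod) (trace γ) := by
    intro s
    induction s using Multiset.induction_on with
    | empty => intro _; simpa using continuousOn_const
    | cons b s ih =>
      intro hs
      simp only [Multiset.map_cons, Multiset.prod_cons]
      exact ((continuousOn_id.sub continuousOn_const).inv₀ (hsub b (hs b (by simp)))).mul
        (ih fun c hc => hs c (by simp [hc]))
  induction hn : s.card using Nat.strong_induction_on generalizing s with
  | _ n ih =>
  obtain ⟨b, hb⟩ := Multiset.card_pos_iff_exists_mem.1 (show 0 < s.card by omega)
  obtain ⟨t, rfl⟩ := Multiset.exists_cons_of_mem hb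
  by_cases hall : ∀ c ∈ t, c = b
  · obtain ⟨k, hk⟩ : ∃ k, t.card = k + 1 := ⟨t.card - 1, by simp at hcard; omega⟩
    have ht : t = Multiset.replicate (k + 1) b := Multiset.eq_replicate.2 ⟨hk, hall⟩
    have hbin := hs b (by simp)
    have hpow : ∀ w, ((b ::ₘ t).map fun b => (w - b)⁻¹).prod = ((w - b) ^ (k + 2))⁻¹ := by
      intro w
      rw [ht, ← Multiset.replicate_succ, Multiset.map_replicate, Multiset.prod_replicate, inv_pow]
    simp only [hpow]
    refine hγ.cint_eq_zero_of_hasDerivAt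
      (g := fun w => -((k : ℂ) + 1)⁻¹ * ((w - b) ^ (k + 1))⁻¹) ?_ ?_
    · intro w hw
      have hne := hsub b hbin w hw
      have h1 : HasDerivAt (fun w => (w - b) ^ (k + 1)) (((k + 1 : ℕ) : ℂ) * (w - b) ^ k * 1) w :=
        ((hasDerivAt_id w).sub_const b).pow (k + 1)
      have hk1 : (k : ℂ) + 1 ≠ 0 := by exact_mod_cast Nat.succ_ne_zero k
      convert! (h1.inv (pow_ne_zero _ hne)).const_mul (-((k : ℂ) + 1)⁻¹) using 1
      push_cast
      field_simp
      ring
    · exact ((continuousOn_id.sub continuousOn_const).pow _).inv₀ fun w hw =>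
        pow_ne_zero _ (hsub b hbin w hw)
  · push Not at hall
    obtain ⟨c, hc, hcb⟩ := hall
    obtain ⟨u, rfl⟩ := Multiset.exists_cons_of_mem hc
    have hb' := hs b (by simp)
    have hc' := hs c (by simp)
    have hu : ∀ d ∈ u, d ∈ inside γ := fun d hd => hs d (by simp [hd])
    have hsplit : cint γ (fun w => ((b ::ₘ c ::ₘ u).map fun b => (w - b)⁻¹).prod) =
        (c - b)⁻¹ * (cint γ (fun w => ((c ::ₘ u).map fun b => (w - b)⁻¹).prod) -
          cint γ (fun w => ((b ::ₘ u).map fun b => (w - b)⁻¹).prod)) := by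
      rw [← hγ.cint_sub (hcont _ (by simpa using ⟨hc', hu⟩)) (hcont _ (by simpa using ⟨hb', hu⟩)),
        ← cint_const_mul]
      refine cint_congr fun w hw => ?_
      have h1 := hsub b hb' w hw
      have h2 := hsub c hc' w hw
      have h3 : c - b ≠ 0 := sub_ne_zero.2 hcb
      simp only [Multiset.map_cons, Multiset.prod_cons]
      field_simp
      ring
    rw [hsplit]
    simp only [Multiset.card_cons] at hcard hn
    rcases Nat.eq_zero_or_pos u.card with h0 | hpos
    · rw [Multiset.card_eq_zero.1 h0]
      have e : ∀ d ∈ inside γ, cint γ (fun w => ((d ::ₘ (0 : Multiset ℂ)).map fun b => (w - b)⁻¹).prod) = 1 := by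
        intro d hd
        simpa using cint_inv_sub hd
      rw [e c hc', e b hb', sub_self, mul_zero]
    · rw [ih (u.card + 1) (by omega) (c ::ₘ u) (by simpa using ⟨hc', hu⟩) (by simp; omega) (by simp),
        ih (u.card + 1) (by omega) (b ::ₘ u) (by simpa using ⟨hb', hu⟩) (by simp; omega) (by simp)]
      simp

/-! ### The scalar Toeplitz-like coefficients -/

theorem charPoly_add (a : ℕ → ℝ) (k d : ℕ) (z : ℂ) :
    charPoly a (k + d) z = charPoly a k z * ∏ i ∈ Finset.range d, (1 - z / (a (k + i) : ℂ)) :=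
  Finset.prod_range_add _ _ _

theorem charPoly_succ (a : ℕ → ℝ) (k : ℕ) (z : ℂ) :
    charPoly a (k + 1) z = charPoly a k z * (1 - z / (a k : ℂ)) := Finset.prod_range_succ _ _

theorem differentiable_charPoly (a : ℕ → ℝ) (k : ℕ) : Differentiable ℂ (charPoly a k) := by
  unfold charPoly
  fun_prop

theorem NodesIn.one_sub_ne_zero (hU : NodesIn a γ U) {z : ℂ} (hz : z ∈ trace γ) (k : ℕ) :
    1 - z / (a k : ℂ) ≠ 0 := by
  intro e
  have h0 : (a k : ℂ) ≠ 0 := by exact_mod_cast hU.node_ne_zero k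
  have : z = a k := (div_eq_one_iff_eq h0).1 (sub_eq_zero.1 e).symm
  exact (hU.node_inside k).1 (this ▸ hz)

theorem NodesIn.charPoly_ne_zero (hU : NodesIn a γ U) {z : ℂ} (hz : z ∈ trace γ) (k : ℕ) :
    charPoly a k z ≠ 0 := Finset.prod_ne_zero_iff.2 fun i _ => hU.one_sub_ne_zero hz i

theorem NodesIn.continuousOn_div_charPoly (hU : NodesIn a γ U) {h : ℂ → ℂ}
    (hh : ContinuousOn h (trace γ)) (m : ℕ) :
    ContinuousOn (fun w => h w / charPoly a m w) (trace γ) :=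
  hh.div (differentiable_charPoly a m).continuous.continuousOn fun _ hw => hU.charPoly_ne_zero hw m

/-- The coefficient of `p_m` in the Newton expansion of `h`. -/
noncomputable def newtonCoeff (a : ℕ → ℝ) (γ : ℝ → ℂ) (h : ℂ → ℂ) (m : ℕ) : ℂ :=
  -(a m : ℂ)⁻¹ * cint γ (fun w => h w / charPoly a (m + 1) w)

theorem NodesIn.newtonCoeff_add (hU : NodesIn a γ U) {g h : ℂ → ℂ} (hg : ContinuousOn g (trace γ))
    (hh : ContinuousOn h (trace γ)) (m : ℕ) :
    newtonCoeff a γ (fun w => g w + h w) m = newtonCoeff a γ g m + newtonCoeff a γ h m := by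
  simp only [newtonCoeff, add_div]
  rw [hU.contour.cint_add (hU.continuousOn_div_charPoly hg _) (hU.continuousOn_div_charPoly hh _)]
  ring

theorem newtonCoeff_const_mul (c : ℂ) (h : ℂ → ℂ) (m : ℕ) :
    newtonCoeff a γ (fun w => c * h w) m = c * newtonCoeff a γ h m := by
  simp only [newtonCoeff, mul_div_assoc, cint_const_mul]; ring

theorem NodesIn.newtonCoeff_sum (hU : NodesIn a γ U) {ι : Type*} (s : Finset ι) {F : ι → ℂ → ℂ}
    (hF : ∀ i ∈ s, ContinuousOn (F i) (trace γ)) (m : ℕ) :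
    newtonCoeff a γ (fun w => ∑ i ∈ s, F i w) m = ∑ i ∈ s, newtonCoeff a γ (F i) m := by
  simp only [newtonCoeff, Finset.sum_div]
  rw [hU.contour.cint_sum s (fun i hi => hU.continuousOn_div_charPoly (hF i hi) _), Finset.mul_sum]

/-- $p_{m+1}$ divides $p_k$ when $m<k$, so no pole remains. This is the triangularity of the
Toeplitz-like matrices. -/
theorem NodesIn.newtonCoeff_eq_zero (hU : NodesIn a γ U) {h : ℂ → ℂ} (hh : DifferentiableOn ℂ h U)
    {k m : ℕ} (hkm : m < k) : newtonCoeff a γ (fun w => charPoly a k w * h w) m = 0 := by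
  obtain ⟨d, rfl⟩ := Nat.exists_eq_add_of_lt hkm
  have : cint γ (fun w => charPoly a (m + d + 1) w * h w / charPoly a (m + 1) w) = 0 := by
    rw [cint_congr (G := fun w => (∏ i ∈ Finset.range d, (1 - w / (a (m + 1 + i) : ℂ))) * h w)]
    · refine hU.cint_eq_zero (DifferentiableOn.mul ?_ hh)
      fun_prop
    · intro w hw
      have h1 := hU.charPoly_ne_zero hw (m + 1)
      simp only [show m + d + 1 = m + 1 + d by ring, charPoly_add a (m + 1) d]
      field_simp
  rw [newtonCoeff, this, mul_zero]

/-- For $m=k+d$, the quotient $p_k/p_{m+1}$ is a constant times $d+1$ pole factors, whose integral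
is 1 for $d=0$ and 0 otherwise. -/
theorem NodesIn.newtonCoeff_charPoly (hU : NodesIn a γ U) (k m : ℕ) :
    newtonCoeff a γ (charPoly a k) m = if k = m then 1 else 0 := by
  rcases lt_or_ge m k with hlt | hle
  · rw [if_neg hlt.ne']
    simpa using hU.newtonCoeff_eq_zero (h := fun _ => 1) (differentiableOn_const _) hlt
  obtain ⟨d, rfl⟩ := Nat.exists_eq_add_of_le hle
  set s : Multiset ℂ := (Multiset.range (d + 1)).map fun i => (a (k + i) : ℂ) with hs
  have hsin : ∀ b ∈ s, b ∈ inside γ := by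
    intro b hb
    obtain ⟨i, -, rfl⟩ := Multiset.mem_map.1 hb
    exact hU.node_inside _
  have hne : ∀ i, (a i : ℂ) ≠ 0 := fun i => by exact_mod_cast hU.node_ne_zero i
  have e : cint γ (fun w => charPoly a k w / charPoly a (k + d + 1) w) =
      (∏ i ∈ Finset.range (d + 1), (-(a (k + i) : ℂ))) *
        cint γ (fun w => (s.map fun b => (w - b)⁻¹).prod) := by
    rw [← cint_const_mul]
    refine cint_congr fun w hw => ?_
    have h1 := hU.charPoly_ne_zero hw k
    have h2 : ∀ i, w - (a i : ℂ) ≠ 0 := fun i e0 =>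
      (hU.node_inside i).1 (by rw [← sub_eq_zero.1 e0]; exact hw)
    simp only [add_assoc k d 1, charPoly_add a k (d + 1)]
    rw [hs, Multiset.map_map]
    change _ = _ * ∏ i ∈ Finset.range (d + 1), (w - (a (k + i) : ℂ))⁻¹
    rw [← Finset.prod_mul_distrib, div_mul_cancel_left₀ h1, ← Finset.prod_inv_distrib]
    refine Finset.prod_congr rfl fun i _ => ?_
    have h3 := h2 (k + i)
    have h4 := hne (k + i)
    rw [show 1 - w / (a (k + i) : ℂ) = (w - a (k + i)) / (-(a (k + i) : ℂ)) by field_simp; ring,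
      inv_div]
    rfl
  rw [newtonCoeff, e]
  rcases Nat.eq_zero_or_pos d with rfl | hd
  · have h1 : cint γ (fun w => (s.map fun b => (w - b)⁻¹).prod) = 1 := by
      simpa [hs] using cint_inv_sub (hU.node_inside k)
    rw [h1]
    have := hne k
    simp [this]
  · rw [hU.contour.cint_multiset_prod_inv s hsin (by simp [hs]; omega), if_neg (by omega)]
    simp

/-- Newton interpolation with remainder: at each step $g$ is replaced by its divided difference at
the next node, rescaled by $-a_{k+d}$ because $w-a = -a(1-w/a)$. -/
theorem NodesIn.exists_newton (hU : NodesIn a γ U) {h : ℂ → ℂ} (hh : DifferentiableOn ℂ h U)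
    (k d : ℕ) : ∃ (c : ℕ → ℂ) (g : ℂ → ℂ), DifferentiableOn ℂ g U ∧
      ∀ w, charPoly a k w * h w =
        ∑ i ∈ Finset.range d, c i * charPoly a (k + i) w + charPoly a (k + d) w * g w := by
  induction d with
  | zero => exact ⟨0, h, hh, fun w => by simp⟩
  | succ d ih =>
    obtain ⟨c, g, hg, e⟩ := ih
    have h0 : (a (k + d) : ℂ) ≠ 0 := by exact_mod_cast hU.node_ne_zero _
    refine ⟨Function.update c d (g (a (k + d))), fun w => -(a (k + d) : ℂ) * dslope g (a (k + d)) w,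
      (((Complex.differentiableOn_dslope (hU.isOpen.mem_nhds (hU.node_mem _))).2 hg).const_mul _),
      fun w => ?_⟩
    rw [e, Finset.sum_range_succ, Function.update_self, add_assoc]
    congr 1
    · exact Finset.sum_congr rfl fun i hi => by
        rw [Function.update_of_ne (Finset.mem_range.1 hi).ne]
    · have h1 := sub_smul_dslope g (a (k + d) : ℂ) w
      rw [smul_eq_mul] at h1
      have h2 : g w = g (a (k + d)) + (w - a (k + d)) * dslope g (a (k + d)) w := by rw [h1]; ring
      rw [← add_assoc k d 1, charPoly_succ, h2]
      field_simp
      ring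

/-- Expand $p_k g$ up to order $l$: the remainder is divisible by $p_{l+1}$ and stays so after
multiplication by $h$, hence it does not reach the coefficient of $p_l$. -/
theorem NodesIn.newtonCoeff_mul (hU : NodesIn a γ U) {g h : ℂ → ℂ} (hg : DifferentiableOn ℂ g U)
    (hh : DifferentiableOn ℂ h U) (k l n : ℕ) (hl : l < n) :
    newtonCoeff a γ (fun w => charPoly a k w * (g w * h w)) l =
      ∑ m ∈ Finset.range n, newtonCoeff a γ (fun w => charPoly a k w * g w) m *
        newtonCoeff a γ (fun w => charPoly a m w * h w) l := by
  have hpd : ∀ i, DifferentiableOn ℂ (charPoly a i) U := fun i =>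
    (differentiable_charPoly a i).differentiableOn
  rcases lt_or_ge l k with hlt | hle
  · rw [hU.newtonCoeff_eq_zero (h := fun w => g w * h w) (hg.mul hh) hlt]
    refine (Finset.sum_eq_zero fun m _ => ?_).symm
    rcases lt_or_ge m k with h1 | h1
    · rw [hU.newtonCoeff_eq_zero hg h1, zero_mul]
    · rw [hU.newtonCoeff_eq_zero hh (hlt.trans_le h1), mul_zero]
  obtain ⟨d, rfl⟩ := Nat.exists_eq_add_of_le hle
  obtain ⟨c, u, hu, e⟩ := hU.exists_newton hg k (d + 1)
  have hcoef : ∀ m ≤ k + d, newtonCoeff a γ (fun w => charPoly a k w * g w) m =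
      ∑ i ∈ Finset.range (d + 1), if k + i = m then c i else 0 := by
    intro m hm
    simp only [e]
    rw [hU.newtonCoeff_add, hU.newtonCoeff_sum, hU.newtonCoeff_eq_zero hu (by omega), add_zero]
    · refine Finset.sum_congr rfl fun i _ => ?_
      rw [newtonCoeff_const_mul, hU.newtonCoeff_charPoly]
      simp
    · exact fun i _ => (hU.continuousOn (hpd _)).const_smul (c i)
    · exact continuousOn_finsetSum _ fun i _ => (hU.continuousOn (hpd _)).const_smul (c i)
    · exact hU.continuousOn ((hpd _).mul hu)
  have hL : newtonCoeff a γ (fun w => charPoly a k w * (g w * h w)) (k + d) =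
      ∑ i ∈ Finset.range (d + 1), c i * newtonCoeff a γ (fun w => charPoly a (k + i) w * h w) (k + d) := by
    have e' : ∀ w, charPoly a k w * (g w * h w) = (∑ i ∈ Finset.range (d + 1),
        c i * (charPoly a (k + i) w * h w)) + charPoly a (k + (d + 1)) w * (u w * h w) := by
      intro w
      rw [← mul_assoc, e, add_mul, Finset.sum_mul]
      simp only [mul_assoc]
    simp only [e']
    rw [hU.newtonCoeff_add, hU.newtonCoeff_sum, hU.newtonCoeff_eq_zero (h := fun w => u w * h w) (hu.mul hh) (by omega), add_zero]
    · simp only [newtonCoeff_const_mul]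
    · exact fun i _ => (hU.continuousOn ((hpd _).mul hh)).const_smul (c i)
    · exact continuousOn_finsetSum _ fun i _ => (hU.continuousOn ((hpd _).mul hh)).const_smul (c i)
    · exact hU.continuousOn ((hpd _).mul (hu.mul hh))
  have hR : ∀ m ∈ Finset.range n, newtonCoeff a γ (fun w => charPoly a k w * g w) m *
      newtonCoeff a γ (fun w => charPoly a m w * h w) (k + d) =
      ∑ i ∈ Finset.range (d + 1), if k + i = m then
        c i * newtonCoeff a γ (fun w => charPoly a m w * h w) (k + d) else 0 := by
    intro m _
    rcases le_or_gt m (k + d) with hm | hm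
    · rw [hcoef m hm, Finset.sum_mul]
      exact Finset.sum_congr rfl fun i _ => by split_ifs <;> simp
    · rw [hU.newtonCoeff_eq_zero hh hm]; simp
  rw [hL, Finset.sum_congr rfl hR, Finset.sum_comm]
  refine Finset.sum_congr rfl fun i hi => ?_
  rw [Finset.sum_ite_eq, if_pos]
  rw [Finset.mem_range] at hi ⊢
  omega

/-! ### The Toeplitz-like matrices -/

variable {p : ℕ}

theorem symbolProd_self (f : ℕ → ℂ → Matrix (Fin p) (Fin p) ℂ) (r : ℕ) :
    symbolProd f r r = fun _ => 1 := by
  funext z; simp [symbolProd]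

theorem symbolProd_succ (f : ℕ → ℂ → Matrix (Fin p) (Fin p) ℂ) (r : ℕ) :
    symbolProd f r (r + 1) = f r := by
  funext z; simp [symbolProd]

theorem symbolProd_mul (f : ℕ → ℂ → Matrix (Fin p) (Fin p) ℂ) {r s t : ℕ} (hrs : r ≤ s)
    (hst : s ≤ t) : symbolProd f r t = fun z => symbolProd f r s z * symbolProd f s t z := by
  funext z
  obtain ⟨u, rfl⟩ := Nat.exists_eq_add_of_le hrs
  obtain ⟨v, rfl⟩ := Nat.exists_eq_add_of_le hst
  rw [symbolProd, symbolProd, symbolProd, ← List.prod_append, ← List.map_append]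
  congr 2
  rw [Nat.add_sub_cancel_left, Nat.add_sub_cancel_left, List.range'_append_1]
  congr 1; omega

theorem differentiableOn_symbolProd {f : ℕ → ℂ → Matrix (Fin p) (Fin p) ℂ} {L : ℕ}
    (hf : ∀ r < L, ∀ i j, DifferentiableOn ℂ (fun z => f r z i j) U) {r s : ℕ} (hrs : r ≤ s)
    (hs : s ≤ L) (i j : Fin p) : DifferentiableOn ℂ (fun z => symbolProd f r s z i j) U := by
  induction s, hrs using Nat.le_induction generalizing i j with
  | base => rw [symbolProd_self]; exact differentiableOn_const _
  | succ s hrs ih =>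
    rw [symbolProd_mul f hrs s.le_succ, symbolProd_succ]
    simp only [Matrix.mul_apply]
    exact DifferentiableOn.fun_sum fun l _ => (ih (by omega) i l).mul (hf s (by omega) l j)

variable [NeZero p]

theorem toeplitz_eq (f : ℂ → Matrix (Fin p) (Fin p) ℂ) (x y : ℕ) :
    toeplitz a γ f x y = newtonCoeff a γ
      (fun w => charPoly a (x / p) w * f w (Fin.ofNat p x) (Fin.ofNat p y)) (y / p) := by
  rw [toeplitz, newtonCoeff, cint]
  have : ∀ w, charPoly a (x / p) w / charPoly a (y / p + 1) w * f w (Fin.ofNat p x) (Fin.ofNat p y) =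
      charPoly a (x / p) w * f w (Fin.ofNat p x) (Fin.ofNat p y) / charPoly a (y / p + 1) w :=
    fun w => div_mul_eq_mul_div _ _ _
  simp only [this]
  ring

theorem NodesIn.toeplitz_eq_zero (hU : NodesIn a γ U) {f : ℂ → Matrix (Fin p) (Fin p) ℂ}
    (hf : ∀ i j, DifferentiableOn ℂ (fun z => f z i j) U) {x y : ℕ} (hxy : y / p < x / p) :
    toeplitz a γ f x y = 0 := by
  rw [toeplitz_eq, hU.newtonCoeff_eq_zero (hf _ _) hxy]

theorem eq_iff_div_ofNat (x y : ℕ) : x = y ↔ x / p = y / p ∧ Fin.ofNat p x = Fin.ofNat p y := by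
  constructor
  · rintro rfl; simp
  · rintro ⟨h1, h2⟩
    have h3 : x % p = y % p := congrArg Fin.val h2
    rw [← Nat.div_add_mod x p, ← Nat.div_add_mod y p, h1, h3]

theorem NodesIn.toeplitz_one (hU : NodesIn a γ U) (x y : ℕ) :
    toeplitz a γ (fun _ => (1 : Matrix (Fin p) (Fin p) ℂ)) x y = if x = y then 1 else 0 := by
  rw [toeplitz_eq]
  simp only [mul_comm (charPoly a _ _), newtonCoeff_const_mul]
  rw [hU.newtonCoeff_charPoly, Matrix.one_apply]
  simp only [eq_iff_div_ofNat (p := p) x y]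
  split_ifs <;> simp_all

theorem sum_fin_mul_eq {p Q : ℕ} (F : Fin (Q * p) → ℂ) (G : ℕ → Fin p → ℂ) [NeZero p]
    (hFG : ∀ x, F x = G (x / p) (Fin.ofNat p x)) :
    ∑ x, F x = ∑ m ∈ Finset.range Q, ∑ j, G m j := by
  rw [← finProdFinEquiv.sum_comp, Fintype.sum_prod_type, Finset.sum_range]
  refine Finset.sum_congr rfl fun m _ => Finset.sum_congr rfl fun j _ => ?_
  have hp := NeZero.pos p
  rw [hFG]
  congr 1
  · simp only [finProdFinEquiv_apply_val]
    rw [Nat.add_mul_div_left _ _ hp, Nat.div_eq_of_lt j.2, zero_add]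
  · ext
    simp [Fin.ofNat, Nat.mod_eq_of_lt j.2]

/-- The scalar composition rule, summed over residues modulo `p`. Truncation loses nothing:
intermediate blocks beyond the block of `y` contribute 0 by triangularity. -/
theorem NodesIn.toeplitz_mul (hU : NodesIn a γ U) {f g : ℂ → Matrix (Fin p) (Fin p) ℂ}
    (hf : ∀ i j, DifferentiableOn ℂ (fun z => f z i j) U)
    (hg : ∀ i j, DifferentiableOn ℂ (fun z => g z i j) U) (Q x y : ℕ) (hy : y / p < Q) :
    toeplitz a γ (fun z => f z * g z) x y =
      ∑ v : Fin (Q * p), toeplitz a γ f x v * toeplitz a γ g v y := by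
  rw [sum_fin_mul_eq _ (fun m j =>
    newtonCoeff a γ (fun w => charPoly a (x / p) w * f w (Fin.ofNat p x) j) m *
    newtonCoeff a γ (fun w => charPoly a m w * g w j (Fin.ofNat p y)) (y / p))
    (fun v => by rw [toeplitz_eq, toeplitz_eq]), Finset.sum_comm, toeplitz_eq]
  simp only [Matrix.mul_apply, Finset.mul_sum]
  rw [hU.newtonCoeff_sum]
  · exact Finset.sum_congr rfl fun j _ => hU.newtonCoeff_mul (hf _ _) (hg _ _) _ _ Q hy
  · exact fun j _ => hU.continuousOn
      (((differentiable_charPoly a _).differentiableOn).mul ((hf _ _).mul (hg _ _)))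

/-- The truncated Toeplitz-like matrix of `f_r ⋯ f_{s-1}`. -/
noncomputable def truncated (a : ℕ → ℝ) (γ : ℝ → ℂ) (f : ℕ → ℂ → Matrix (Fin p) (Fin p) ℂ)
    (Q r s : ℕ) : Matrix (Fin (Q * p)) (Fin (Q * p)) ℂ :=
  Matrix.of fun x y => toeplitz a γ (symbolProd f r s) x y

theorem NodesIn.truncated_self (hU : NodesIn a γ U) (f : ℕ → ℂ → Matrix (Fin p) (Fin p) ℂ) (Q r : ℕ) :
    truncated a γ f Q r r = 1 := by
  ext x y
  rw [truncated, Matrix.of_apply, symbolProd_self, hU.toeplitz_one, Matrix.one_apply]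
  simp only [Fin.ext_iff]

theorem NodesIn.truncated_mul (hU : NodesIn a γ U) {f : ℕ → ℂ → Matrix (Fin p) (Fin p) ℂ} {L : ℕ}
    (hf : ∀ r < L, ∀ i j, DifferentiableOn ℂ (fun z => f r z i j) U) (Q : ℕ) {r s t : ℕ}
    (hrs : r ≤ s) (hst : s ≤ t) (ht : t ≤ L) :
    truncated a γ f Q r t = truncated a γ f Q r s * truncated a γ f Q s t := by
  ext x y
  rw [Matrix.mul_apply, truncated, Matrix.of_apply, symbolProd_mul f hrs hst,
    hU.toeplitz_mul (differentiableOn_symbolProd hf hrs (hst.trans ht))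
      (differentiableOn_symbolProd hf hst ht) Q]
  · rfl
  · rw [Nat.div_lt_iff_lt_mul (NeZero.pos p)]; exact y.2

end

/-! ### Compound matrices and the Cauchy-Binet formula -/

/-- Row $i$ of $AB$ is a combination of rows of $B$; expand by multilinearity. -/
theorem det_mul_eq_sum_functions {R ι κ : Type*} [CommRing R] [Fintype ι] [DecidableEq ι] [Fintype κ]
    (A : Matrix ι κ R) (B : Matrix κ ι R) :
    (A * B).det = ∑ f : ι → κ, (∏ i, A i (f i)) * (B.submatrix f id).det := by
  classical
  have h1 : (A * B).det = Matrix.detRowAlternating (fun i => ∑ s, A i s • B s) := by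
    change Matrix.det _ = Matrix.det _
    congr 1
    ext i j
    simp [Matrix.mul_apply, Finset.sum_apply]
  rw [h1, ← AlternatingMap.coe_multilinearMap, MultilinearMap.map_sum]
  refine Finset.sum_congr rfl fun f _ => ?_
  rw [MultilinearMap.map_smul_univ, smul_eq_mul]
  rfl

/-- The Cauchy-Binet formula. -/
theorem det_mul_eq_sum_strictMono {R : Type*} [CommRing R] {n S : ℕ}
    (A : Matrix (Fin n) (Fin S) R) (B : Matrix (Fin S) (Fin n) R)
    [Fintype {x : Fin n → Fin S // StrictMono x}] :
    (A * B).det = ∑ x : {x : Fin n → Fin S // StrictMono x},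
      (A.submatrix id x.1).det * (B.submatrix x.1 id).det := by
  classical
  have h1 : ∀ x : {x : Fin n → Fin S // StrictMono x},
      (A.submatrix id x.1).det * (B.submatrix x.1 id).det =
      ∑ σ : Equiv.Perm (Fin n), (∏ i, A i (x.1 (σ i))) * (B.submatrix (x.1 ∘ σ) id).det := by
    intro x
    rw [← Matrix.det_transpose (A.submatrix id x.1), Matrix.det_apply', Finset.sum_mul]
    refine Finset.sum_congr rfl fun σ _ => ?_
    have : (B.submatrix (x.1 ∘ σ) id).det =
        ((Equiv.Perm.sign σ : ℤ) : R) * (B.submatrix x.1 id).det := by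
      rw [← Matrix.det_permute]; rfl
    rw [this]
    simp only [Matrix.transpose_apply, Matrix.submatrix_apply, id]
    ring
  rw [det_mul_eq_sum_functions, Finset.sum_congr rfl fun x _ => h1 x, ← Fintype.sum_prod_type']
  symm
  -- An injective index map is uniquely an increasing one composed with a permutation; a
  -- non-injective one repeats a row of `B`.
  refine Finset.sum_of_injOn (fun q => q.1.1 ∘ q.2) ?_ (fun _ _ => Finset.mem_coe.2 (Finset.mem_univ _)) ?_ ?_
  · rintro ⟨x, σ⟩ _ ⟨y, τ⟩ _ h
    have hr : Set.range x.1 = Set.range y.1 := by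
      have := congrArg Set.range h
      simpa [Set.range_comp] using this
    have hxy : x = y := Subtype.ext ((StrictMono.range_inj x.2 y.2).1 hr)
    subst hxy
    refine Prod.ext rfl (Equiv.ext fun i => x.2.injective (congrFun h i))
  · intro f _ hf
    by_cases hinj : Function.Injective f
    · refine absurd ⟨(⟨f ∘ Tuple.sort f, (Tuple.monotone_sort f).strictMono_of_injective
        (hinj.comp (Tuple.sort f).injective)⟩, (Tuple.sort f)⁻¹), by simp, ?_⟩ hf
      funext i
      simp
    · obtain ⟨i, j, hij, hne⟩ : ∃ i j, f i = f j ∧ i ≠ j := by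
        simpa [Function.Injective] using hinj
      rw [Matrix.det_zero_of_row_eq hne (by ext k; simp [hij]), mul_zero]
  · intro q _
    rfl

/-- The compound matrix of minors of order `n`. -/
noncomputable def compound {R : Type*} [CommRing R] {S : ℕ} (n : ℕ) (T : Matrix (Fin S) (Fin S) R) :
    Matrix {x : Fin n → Fin S // StrictMono x} {x : Fin n → Fin S // StrictMono x} R :=
  Matrix.of fun x y => (T.submatrix x.1 y.1).det

theorem compound_one {R : Type*} [CommRing R] {n S : ℕ}
    [DecidableEq {x : Fin n → Fin S // StrictMono x}] :
    compound n (1 : Matrix (Fin S) (Fin S) R) = 1 := by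
  ext x y
  rw [compound, Matrix.of_apply, Matrix.one_apply]
  split_ifs with h
  · subst h
    have : (1 : Matrix (Fin S) (Fin S) R).submatrix x.1 x.1 = 1 := Matrix.submatrix_one _ x.2.injective
    rw [this, Matrix.det_one]
  · have : Set.range x.1 ≠ Set.range y.1 := fun e => h (Subtype.ext ((StrictMono.range_inj x.2 y.2).1 e))
    -- Two different sets of `n` sites: some point of the first is missing from the second, which
    -- yields a zero row.
    have hex : ∃ i, ∀ j, x.1 i ≠ y.1 j := by
      by_contra! hcon
      have hsub : Finset.univ.image x.1 ⊆ Finset.univ.image y.1 := by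
        intro v hv
        obtain ⟨i, -, rfl⟩ := Finset.mem_image.1 hv
        obtain ⟨j, hj⟩ := hcon i
        exact Finset.mem_image.2 ⟨j, Finset.mem_univ _, hj.symm⟩
      have := Finset.eq_of_subset_of_card_le hsub (by
        rw [Finset.card_image_of_injective _ x.2.injective, Finset.card_image_of_injective _ y.2.injective])
      apply_fun (fun s : Finset (Fin S) => (s : Set (Fin S))) at this
      simp at this
      contradiction
    obtain ⟨i, hi⟩ := hex
    exact Matrix.det_eq_zero_of_row_eq_zero i fun j => by simp [hi j]

theorem compound_mul {R : Type*} [CommRing R] {n S : ℕ} (A B : Matrix (Fin S) (Fin S) R)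
    [Fintype {x : Fin n → Fin S // StrictMono x}] :
    compound n (A * B) = compound n A * compound n B := by
  ext x y
  rw [Matrix.mul_apply, compound, Matrix.of_apply,
    show (A * B).submatrix x.1 y.1 = A.submatrix x.1 id * B.submatrix id y.1 from
      Matrix.submatrix_mul _ _ _ _ _ Function.bijective_id, det_mul_eq_sum_strictMono]
  rfl

theorem compound_diagonal_mul {R : Type*} [CommRing R] {n S : ℕ} (d : Fin S → R)
    (T : Matrix (Fin S) (Fin S) R) (x y : {x : Fin n → Fin S // StrictMono x}) :
    compound n (Matrix.diagonal d * T) x y = (∏ j, d (x.1 j)) * compound n T x y := by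
  rw [compound, Matrix.of_apply, compound, Matrix.of_apply, ← Matrix.det_mul_column]
  congr 1
  ext i j
  simp [Matrix.diagonal_mul]

/-! ### Sums over paths -/

/-- The product `C_0 ⋯ C_{m-1}`. -/
noncomputable def chain {R ι : Type*} [CommRing R] [Fintype ι] [DecidableEq ι] (C : ℕ → Matrix ι ι R) :
    ℕ → Matrix ι ι R
  | 0 => 1
  | m + 1 => chain C m * C m

/-- The path through `x` with the prescribed end points. -/
def pathThrough {ι : Type*} {m : ℕ} (s e : ι) (x : Fin m → ι) (t : ℕ) : ι :=
  if h : t ∈ Set.Icc 1 m then x ⟨t - 1, by have := h.1; have := h.2; omega⟩ else if t = 0 then s else e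

/-- The position at the last intermediate time is the summation index of the last matrix product. -/
theorem sum_pathThrough {R ι : Type*} [CommRing R] [Fintype ι] [DecidableEq ι]
    (C : ℕ → Matrix ι ι R) (m : ℕ) (s e : ι) :
    ∑ x : Fin m → ι, ∏ r ∈ Finset.range (m + 1), C r (pathThrough s e x r) (pathThrough s e x (r + 1)) =
      chain C (m + 1) s e := by
  induction m generalizing e with
  | zero => simp [chain, pathThrough]
  | succ m ih =>
    rw [chain, Matrix.mul_apply, ← (Fin.snocEquiv (fun _ => ι)).sum_comp, Fintype.sum_prod_type]
    refine Finset.sum_congr rfl fun y _ => ?_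
    rw [← ih y, Finset.sum_mul]
    refine Finset.sum_congr rfl fun x _ => ?_
    have h1 : ∀ r ≤ m + 1, pathThrough s e (Fin.snocEquiv (fun _ => ι) (y, x)) r = pathThrough s y x r := by
      intro r hr
      rcases Nat.eq_zero_or_pos r with rfl | hr0
      · simp [pathThrough]
      · rcases hr.lt_or_eq with hlt | rfl
        · have e1 : r ∈ Set.Icc 1 m := ⟨hr0, by omega⟩
          have e2 : r ∈ Set.Icc 1 (m + 1) := ⟨hr0, by omega⟩
          simp only [pathThrough, dif_pos e1, dif_pos e2]
          exact Fin.snoc_castSucc (α := fun _ => ι) y x ⟨r - 1, by omega⟩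
        · have e1 : m + 1 ∉ Set.Icc 1 m := fun h => by have := h.2; omega
          have e2 : m + 1 ∈ Set.Icc 1 (m + 1) := ⟨by omega, le_rfl⟩
          simp only [pathThrough, dif_neg e1, dif_pos e2]
          rw [if_neg (by omega)]
          exact Fin.snoc_last (α := fun _ => ι) y x
    have h2 : pathThrough s e (Fin.snocEquiv (fun _ => ι) (y, x)) (m + 1 + 1) = e := by
      have e1 : m + 1 + 1 ∉ Set.Icc 1 (m + 1) := fun h => by have := h.2; omega
      simp only [pathThrough, dif_neg e1]
      rw [if_neg (by omega)]
    have h3 : pathThrough s y x (m + 1) = y := by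
      have e1 : m + 1 ∉ Set.Icc 1 m := fun h => by have := h.2; omega
      simp only [pathThrough, dif_neg e1]
      rw [if_neg (by omega)]
    rw [Finset.prod_range_succ _ (m + 1), h2, h1 (m + 1) le_rfl, h3]
    congr 1
    refine Finset.prod_congr rfl fun r hr => ?_
    rw [Finset.mem_range] at hr
    rw [h1 r hr.le, h1 (r + 1) hr]

theorem compound_chain {R : Type*} [CommRing R] {n S : ℕ} (C : ℕ → Matrix (Fin S) (Fin S) R)
    [Fintype {x : Fin n → Fin S // StrictMono x}] [DecidableEq {x : Fin n → Fin S // StrictMono x}] (m : ℕ) :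
    chain (fun r => compound n (C r)) m = compound n (chain C m) := by
  induction m with
  | zero => rw [chain, chain, compound_one]
  | succ m ih => rw [chain, chain, compound_mul, ih]

/-- The configuration at time `t` of a family of paths with prescribed end points. -/
def configAt {ι : Type*} {L : ℕ} (s e : ι) (c : Set.Icc 1 (L - 1) → ι) (t : ℕ) : ι :=
  if h : t ∈ Set.Icc 1 (L - 1) then c ⟨t, h⟩ else if t = 0 then s else e

theorem sum_configAt {R ι : Type*} [CommRing R] [Fintype ι] [DecidableEq ι]
    (C : ℕ → Matrix ι ι R) {L : ℕ} (hL : 1 ≤ L) (s e : ι) :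
    ∑ c : Set.Icc 1 (L - 1) → ι, ∏ r ∈ Finset.range L, C r (configAt s e c r) (configAt s e c (r + 1)) =
      chain C L s e := by
  obtain ⟨m, rfl⟩ := Nat.exists_eq_add_of_le' hL
  rw [← sum_pathThrough]
  let E : Fin m ≃ Set.Icc 1 (m + 1 - 1) :=
    { toFun := fun i => ⟨i + 1, ⟨by omega, by have := i.2; omega⟩⟩
      invFun := fun t => ⟨t.1 - 1, by have := t.2.1; have := t.2.2; omega⟩
      left_inv := fun i => by simp
      right_inv := fun t => by ext; have := t.2.1; simp; omega }
  refine Fintype.sum_equiv (E.arrowCongr (Equiv.refl ι)).symm _ _ fun c => ?_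
  have : ∀ t, configAt s e c t = pathThrough s e ((E.arrowCongr (Equiv.refl ι)).symm c) t := by
    intro t
    unfold configAt pathThrough
    by_cases h : t ∈ Set.Icc 1 m
    · have h' : t ∈ Set.Icc 1 (m + 1 - 1) := h
      rw [dif_pos h, dif_pos h']
      simp only [Equiv.arrowCongr_symm, Equiv.arrowCongr_apply, Function.comp, Equiv.refl_symm, Equiv.refl_apply]
      congr 1
      ext
      have := h.1
      simp [E]
      omega
    · have h' : t ∉ Set.Icc 1 (m + 1 - 1) := h
      rw [dif_neg h, dif_neg h']
  simp only [this]

/-! ### Determinants and principal minors -/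

/-- By multilinearity each row comes from either summand; choosing identity rows off $A$ leaves the
principal minor on $A$. -/
theorem det_one_add_diagonal_mul {R V : Type*} [CommRing R] [Fintype V] [DecidableEq V]
    (K : Matrix V V R) (B : Finset V) :
    (1 + Matrix.diagonal (fun v => if v ∈ B then (1 : R) else 0) * K).det =
      ∑ A ∈ B.powerset, (K.submatrix (fun v : A => (v : V)) (fun v : A => (v : V))).det := by
  have h1 : (1 + Matrix.diagonal (fun v => if v ∈ B then (1 : R) else 0) * K).det =
      Matrix.detRowAlternating ((fun i => (Matrix.diagonal (fun v => if v ∈ B then (1 : R) else 0) * K) i) +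
        fun i => (1 : Matrix V V R) i) := by
    rw [add_comm]; rfl
  rw [h1, ← AlternatingMap.coe_multilinearMap, MultilinearMap.map_add_univ]
  symm
  refine Finset.sum_subset_zero_on_sdiff (Finset.subset_univ _) ?_ ?_
  · intro s hs
    have hsB : ¬ s ⊆ B := by simpa using hs
    obtain ⟨i, his, hiB⟩ := Finset.not_subset.1 hsB
    refine Matrix.det_eq_zero_of_row_eq_zero i fun j => ?_
    simp [Finset.piecewise, his, hiB]
  · intro s hs
    rw [Finset.mem_powerset] at hs
    rw [← Matrix.det_piecewise_one_eq_submatrix_det]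
    change _ = Matrix.det _
    congr 1
    ext i j
    by_cases hi : i ∈ s
    · simp [Finset.piecewise, hi, hs hi]
    · simp [Finset.piecewise, hi]

/-- Inversion over subsets, by strong induction. -/
theorem eq_of_sum_powerset_eq {V M : Type*} [DecidableEq V] [AddCommGroup M] {F G : Finset V → M}
    (h : ∀ B : Finset V, ∑ A ∈ B.powerset, F A = ∑ A ∈ B.powerset, G A) (B : Finset V) : F B = G B := by
  induction B using Finset.strongInduction with
  | H B ih =>
    have hB := h B
    rw [← Finset.add_sum_erase _ F (Finset.mem_powerset_self B),
      ← Finset.add_sum_erase _ G (Finset.mem_powerset_self B)] at hB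
    have : ∑ A ∈ B.powerset.erase B, F A = ∑ A ∈ B.powerset.erase B, G A :=
      Finset.sum_congr rfl fun A hA => ih A (Finset.mem_ssubsets.1 hA)
    rw [this] at hB
    exact add_right_cancel hB

theorem det_one_sub_of_strictUpper {V α : Type*} [Fintype V] [DecidableEq V] [LinearOrder α]
    (b : V → α) (W : Matrix V V ℂ) (hW : ∀ i j, ¬ b i < b j → W i j = 0) : (1 - W).det = 1 := by
  have hbt : Matrix.BlockTriangular (1 - W) b := by
    intro i j hij
    rw [Matrix.sub_apply, hW i j hij.not_gt, Matrix.one_apply_ne (fun e => by rw [e] at hij; exact lt_irrefl _ hij),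
      sub_zero]
  rw [hbt.det]
  refine Finset.prod_eq_one fun k _ => ?_
  have : (1 - W).toSquareBlock b k = 1 := by
    ext i j
    rw [Matrix.toSquareBlock_def, Matrix.of_apply, Matrix.sub_apply, hW _ _ (by rw [i.2, j.2]; exact lt_irrefl _),
      sub_zero, Matrix.one_apply, Matrix.one_apply]
    simp only [Subtype.ext_iff]
  rw [this, Matrix.det_one]

/-! ### Determinantal correlations of non-intersecting paths -/

section Correlation

variable {S n L : ℕ}

/-- The transition matrices between times `r ≤ s` of a family of composable matrices. -/
structure IsFlow (L : ℕ) (T : ℕ → ℕ → Matrix (Fin S) (Fin S) ℂ) : Prop where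
  self : ∀ r, T r r = 1
  mul : ∀ r s t, r ≤ s → s ≤ t → t ≤ L → T r t = T r s * T s t

/-- The correlation matrix of the paths, indexed by times and sites. -/
noncomputable def pathKernel (L : ℕ) (T : ℕ → ℕ → Matrix (Fin S) (Fin S) ℂ) (s e : Fin n → Fin S)
    (u v : Set.Icc 1 (L - 1) × Fin S) : ℂ :=
  (∑ j, ∑ i, T u.1 L u.2 (e j) * ((T 0 L).submatrix s e)⁻¹ j i * T 0 v.1 (s i) v.2) -
    if u.1 < v.1 then T u.1 v.1 u.2 v.2 else 0

/-- The weight of a family of paths. -/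
noncomputable def configWeight (T : ℕ → ℕ → Matrix (Fin S) (Fin S) ℂ)
    (s e : {x : Fin n → Fin S // StrictMono x})
    (c : Set.Icc 1 (L - 1) → {x : Fin n → Fin S // StrictMono x}) : ℂ :=
  ∏ r ∈ Finset.range L, compound n (T r (r + 1)) (configAt s e c r) (configAt s e c (r + 1))

/-- The points occupied by a family of paths. -/
def occupied (c : Set.Icc 1 (L - 1) → {x : Fin n → Fin S // StrictMono x}) :
    Finset (Set.Icc 1 (L - 1) × Fin S) :=
  Finset.univ.image fun q : Set.Icc 1 (L - 1) × Fin n => (q.1, (c q.1).1 q.2)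

theorem prod_occupied (c : Set.Icc 1 (L - 1) → {x : Fin n → Fin S // StrictMono x})
    (g : Set.Icc 1 (L - 1) × Fin S → ℂ) :
    ∏ v ∈ occupied c, g v = ∏ t, ∏ j, g (t, (c t).1 j) := by
  rw [occupied, Finset.prod_image, Fintype.prod_prod_type]
  rintro ⟨t, i⟩ _ ⟨t', j⟩ _ h
  simp only [Prod.mk.injEq] at h
  obtain ⟨rfl, h⟩ := h
  rw [(c t).2.injective h]

/-- A function on times and sites, extended by zero. -/
noncomputable def extendZero (g : Set.Icc 1 (L - 1) × Fin S → ℂ) (r : ℕ) (x : Fin S) : ℂ :=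
  if h : r ∈ Set.Icc 1 (L - 1) then g (⟨r, h⟩, x) else 0

variable {T : ℕ → ℕ → Matrix (Fin S) (Fin S) ℂ}

/-- The transition matrix of one step, weighted at its initial time. -/
noncomputable def weightedStep (L : ℕ) (T : ℕ → ℕ → Matrix (Fin S) (Fin S) ℂ)
    (g : Set.Icc 1 (L - 1) × Fin S → ℂ) (r : ℕ) : Matrix (Fin S) (Fin S) ℂ :=
  Matrix.diagonal (fun x => 1 + extendZero g r x) * T r (r + 1)

/-- The weights at a time act as a diagonal matrix, whose compound multiplies by the product over
the occupied sites. Since compounds are multiplicative, the sum over all paths is a single minor. -/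
theorem sum_configWeight (hL : 1 ≤ L) (s e : {x : Fin n → Fin S // StrictMono x})
    [Fintype {x : Fin n → Fin S // StrictMono x}]
    (g : Set.Icc 1 (L - 1) × Fin S → ℂ) :
    ∑ c : Set.Icc 1 (L - 1) → {x : Fin n → Fin S // StrictMono x},
      configWeight T s e c * ∏ v ∈ occupied c, (1 + g v) =
      ((chain (weightedStep L T g) L).submatrix s.1 e.1).det := by
  classical
  have h2 : ((chain (weightedStep L T g) L).submatrix s.1 e.1).det =
      chain (fun r => compound n (weightedStep L T g r)) L s e := by
    rw [compound_chain]; rfl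
  rw [h2, ← sum_configAt _ hL]
  refine Finset.sum_congr rfl fun c _ => ?_
  simp only [weightedStep, compound_diagonal_mul]
  rw [Finset.prod_mul_distrib, configWeight, mul_comm, prod_occupied c (fun v => 1 + g v)]
  congr 1
  have hsub : (Finset.Icc 1 (L - 1)) ⊆ Finset.range L := fun r hr => by
    rw [Finset.mem_Icc] at hr; rw [Finset.mem_range]; omega
  rw [← Finset.prod_subset hsub]
  · rw [Finset.prod_subtype (Finset.Icc 1 (L - 1)) (p := fun r => r ∈ Set.Icc 1 (L - 1)) (by simp)]
    refine Finset.prod_congr rfl fun t _ => Finset.prod_congr rfl fun j _ => ?_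
    rw [extendZero, dif_pos t.2, configAt, dif_pos t.2]
  · intro r hr hr'
    refine Finset.prod_eq_one fun j _ => ?_
    have : r ∉ Set.Icc 1 (L - 1) := fun h => hr' (by simpa using h)
    rw [extendZero, dif_neg this, add_zero]

/-- Expand the factors $1+g$ according to the last time $q$ at which $g$ is chosen; from $q$ to $r$
the unweighted steps compose by the flow property. -/
theorem chain_weightedStep (hT : IsFlow L T) (g : Set.Icc 1 (L - 1) × Fin S → ℂ)
    (r : ℕ) (hr : r ≤ L) :
    chain (weightedStep L T g) r = T 0 r +
      ∑ q ∈ Finset.range r, chain (weightedStep L T g) q * Matrix.diagonal (extendZero g q) * T q r := by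
  induction r with
  | zero => simp [chain, hT.self]
  | succ r ih =>
    have hd : Matrix.diagonal (fun x => 1 + extendZero g r x) = 1 + Matrix.diagonal (extendZero g r) := by
      rw [← Matrix.diagonal_one, Matrix.diagonal_add]
    rw [chain, weightedStep, hd, add_mul, one_mul, mul_add, Finset.sum_range_succ, ← add_assoc,
      ← Matrix.mul_assoc]
    congr 1
    nth_rewrite 1 [ih (by omega)]
    rw [add_mul, ← hT.mul 0 r (r + 1) (by omega) (by omega) hr, Finset.sum_mul]
    congr 1
    refine Finset.sum_congr rfl fun q hq => ?_
    rw [Finset.mem_range] at hq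
    rw [Matrix.mul_assoc _ (T q r), ← hT.mul q r (r + 1) (by omega) (by omega) hr]

theorem sum_range_extendZero (F : ℕ → Fin S → ℂ) (g : Set.Icc 1 (L - 1) × Fin S → ℂ)
    (r : ℕ) :
    ∑ q ∈ Finset.range r, ∑ x, F q x * extendZero g q x =
      ∑ v : Set.Icc 1 (L - 1) × Fin S, if v.1.1 < r then F v.1 v.2 * g v else 0 := by
  rw [Fintype.sum_prod_type]
  have h2 : ∑ q ∈ Finset.range r, ∑ x, F q x * extendZero g q x =
      ∑ q ∈ Finset.Icc 1 (L - 1), if q < r then ∑ x, F q x * extendZero g q x else 0 := by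
    rw [← Finset.sum_filter]
    symm
    refine Finset.sum_subset ?_ ?_
    · intro q hq
      rw [Finset.mem_filter] at hq
      exact Finset.mem_range.2 hq.2
    · intro q hq hq'
      rw [Finset.mem_range] at hq
      refine Finset.sum_eq_zero fun x _ => ?_
      have : q ∉ Set.Icc 1 (L - 1) := fun h => hq' (Finset.mem_filter.2 ⟨by simpa using h, hq⟩)
      rw [extendZero, dif_neg this, mul_zero]
  rw [h2, Finset.sum_subtype (Finset.Icc 1 (L - 1)) (p := fun r => r ∈ Set.Icc 1 (L - 1)) (by simp)]
  refine Finset.sum_congr rfl fun t _ => ?_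
  split_ifs with h
  · refine Finset.sum_congr rfl fun x _ => ?_
    rw [extendZero, dif_pos t.2]
  · simp

theorem chain_weightedStep_apply (hT : IsFlow L T) (g : Set.Icc 1 (L - 1) × Fin S → ℂ)
    (r : ℕ) (hr : r ≤ L) (x y : Fin S) :
    chain (weightedStep L T g) r x y = T 0 r x y +
      ∑ v : Set.Icc 1 (L - 1) × Fin S,
        chain (weightedStep L T g) v.1 x v.2 * g v * (if v.1.1 < r then T v.1 r v.2 y else 0) := by
  have h := congrFun (congrFun (chain_weightedStep hT g r hr) x) y
  rw [h, Matrix.add_apply, Matrix.sum_apply]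
  congr 1
  have e : ∀ q, (chain (weightedStep L T g) q * Matrix.diagonal (extendZero g q) * T q r) x y =
      ∑ z, (chain (weightedStep L T g) q x z * T q r z y) * extendZero g q z := by
    intro q
    rw [Matrix.mul_apply]
    refine Finset.sum_congr rfl fun z _ => ?_
    rw [Matrix.mul_diagonal]; ring
  simp only [e]
  rw [sum_range_extendZero (fun q z => chain (weightedStep L T g) q x z * T q r z y) g r]
  refine Finset.sum_congr rfl fun v _ => ?_
  split_ifs
  · ring
  · ring

/-- Let $A$ collect the weighted propagators from the starting points. The last-use expansion reads
$A(1-gW)=\Phi$ and turns the minor into $\det(G+Ag\Psi)$. The identity $\det(1+XY)=\det(1+YX)$ moves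
the determinant to the space of sites. Multiplying by $\det(1-gW)=1$, valid since $W$ strictly
increases time, replaces $A$ by $\Phi$ and produces $1+g(\Psi G^{-1}\Phi-W)$. -/
theorem det_chain_weightedStep (hL : 1 ≤ L) (hT : IsFlow L T) (g : Set.Icc 1 (L - 1) × Fin S → ℂ)
    (s e : Fin n → Fin S) (hG : ((T 0 L).submatrix s e).det ≠ 0) :
    ((chain (weightedStep L T g) L).submatrix s e).det =
      ((T 0 L).submatrix s e).det * (1 + Matrix.diagonal g * Matrix.of (pathKernel L T s e)).det := by
  set G := (T 0 L).submatrix s e with hGdef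
  let A : Matrix (Fin n) (Set.Icc 1 (L - 1) × Fin S) ℂ :=
    Matrix.of fun i v => chain (weightedStep L T g) v.1 (s i) v.2
  let Φ : Matrix (Fin n) (Set.Icc 1 (L - 1) × Fin S) ℂ := Matrix.of fun i v => T 0 v.1 (s i) v.2
  let Ψ : Matrix (Set.Icc 1 (L - 1) × Fin S) (Fin n) ℂ := Matrix.of fun v j => T v.1 L v.2 (e j)
  let W : Matrix (Set.Icc 1 (L - 1) × Fin S) (Set.Icc 1 (L - 1) × Fin S) ℂ :=
    Matrix.of fun u v => if u.1 < v.1 then T u.1 v.1 u.2 v.2 else 0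
  have hlt : ∀ t : Set.Icc 1 (L - 1), t.1 < L := fun t => by have := t.2.2; omega
  have hA : A = Φ + A * Matrix.diagonal g * W := by
    ext i v
    rw [Matrix.add_apply, Matrix.mul_apply]
    simp only [A, Φ, W, Matrix.mul_diagonal, Matrix.of_apply]
    exact chain_weightedStep_apply hT g v.1 (hlt v.1).le _ _
  have hC : (chain (weightedStep L T g) L).submatrix s e = G + A * (Matrix.diagonal g * Ψ) := by
    ext i j
    rw [Matrix.add_apply, ← Matrix.mul_assoc, Matrix.mul_apply, Matrix.submatrix_apply,
      chain_weightedStep_apply hT g L le_rfl]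
    simp only [A, Ψ, Matrix.mul_diagonal, Matrix.of_apply, hlt, if_true]
    rfl
  have hK : Matrix.of (pathKernel L T s e) = Ψ * G⁻¹ * Φ - W := by
    ext u v
    rw [Matrix.sub_apply, Matrix.mul_apply]
    simp only [Matrix.mul_apply, Finset.sum_mul, Matrix.of_apply, pathKernel, Ψ, Φ, W]
    rw [Finset.sum_comm]
  have hW : (1 - Matrix.diagonal g * W).det = 1 := by
    refine det_one_sub_of_strictUpper (fun v => v.1) _ fun u v h => ?_
    rw [Matrix.diagonal_mul]
    simp only [W, Matrix.of_apply, if_neg h, mul_zero]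
  have hGu : IsUnit G.det := isUnit_iff_ne_zero.2 hG
  rw [hC]
  have e1 : G + A * (Matrix.diagonal g * Ψ) = G * (1 + (G⁻¹ * A) * (Matrix.diagonal g * Ψ)) := by
    rw [mul_add, mul_one, Matrix.mul_assoc G⁻¹, Matrix.mul_nonsing_inv_cancel_left _ _ hGu]
  rw [e1, Matrix.det_mul, Matrix.det_one_add_mul_comm, ← mul_one (Matrix.det (1 + _)), ← hW,
    ← Matrix.det_mul, hK]
  congr 2
  have hA' : A * (1 - Matrix.diagonal g * W) = Φ := by
    rw [Matrix.mul_sub, Matrix.mul_one, ← Matrix.mul_assoc]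
    nth_rewrite 1 [hA]
    rw [add_sub_cancel_right]
  rw [add_mul, one_mul, Matrix.mul_assoc, Matrix.mul_assoc G⁻¹, hA', mul_sub]
  simp only [Matrix.mul_assoc]
  abel

/-- The correlation functions of the paths are minors of the correlation matrix. -/
theorem sum_configWeight_occupied (hL : 1 ≤ L) (hT : IsFlow L T)
    (s e : {x : Fin n → Fin S // StrictMono x}) [Fintype {x : Fin n → Fin S // StrictMono x}]
    (hG : ((T 0 L).submatrix s.1 e.1).det ≠ 0) (A : Finset (Set.Icc 1 (L - 1) × Fin S)) :
    ∑ c : Set.Icc 1 (L - 1) → {x : Fin n → Fin S // StrictMono x},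
      (if A ⊆ occupied c then configWeight T s e c else 0) =
      ((T 0 L).submatrix s.1 e.1).det *
        (Matrix.of fun u v : A => pathKernel L T s.1 e.1 u v).det := by
  refine eq_of_sum_powerset_eq (F := fun A => ∑ c : Set.Icc 1 (L - 1) → {x : Fin n → Fin S // StrictMono x},
      (if A ⊆ occupied c then configWeight T s e c else 0))
    (G := fun A => ((T 0 L).submatrix s.1 e.1).det *
        (Matrix.of fun u v : A => pathKernel L T s.1 e.1 u v).det) (fun B => ?_) A
  -- With $g$ the indicator of `B`, the product over occupied points counts the subsets of `B`
  -- contained in the path configuration.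
  have h1 := sum_configWeight (T := T) hL s e (fun v => if v ∈ B then 1 else 0)
  rw [det_chain_weightedStep hL hT _ _ _ hG, det_one_add_diagonal_mul] at h1
  rw [← Finset.mul_sum]
  refine Eq.trans ?_ h1
  rw [Finset.sum_comm]
  refine Finset.sum_congr rfl fun c _ => ?_
  rw [Finset.prod_one_add, Finset.mul_sum]
  rw [← Finset.sum_filter]
  have e1 : ∀ D ∈ (occupied c).powerset, configWeight T s e c * ∏ v ∈ D, (if v ∈ B then (1 : ℂ) else 0) =
      if D ⊆ B then configWeight T s e c else 0 := by
    intro D _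
    by_cases h : D ⊆ B
    · rw [if_pos h, Finset.prod_eq_one fun v hv => if_pos (h hv), mul_one]
    · obtain ⟨v, hv, hvB⟩ := Finset.not_subset.1 h
      rw [if_neg h, Finset.prod_eq_zero hv (if_neg hvB), mul_zero]
  rw [Finset.sum_congr rfl e1, ← Finset.sum_filter]
  refine Finset.sum_congr ?_ fun _ _ => rfl
  ext D
  simp only [Finset.mem_filter, Finset.mem_powerset]
  exact and_comm

end Correlation

/-! ### The law of the non-intersecting paths -/

section Law

variable {a : ℕ → ℝ} {γ : ℝ → ℂ} {U : Set ℂ} {p N M L : ℕ}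
  {f : ℕ → ℂ → Matrix (Fin p) (Fin p) ℂ}

/-- The initial configuration among finitely many sites. -/
def startConfig (p N M Q : ℕ) (hQ : M + N ≤ Q) : {x : Fin (p * N) → Fin (Q * p) // StrictMono x} :=
  ⟨fun j => ⟨j, j.2.trans_le (by rw [mul_comm]; exact Nat.mul_le_mul_right p (by omega))⟩, fun _ _ h => h⟩

/-- The final configuration among finitely many sites. -/
def endConfig (p N M Q : ℕ) (hQ : M + N ≤ Q) : {x : Fin (p * N) → Fin (Q * p) // StrictMono x} :=
  ⟨fun j => ⟨p * M + j, (Nat.add_lt_add_left j.2 _).trans_le (by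
    rw [← mul_add, mul_comm]; exact Nat.mul_le_mul_right p hQ)⟩, fun _ _ h => Nat.add_lt_add_left h _⟩

/-- Configurations of finitely many sites as configurations of `ℤ₊`. -/
def embedConfig {n S L : ℕ} (c : Set.Icc 1 (L - 1) → {x : Fin n → Fin S // StrictMono x})
    (t : Set.Icc 1 (L - 1)) : WeylChamber n :=
  ⟨fun j => (c t).1 j, fun _ _ h => (c t).2 h⟩

theorem embedConfig_injective {n S L : ℕ} : Function.Injective
    (embedConfig : (Set.Icc 1 (L - 1) → {x : Fin n → Fin S // StrictMono x}) → _) := by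
  intro c c' h
  funext t
  ext j
  exact congrFun (congrArg Subtype.val (congrFun h t)) j

theorem pathAt_embedConfig {Q : ℕ} (hQ : M + N ≤ Q)
    (c : Set.Icc 1 (L - 1) → {x : Fin (p * N) → Fin (Q * p) // StrictMono x}) (t : ℕ) (j : Fin (p * N)) :
    pathAt p N M L (embedConfig c) t j =
      (configAt (startConfig p N M Q hQ) (endConfig p N M Q hQ) c t).1 j := by
  unfold pathAt configAt
  split_ifs <;> rfl

variable {Ω : Type*} [MeasurableSpace Ω] {P : Measure Ω} [IsProbabilityMeasure P]
  {X : Set.Icc 1 (L - 1) → Ω → WeylChamber (p * N)} {Z : ℝ}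

theorem measurableSet_path_eq (hX : ∀ t, Measurable (X t)) (x : Set.Icc 1 (L - 1) → WeylChamber (p * N)) :
    MeasurableSet {ω | ∀ t, X t ω = x t} := by
  have : {ω | ∀ t, X t ω = x t} = ⋂ t, X t ⁻¹' {x t} := by ext; simp
  rw [this]
  exact MeasurableSet.iInter fun t => hX t (measurableSet_singleton _)

variable [NeZero p]

theorem NodesIn.isFlow (hU : NodesIn a γ U)
    (hf : ∀ r < L, ∀ i j, DifferentiableOn ℂ (fun z => f r z i j) U) (Q : ℕ) :
    IsFlow L (truncated a γ f Q) :=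
  ⟨hU.truncated_self f Q, fun _ _ _ h1 h2 h3 => hU.truncated_mul hf Q h1 h2 h3⟩

/-- Backwards in time from the fixed end: a nonzero determinant has a nonzero entry in each row, and
by triangularity such an entry cannot lower the block index. -/
theorem NodesIn.pathAt_lt (hU : NodesIn a γ U) (hL : 1 ≤ L)
    (hf : ∀ r < L, ∀ i j, DifferentiableOn ℂ (fun z => f r z i j) U)
    {x : Set.Icc 1 (L - 1) → WeylChamber (p * N)} (hx : pathWeight a γ N M L f x ≠ 0)
    (r : ℕ) (hr : r ≤ L) (j : Fin (p * N)) : pathAt p N M L x r j / p < M + N := by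
  have hp := NeZero.pos p
  induction hr using Nat.decreasingInduction generalizing j with
  | self =>
    have h1 : L ∉ Set.Icc 1 (L - 1) := fun h => by have := h.2; omega
    rw [pathAt, dif_neg h1, if_neg (by omega), Nat.mul_add_div hp, Nat.add_lt_add_iff_left]
    exact Nat.div_lt_of_lt_mul j.2
  | of_succ r hr ih =>
    have hdet := Finset.prod_ne_zero_iff.1 hx r (Finset.mem_range.2 hr)
    obtain ⟨k, hk⟩ : ∃ k, toeplitz a γ (f r) (pathAt p N M L x r j) (pathAt p N M L x (r + 1) k) ≠ 0 := by
      by_contra! h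
      exact hdet (Matrix.det_eq_zero_of_row_eq_zero j h)
    have : ¬ pathAt p N M L x (r + 1) k / p < pathAt p N M L x r j / p := fun h =>
      hk (hU.toeplitz_eq_zero (hf r hr) h)
    exact (not_lt.1 this).trans_lt (ih k)

theorem pathWeight_embedConfig {Q : ℕ} (hQ : M + N ≤ Q)
    (c : Set.Icc 1 (L - 1) → {x : Fin (p * N) → Fin (Q * p) // StrictMono x}) :
    pathWeight a γ N M L f (embedConfig c) =
      configWeight (truncated a γ f Q) (startConfig p N M Q hQ) (endConfig p N M Q hQ) c := by
  unfold pathWeight configWeight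
  refine Finset.prod_congr rfl fun r _ => ?_
  rw [compound, Matrix.of_apply]
  congr 1
  ext i j
  rw [Matrix.of_apply, pathAt_embedConfig hQ, pathAt_embedConfig hQ, Matrix.submatrix_apply, truncated,
    Matrix.of_apply, symbolProd_succ]

/-- Probabilities of events as finite sums. -/
theorem NodesIn.real_event_eq_sum (hU : NodesIn a γ U) (hL : 1 ≤ L)
    (hf : ∀ r < L, ∀ i j, DifferentiableOn ℂ (fun z => f r z i j) U) (hX : ∀ t, Measurable (X t))
    (hlaw : ∀ x : Set.Icc 1 (L - 1) → WeylChamber (p * N),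
      ((P.real {ω | ∀ t, X t ω = x t} : ℝ) : ℂ) = (Z : ℂ)⁻¹ * pathWeight a γ N M L f x)
    {Q : ℕ} (hQ : M + N ≤ Q) [Fintype {x : Fin (p * N) → Fin (Q * p) // StrictMono x}]
    (q : (Set.Icc 1 (L - 1) → WeylChamber (p * N)) → Prop) [DecidablePred q] :
    ((P.real {ω | q fun t => X t ω} : ℝ) : ℂ) = (Z : ℂ)⁻¹ *
      ∑ c : Set.Icc 1 (L - 1) → {x : Fin (p * N) → Fin (Q * p) // StrictMono x},
        if q (embedConfig c) then
          configWeight (truncated a γ f Q) (startConfig p N M Q hQ) (endConfig p N M Q hQ) c else 0 := by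
  classical
  -- Configurations leaving the first `Q` blocks have weight 0, hence probability 0; there are
  -- countably many of them.
  have hnull : ∀ x : Set.Icc 1 (L - 1) → WeylChamber (p * N),
      (∀ c : Set.Icc 1 (L - 1) → {x : Fin (p * N) → Fin (Q * p) // StrictMono x}, embedConfig c ≠ x) →
      P {ω | ∀ t, X t ω = x t} = 0 := by
    intro x hx
    have hw : pathWeight a γ N M L f x = 0 := by
      by_contra hne
      have hlt : ∀ (t : Set.Icc 1 (L - 1)) j, (x t).1 j < Q * p := by
        intro t j
        have h1 := hU.pathAt_lt hL hf hne t.1 (t.2.2.trans (by omega)) j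
        rw [pathAt, dif_pos t.2, Nat.div_lt_iff_lt_mul (NeZero.pos p)] at h1
        exact h1.trans_le (Nat.mul_le_mul_right p hQ)
      exact hx (fun t => ⟨fun j => ⟨(x t).1 j, hlt t j⟩, fun _ _ h => (x t).2 h⟩) rfl
    have h1 := hlaw x
    rw [hw, mul_zero] at h1
    have h2 : P.real {ω | ∀ t, X t ω = x t} = 0 := by exact_mod_cast h1
    rwa [measureReal_eq_zero_iff] at h2
  set E : (Set.Icc 1 (L - 1) → {x : Fin (p * N) → Fin (Q * p) // StrictMono x}) → Set Ω :=
    fun c => {ω | ∀ t, X t ω = embedConfig c t} with hE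
  have hfull : P (⋃ c, E c)ᶜ = 0 := by
    have hsub : (⋃ c, E c)ᶜ ⊆ ⋃ x : {x : Set.Icc 1 (L - 1) → WeylChamber (p * N) //
        ∀ c : Set.Icc 1 (L - 1) → {x : Fin (p * N) → Fin (Q * p) // StrictMono x}, embedConfig c ≠ x},
        {ω | ∀ t, X t ω = x.1 t} := by
      intro ω hω
      simp only [Set.mem_compl_iff, Set.mem_iUnion, not_exists] at hω
      refine Set.mem_iUnion.2 ⟨⟨fun t => X t ω, fun c hc => hω c ?_⟩, fun t => rfl⟩
      intro t; rw [hc]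
    exact measure_mono_null hsub (measure_iUnion_null fun x => hnull x.1 x.2)
  have hdisj : ∀ c c', c ≠ c' → Disjoint (E c) (E c') := by
    intro c c' hcc
    refine Set.disjoint_left.2 fun ω h1 h2 => hcc (embedConfig_injective ?_)
    funext t
    exact (h1 t).symm.trans (h2 t)
  have hqE : ∀ c, {ω | q fun t => X t ω} ∩ E c = if q (embedConfig c) then E c else ∅ := by
    intro c
    ext ω
    have : ω ∈ E c → (fun t => X t ω) = embedConfig c := fun h => funext h
    split_ifs with h
    · exact ⟨fun h' => h'.2, fun h' => ⟨by change q _; rw [this h']; exact h, h'⟩⟩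
    · refine ⟨fun h' => h ?_, fun h' => h'.elim⟩
      rw [← this h'.2]; exact h'.1
  have hmeas : P.real {ω | q fun t => X t ω} = ∑ c, if q (embedConfig c) then P.real (E c) else 0 := by
    have h1 : P {ω | q fun t => X t ω} = P ({ω | q fun t => X t ω} ∩ ⋃ c, E c) :=
      (measure_inter_conull hfull).symm
    rw [measureReal_def, h1, Set.inter_iUnion, ← measureReal_def, measureReal_iUnion_fintype]
    · refine Finset.sum_congr rfl fun c _ => ?_
      rw [hqE]
      split_ifs <;> simp
    · intro c c' hcc
      exact (hdisj c c' hcc).mono Set.inter_subset_right Set.inter_subset_right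
    · intro c
      rw [hqE]
      split_ifs
      · exact measurableSet_path_eq hX _
      · exact MeasurableSet.empty
  rw [hmeas, Finset.mul_sum]
  push_cast
  refine Finset.sum_congr rfl fun c _ => ?_
  split_ifs
  · rw [← pathWeight_embedConfig hQ, ← hlaw]
  · simp

/-- The Gram matrix of the process. -/
noncomputable def gram (a : ℕ → ℝ) (γ : ℝ → ℂ) (N M L : ℕ) (f : ℕ → ℂ → Matrix (Fin p) (Fin p) ℂ) :
    Matrix (Fin (p * N)) (Fin (p * N)) ℂ :=
  Matrix.of fun i j => toeplitz a γ (symbolProd f 0 L) i (p * M + j)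

theorem gram_eq {Q : ℕ} (hQ : M + N ≤ Q) : (truncated a γ f Q 0 L).submatrix
    (startConfig p N M Q hQ).1 (endConfig p N M Q hQ).1 = gram a γ N M L f := rfl

/-- The sure event has probability 1, and for weights $g=0$ the total weight of the paths is the
Gram determinant. -/
theorem NodesIn.det_gram (hU : NodesIn a γ U) (hL : 1 ≤ L)
    (hf : ∀ r < L, ∀ i j, DifferentiableOn ℂ (fun z => f r z i j) U) (hX : ∀ t, Measurable (X t))
    (hZ : 0 < Z) (hlaw : ∀ x : Set.Icc 1 (L - 1) → WeylChamber (p * N),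
      ((P.real {ω | ∀ t, X t ω = x t} : ℝ) : ℂ) = (Z : ℂ)⁻¹ * pathWeight a γ N M L f x) :
    (gram a γ N M L f).det = Z := by
  classical
  have h1 := hU.real_event_eq_sum hL hf hX hlaw (le_refl (M + N)) (fun _ => True)
  have h2 := sum_configWeight (T := truncated a γ f (M + N)) hL (startConfig p N M (M + N) le_rfl)
    (endConfig p N M (M + N) le_rfl) 0
  rw [chain_weightedStep (hU.isFlow hf (M + N)) 0 L le_rfl] at h2
  have h3 : ∀ q, Matrix.diagonal (extendZero (0 : Set.Icc 1 (L - 1) × Fin ((M + N) * p) → ℂ) q) = 0 := by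
    intro q
    rw [Matrix.diagonal_eq_zero]
    funext x
    simp [extendZero]
  simp only [h3, Matrix.mul_zero, Matrix.zero_mul, Finset.sum_const_zero, add_zero, gram_eq,
    Pi.zero_apply, Finset.prod_const_one, mul_one] at h2
  simp only [Set.ofPred_true, probReal_univ, if_true, h2] at h1
  have hZ' : (Z : ℂ) ≠ 0 := by exact_mod_cast hZ.ne'
  field_simp at h1
  simpa using h1.symm

/-- The correlation matrix of the process. -/
noncomputable def siteKernel (a : ℕ → ℝ) (γ : ℝ → ℂ) (N M L : ℕ)
    (f : ℕ → ℂ → Matrix (Fin p) (Fin p) ℂ) (r x s y : ℕ) : ℂ :=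
  (∑ j : Fin (p * N), ∑ i : Fin (p * N), toeplitz a γ (symbolProd f r L) x (p * M + j) *
    (gram a γ N M L f)⁻¹ j i * toeplitz a γ (symbolProd f 0 s) i y) -
    if r < s then toeplitz a γ (symbolProd f r s) x y else 0

theorem NodesIn.correlation_eq_det (hU : NodesIn a γ U) (hL : 1 ≤ L)
    (hf : ∀ r < L, ∀ i j, DifferentiableOn ℂ (fun z => f r z i j) U) (hX : ∀ t, Measurable (X t))
    (hZ : 0 < Z) (hlaw : ∀ x : Set.Icc 1 (L - 1) → WeylChamber (p * N),
      ((P.real {ω | ∀ t, X t ω = x t} : ℝ) : ℂ) = (Z : ℂ)⁻¹ * pathWeight a γ N M L f x)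
    {n : ℕ} (t : Fin n → Set.Icc 1 (L - 1)) (x : Fin n → ℕ)
    (hinj : Function.Injective (fun i => (t i, x i))) :
    ((P.real {ω | ∃ l : Fin n → Fin (p * N), ∀ i, (X (t i) ω).1 (l i) = x i} : ℝ) : ℂ) =
      Matrix.det (Matrix.of fun i j : Fin n => siteKernel a γ N M L f (t j) (x j) (t i) (x i)) := by
  classical
  have hZ' : (Z : ℂ) ≠ 0 := by exact_mod_cast hZ.ne'
  -- Large enough for the end configuration and for every queried site.
  set Q := M + N + (∑ i, x i) + 1 with hQdef
  have hQ : M + N ≤ Q := by omega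
  have hxQ : ∀ i, x i < Q * p := by
    intro i
    have h1 : x i ≤ ∑ i, x i := Finset.single_le_sum (fun _ _ => Nat.zero_le _) (Finset.mem_univ i)
    have h2 : Q * 1 ≤ Q * p := Nat.mul_le_mul_left Q (NeZero.pos p)
    omega
  let v : Fin n → Set.Icc 1 (L - 1) × Fin (Q * p) := fun i => (t i, ⟨x i, hxQ i⟩)
  have hv : Function.Injective v := by
    intro i j h
    simp only [v, Prod.mk.injEq, Fin.mk.injEq] at h
    exact hinj (Prod.ext h.1 h.2)
  let A := Finset.univ.image v
  have hdet := hU.det_gram (M := M) hL hf hX hZ hlaw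
  have h1 := hU.real_event_eq_sum hL hf hX hlaw hQ
    (fun y => ∃ l : Fin n → Fin (p * N), ∀ i, (y (t i)).1 (l i) = x i)
  have h2 := sum_configWeight_occupied hL (hU.isFlow hf Q) (startConfig p N M Q hQ) (endConfig p N M Q hQ)
    (by rw [gram_eq, hdet]; exact hZ') A
  have h3 : ∀ c : Set.Icc 1 (L - 1) → {x : Fin (p * N) → Fin (Q * p) // StrictMono x},
      (∃ l : Fin n → Fin (p * N), ∀ i, (embedConfig c (t i)).1 (l i) = x i) ↔ A ⊆ occupied c := by
    intro c
    rw [← Classical.skolem (p := fun i l => (embedConfig c (t i)).1 l = x i)]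
    simp only [A, Finset.subset_iff, Finset.mem_image, occupied, Finset.mem_univ, true_and, v]
    constructor
    · rintro h _ ⟨i, rfl⟩
      obtain ⟨j, hj⟩ := h i
      exact ⟨(t i, j), Prod.ext rfl (Fin.ext hj)⟩
    · intro h i
      obtain ⟨⟨s, j⟩, hj⟩ := h ⟨i, rfl⟩
      simp only [Prod.mk.injEq] at hj
      obtain ⟨rfl, hj⟩ := hj
      exact ⟨j, congrArg Fin.val hj⟩
  rw [h1]
  simp only [h3]
  rw [h2, gram_eq, hdet, inv_mul_cancel_left₀ hZ']
  let e : Fin n ≃ A := Equiv.ofBijective (fun i => ⟨v i, Finset.mem_image_of_mem _ (Finset.mem_univ i)⟩)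
    ⟨fun i j h => hv (congrArg Subtype.val h), fun ⟨w, hw⟩ => by
      obtain ⟨i, -, rfl⟩ := Finset.mem_image.1 hw
      exact ⟨i, rfl⟩⟩
  -- The statement lists the arguments of `siteKernel` in transposed order, to match `corrKernel`.
  rw [← Matrix.det_submatrix_equiv_self e, ← Matrix.det_transpose]
  rfl

end Law

/-! ### The reproducing kernel -/

section Reproducing

variable {a : ℕ → ℝ} {γ : ℝ → ℂ} {U : Set ℂ} {p N M L : ℕ}
  {f : ℕ → ℂ → Matrix (Fin p) (Fin p) ℂ}

/-- The polynomials `a_{M+l}⁻¹ ∏_{M+l < i < M+N} (1 - z / a_i)`. -/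
noncomputable def dualPoly (a : ℕ → ℝ) (M N l : ℕ) : Polynomial ℂ :=
  Polynomial.C (a (M + l) : ℂ)⁻¹ *
    ∏ i ∈ Finset.Ico (M + l + 1) (M + N), (1 - Polynomial.C (a i : ℂ)⁻¹ * Polynomial.X)

theorem X_mul_dualPoly (ha : ∀ k, a k ≠ 0) {l : ℕ} (hl : l + 1 < N) :
    Polynomial.X * dualPoly a M N (l + 1) =
      (a (M + (l + 1)) : ℂ) • dualPoly a M N (l + 1) - (a (M + l) : ℂ) • dualPoly a M N l := by
  have h1 : (a (M + (l + 1)) : ℂ) ≠ 0 := by exact_mod_cast ha _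
  have h2 : (a (M + l) : ℂ) ≠ 0 := by exact_mod_cast ha _
  have e1 : Polynomial.C (a (M + (l + 1)) : ℂ) * Polynomial.C (a (M + (l + 1)) : ℂ)⁻¹ = 1 := by
    rw [← Polynomial.C_mul, mul_inv_cancel₀ h1, Polynomial.C_1]
  have e2 : Polynomial.C (a (M + l) : ℂ) * Polynomial.C (a (M + l) : ℂ)⁻¹ = 1 := by
    rw [← Polynomial.C_mul, mul_inv_cancel₀ h2, Polynomial.C_1]
  rw [dualPoly, dualPoly, Finset.prod_eq_prod_Ico_succ_bot (show M + l + 1 < M + N by omega)]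
  simp only [Polynomial.smul_eq_C_mul, ← add_assoc] at *
  linear_combination (-∏ i ∈ Finset.Ico (M + l + 1 + 1) (M + N), (1 - Polynomial.C (a i : ℂ)⁻¹ * Polynomial.X)) *
    (e1 - (1 - Polynomial.C (a (M + l + 1) : ℂ)⁻¹ * Polynomial.X) * e2)

/-- Multiplication by $X$ maps the dual polynomial of index $l+1$ into the span of those of index
$l$ and $l+1$. The lower bound on `l` keeps the index positive, as needed at each inductive step. -/
theorem X_pow_mem_span (ha : ∀ k, a k ≠ 0) {k : ℕ} (hk : k < N) :
    (Polynomial.X ^ k : Polynomial ℂ) ∈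
      Submodule.span ℂ (dualPoly a M N '' {l | N ≤ k + 1 + l ∧ l < N}) := by
  induction k with
  | zero =>
    obtain ⟨n, rfl⟩ := Nat.exists_eq_add_of_lt hk
    simp only [zero_add] at *
    have h1 : (a (M + n) : ℂ) ≠ 0 := by exact_mod_cast ha _
    have : (Polynomial.X ^ 0 : Polynomial ℂ) = (a (M + n) : ℂ) • dualPoly a M (n + 1) n := by
      rw [dualPoly, ← add_assoc, Finset.Ico_self, Finset.prod_empty, mul_one, Polynomial.smul_C, smul_eq_mul,
        mul_inv_cancel₀ h1, Polynomial.C_1, pow_zero]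
    rw [this]
    exact Submodule.smul_mem _ _ (Submodule.subset_span ⟨n, ⟨by omega, by omega⟩, rfl⟩)
  | succ k ih =>
    rw [pow_succ']
    have h1 := Submodule.mem_map_of_mem (f := LinearMap.mulLeft ℂ (Polynomial.X : Polynomial ℂ)) (ih (by omega))
    refine (Submodule.map_span_le _ _ _).2 ?_ h1
    rintro _ ⟨l, ⟨hl1, hl2⟩, rfl⟩
    obtain ⟨l, rfl⟩ : ∃ l', l = l' + 1 := ⟨l - 1, by omega⟩
    rw [LinearMap.mulLeft_apply, X_mul_dualPoly ha hl2]
    exact Submodule.sub_mem _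
      (Submodule.smul_mem _ _ (Submodule.subset_span ⟨l + 1, ⟨by omega, hl2⟩, rfl⟩))
      (Submodule.smul_mem _ _ (Submodule.subset_span ⟨l, ⟨by omega, by omega⟩, rfl⟩))

/-- The moment functional of a function on the contour. -/
noncomputable def moment (hγ : IsContour γ) (h : ℂ → ℂ) (hh : ContinuousOn h (trace γ)) :
    Polynomial ℂ →ₗ[ℂ] ℂ where
  toFun S := cint γ (fun s => h s * S.eval s)
  map_add' S T := by
    simp only [Polynomial.eval_add, mul_add]
    exact hγ.cint_add (hh.mul S.continuous.continuousOn) (hh.mul T.continuous.continuousOn)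
  map_smul' c S := by
    simp only [Polynomial.eval_smul, smul_eq_mul, RingHom.id_apply, mul_left_comm _ c, cint_const_mul]

theorem NodesIn.continuousOn_symbolProd (hU : NodesIn a γ U)
    (hf : ∀ r < L, ∀ i j, DifferentiableOn ℂ (fun z => f r z i j) U) {r s : ℕ} (hrs : r ≤ s) (hs : s ≤ L)
    (i j : Fin p) : ContinuousOn (fun z => symbolProd f r s z i j) (trace γ) :=
  hU.continuousOn (differentiableOn_symbolProd hf hrs hs i j)

theorem matrixWeight_apply (z : ℂ) (i j : Fin p) :
    matrixWeight a N M L f z i j = symbolProd f 0 L z i j / charPoly a (M + N) z := by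
  rw [matrixWeight, Matrix.smul_apply, smul_eq_mul, mul_comm, div_eq_mul_inv]

theorem NodesIn.continuousOn_matrixWeight (hU : NodesIn a γ U)
    (hf : ∀ r < L, ∀ i j, DifferentiableOn ℂ (fun z => f r z i j) U) (i j : Fin p) :
    ContinuousOn (fun z => matrixWeight a N M L f z i j) (trace γ) := by
  simp only [matrixWeight_apply]
  exact hU.continuousOn_div_charPoly (hU.continuousOn_symbolProd hf (Nat.zero_le _) le_rfl _ _) _

theorem NodesIn.continuousOn_mul_matrixWeight (hU : NodesIn a γ U)
    (hf : ∀ r < L, ∀ i j, DifferentiableOn ℂ (fun z => f r z i j) U)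
    {A : ℂ → Matrix (Fin p) (Fin p) ℂ} (hA : ∀ i j, Differentiable ℂ (fun z => A z i j)) (α β : Fin p) :
    ContinuousOn (fun s => (A s * matrixWeight a N M L f s) α β) (trace γ) := by
  simp only [Matrix.mul_apply]
  exact continuousOn_finsetSum _ fun i _ =>
    (hA _ _).continuous.continuousOn.mul (hU.continuousOn_matrixWeight hf _ _)

/-- The integrand is a finite sum of products of one-variable functions, so the iterated integral
separates without Fubini. -/
theorem IsContour.cint_double_sum (hγ : IsContour γ) {ι κ : Type*} [Fintype ι] [Fintype κ]
    (c : ι → κ → ℂ) {A : ι → ℂ → ℂ} {B : κ → ℂ → ℂ} (hA : ∀ j, ContinuousOn (A j) (trace γ))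
    (hB : ∀ i, ContinuousOn (B i) (trace γ)) :
    cint γ (fun w => cint γ (fun z => ∑ j, ∑ i, c j i * A j w * B i z)) =
      ∑ j, ∑ i, c j i * cint γ (A j) * cint γ (B i) := by
  have e1 : ∀ w, cint γ (fun z => ∑ j, ∑ i, c j i * A j w * B i z) =
      ∑ j, ∑ i, (c j i * cint γ (B i)) * A j w := by
    intro w
    rw [hγ.cint_sum _ (F := fun j z => ∑ i, c j i * A j w * B i z)
      fun j _ => continuousOn_finsetSum _ fun i _ => continuousOn_const.mul (hB i)]
    refine Finset.sum_congr rfl fun j _ => ?_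
    rw [hγ.cint_sum _ (F := fun i z => c j i * A j w * B i z) fun i _ => continuousOn_const.mul (hB i)]
    refine Finset.sum_congr rfl fun i _ => ?_
    rw [cint_const_mul]
    ring
  simp only [e1]
  rw [hγ.cint_sum _ (F := fun j w => ∑ i, c j i * cint γ (B i) * A j w)
    fun j _ => continuousOn_finsetSum _ fun i _ => continuousOn_const.mul (hA j)]
  refine Finset.sum_congr rfl fun j _ => ?_
  rw [hγ.cint_sum _ (F := fun i w => c j i * cint γ (B i) * A j w) fun i _ => continuousOn_const.mul (hA j)]
  refine Finset.sum_congr rfl fun i _ => ?_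
  rw [cint_const_mul]
  ring

theorem dualPoly_eval (z : ℂ) (l : ℕ) :
    (dualPoly a M N l).eval z = (a (M + l) : ℂ)⁻¹ *
      ∏ i ∈ Finset.Ico (M + l + 1) (M + N), (1 - z / (a i : ℂ)) := by
  rw [dualPoly, Polynomial.eval_mul, Polynomial.eval_C, Polynomial.eval_prod]
  congr 1
  refine Finset.prod_congr rfl fun i _ => ?_
  simp [div_eq_inv_mul]

variable [NeZero p]

/-- Over the common denominator $p_{M+N}$, the factor $1/(a_{M+l}\,p_{M+l+1})$ has numerator
`dualPoly a M N l`. The Toeplitz columns at the end points thus become pairings with the weight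
$1/p_{M+N}$. -/
theorem NodesIn.toeplitz_final (hU : NodesIn a γ U) (g : ℂ → Matrix (Fin p) (Fin p) ℂ) (x : ℕ)
    (j : Fin (p * N)) : toeplitz a γ g x (p * M + j) =
      -cint γ (fun w => g w (Fin.ofNat p x) (Fin.ofNat p j) * (dualPoly a M N (j / p)).eval w *
        (charPoly a (x / p) w / charPoly a (M + N) w)) := by
  have hp := NeZero.pos p
  have h1 : (p * M + j) / p = M + j / p := Nat.mul_add_div hp _ _
  have h2 : Fin.ofNat p (p * M + j) = Fin.ofNat p j := by
    ext; simp [Fin.ofNat]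
  have h3 : (j : ℕ) / p < N := Nat.div_lt_of_lt_mul j.2
  rw [toeplitz_eq, h1, h2, newtonCoeff, neg_mul, ← cint_const_mul]
  congr 1
  refine cint_congr fun w hw => ?_
  have h4 : charPoly a (M + N) w = charPoly a (M + j / p + 1) w *
      ∏ i ∈ Finset.Ico (M + j / p + 1) (M + N), (1 - w / (a i : ℂ)) :=
    (Finset.prod_range_mul_prod_Ico _ (by omega)).symm
  have h5 := hU.charPoly_ne_zero hw (M + N)
  have h6 : ∏ i ∈ Finset.Ico (M + j / p + 1) (M + N), (1 - w / (a i : ℂ)) ≠ 0 := by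
    rw [h4] at h5; exact right_ne_zero_of_mul h5
  simp only [dualPoly_eval, h4]
  generalize ∏ i ∈ Finset.Ico (M + j / p + 1) (M + N), (1 - w / (a i : ℂ)) = q at *
  have h7 := hU.charPoly_ne_zero hw (M + j / p + 1)
  have h8 : (a (M + j / p) : ℂ) ≠ 0 := by exact_mod_cast hU.node_ne_zero _
  field_simp

/-- Row functions dual to the polynomials `dualPoly`. -/
noncomputable def dualRow (a : ℕ → ℝ) (γ : ℝ → ℂ) (N M L : ℕ) (f : ℕ → ℂ → Matrix (Fin p) (Fin p) ℂ)
    (j : Fin (p * N)) (s : ℂ) (β : Fin p) : ℂ :=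
  -∑ i : Fin (p * N), if Fin.ofNat p i = β then (gram a γ N M L f)⁻¹ j i * charPoly a (i / p) s else 0

theorem differentiable_dualRow (j : Fin (p * N)) (β : Fin p) :
    Differentiable ℂ (fun s => dualRow a γ N M L f j s β) := by
  refine Differentiable.neg (Differentiable.fun_sum fun i _ => ?_)
  split_ifs
  · exact (differentiable_charPoly a _).const_mul _
  · exact differentiable_const _

theorem sum_dualRow_mul (j : Fin (p * N)) (s : ℂ) (F : Fin p → ℂ) :
    ∑ β, dualRow a γ N M L f j s β * F β =
      -∑ i : Fin (p * N), (gram a γ N M L f)⁻¹ j i * (charPoly a (i / p) s * F (Fin.ofNat p i)) := by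
  simp only [dualRow, neg_mul, Finset.sum_neg_distrib, Finset.sum_mul, ite_mul, zero_mul]
  rw [Finset.sum_comm]
  simp [mul_assoc]

/-- This is $G^{-1}G=1$ read as an integral; the sign in `dualRow` cancels the one in
`NodesIn.toeplitz_final`. -/
theorem NodesIn.cint_dualRow (hU : NodesIn a γ U)
    (hf : ∀ r < L, ∀ i j, DifferentiableOn ℂ (fun z => f r z i j) U)
    (hdet : (gram a γ N M L f).det ≠ 0) (j j' : Fin (p * N)) :
    cint γ (fun s => (∑ β, dualRow a γ N M L f j s β * matrixWeight a N M L f s β (Fin.ofNat p j')) *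
      (dualPoly a M N (j' / p)).eval s) = if j = j' then 1 else 0 := by
  have hinv : (gram a γ N M L f)⁻¹ * gram a γ N M L f = 1 :=
    Matrix.nonsing_inv_mul _ (isUnit_iff_ne_zero.2 hdet)
  rw [← Matrix.one_apply, ← hinv, Matrix.mul_apply]
  simp only [sum_dualRow_mul, neg_mul, cint_neg, Finset.sum_mul, mul_assoc]
  rw [hU.contour.cint_sum, ← Finset.sum_neg_distrib]
  · refine Finset.sum_congr rfl fun i _ => ?_
    rw [cint_const_mul, gram, Matrix.of_apply, hU.toeplitz_final, mul_neg]
    congr 2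
    refine cint_congr fun s _ => ?_
    simp only [matrixWeight_apply]
    ring
  · intro i _
    exact (((differentiable_charPoly a _).continuous.continuousOn.mul
      ((hU.continuousOn_matrixWeight hf _ _).mul (Polynomial.continuous _).continuousOn))).const_smul
        ((gram a γ N M L f)⁻¹ j i)

/-- Matrix functions whose rows are combinations of the dual rows. -/
noncomputable def dualCombo (a : ℕ → ℝ) (γ : ℝ → ℂ) (N M L : ℕ) (f : ℕ → ℂ → Matrix (Fin p) (Fin p) ℂ)
    (κ : Fin p → Fin (p * N) → ℂ) (s : ℂ) : Matrix (Fin p) (Fin p) ℂ :=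
  Matrix.of fun α β => ∑ j, κ α j * dualRow a γ N M L f j s β

theorem differentiable_dualCombo (κ : Fin p → Fin (p * N) → ℂ) (α β : Fin p) :
    Differentiable ℂ (fun s => dualCombo a γ N M L f κ s α β) := by
  simp only [dualCombo, Matrix.of_apply]
  exact Differentiable.fun_sum fun j _ => (differentiable_dualRow j β).const_mul _

/-- By duality of the rows both functionals agree on the dual polynomials, which span all powers
below $N$. This one statement supplies both block rows of $Y$ and the reproducing kernel. -/
theorem NodesIn.cint_dualCombo (hU : NodesIn a γ U)
    (hf : ∀ r < L, ∀ i j, DifferentiableOn ℂ (fun z => f r z i j) U)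
    (hdet : (gram a γ N M L f).det ≠ 0) {κ : Fin p → Fin (p * N) → ℂ}
    (ℓ : Fin p → Fin p → Polynomial ℂ →ₗ[ℂ] ℂ)
    (hκ : ∀ α j, κ α j = ℓ α (Fin.ofNat p j) (dualPoly a M N (j / p))) (α β : Fin p) {k : ℕ} (hk : k < N) :
    cint γ (fun s => (dualCombo a γ N M L f κ s * matrixWeight a N M L f s) α β * s ^ k) =
      ℓ α β (Polynomial.X ^ k) := by
  have hcont := hU.continuousOn_mul_matrixWeight (N := N) (M := M) hf
    (A := dualCombo a γ N M L f κ) (differentiable_dualCombo κ) α β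
  have hmem : (Polynomial.X ^ k : Polynomial ℂ) ∈ Submodule.span ℂ (dualPoly a M N '' {l | l < N}) :=
    Submodule.span_mono (Set.image_mono fun l hl => hl.2) (X_pow_mem_span hU.node_ne_zero hk)
  have key : Set.EqOn (moment hU.contour _ hcont) (ℓ α β) (dualPoly a M N '' {l | l < N}) := by
    rintro _ ⟨l, hl, rfl⟩
    have hl : l < N := hl
    have hp := NeZero.pos p
    obtain ⟨j', hj1, hj2⟩ : ∃ j' : Fin (p * N), (j' : ℕ) / p = l ∧ Fin.ofNat p j' = β := by
      refine ⟨⟨p * l + β, ?_⟩, ?_, ?_⟩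
      · calc p * l + β < p * l + p := Nat.add_lt_add_left β.2 _
          _ = p * (l + 1) := by ring
          _ ≤ p * N := Nat.mul_le_mul_left p hl
      · simp only [Nat.mul_add_div hp, Nat.div_eq_of_lt β.2, add_zero]
      · ext; simp [Fin.ofNat, Nat.mod_eq_of_lt β.2]
    subst hj1 hj2
    rw [← hκ]
    change cint γ (fun s => (dualCombo a γ N M L f κ s * matrixWeight a N M L f s) α (Fin.ofNat p j') *
      (dualPoly a M N (j' / p)).eval s) = _
    have e : ∀ s, (dualCombo a γ N M L f κ s * matrixWeight a N M L f s) α (Fin.ofNat p j') *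
        (dualPoly a M N (j' / p)).eval s = ∑ j, κ α j *
          ((∑ β, dualRow a γ N M L f j s β * matrixWeight a N M L f s β (Fin.ofNat p j')) *
            (dualPoly a M N (j' / p)).eval s) := by
      intro s
      simp only [Matrix.mul_apply, dualCombo, Matrix.of_apply, Finset.sum_mul, Finset.mul_sum]
      rw [Finset.sum_comm]
      refine Finset.sum_congr rfl fun _ _ => Finset.sum_congr rfl fun _ _ => by ring
    simp only [e]
    rw [hU.contour.cint_sum]
    · simp only [cint_const_mul, hU.cint_dualRow hf hdet]
      simp
    · intro j _
      refine ContinuousOn.const_smul (c := κ α j) (ContinuousOn.mul ?_ (Polynomial.continuous _).continuousOn)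
      exact continuousOn_finsetSum _ fun i _ =>
        (differentiable_dualRow _ _).continuous.continuousOn.mul (hU.continuousOn_matrixWeight hf _ _)
  have := LinearMap.eqOn_span key hmem
  simpa [moment] using this

/-- The reproducing kernel. -/
noncomputable def reproKernel (a : ℕ → ℝ) (γ : ℝ → ℂ) (N M L : ℕ)
    (f : ℕ → ℂ → Matrix (Fin p) (Fin p) ℂ) (w : ℂ) : ℂ → Matrix (Fin p) (Fin p) ℂ :=
  dualCombo a γ N M L f fun α j => if α = Fin.ofNat p j then (dualPoly a M N (j / p)).eval w else 0

theorem NodesIn.cint_reproKernel (hU : NodesIn a γ U)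
    (hf : ∀ r < L, ∀ i j, DifferentiableOn ℂ (fun z => f r z i j) U)
    (hdet : (gram a γ N M L f).det ≠ 0) (w : ℂ) (α β : Fin p) {k : ℕ} (hk : k < N) :
    cint γ (fun s => (reproKernel a γ N M L f w s * matrixWeight a N M L f s) α β * s ^ k) =
      if α = β then w ^ k else 0 := by
  rw [reproKernel, hU.cint_dualCombo hf hdet
    (fun α β => if α = β then Polynomial.leval w else 0) _ α β hk]
  · split_ifs <;> simp
  · intro α j
    split_ifs <;> simp

theorem continuous_reproKernel :
    Continuous (fun q : ℂ × ℂ => reproKernel a γ N M L f q.1 q.2) := by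
  refine continuous_pi fun α => continuous_pi fun β => ?_
  simp only [reproKernel, dualCombo, Matrix.of_apply]
  refine continuous_finsetSum _ fun j _ => Continuous.mul ?_ ?_
  · split_ifs
    · exact (Polynomial.continuous _).comp continuous_fst
    · exact continuous_const
  · exact (differentiable_dualRow j β).continuous.comp continuous_snd

/-- The correlation kernel is the correlation matrix of the process. -/
theorem NodesIn.corrKernel_eq (hU : NodesIn a γ U)
    (hf : ∀ r < L, ∀ i j, DifferentiableOn ℂ (fun z => f r z i j) U) {r s : ℕ} (hr : r ≤ L) (hs : s ≤ L)
    (x y : ℕ) : corrKernel a γ N M L f (reproKernel a γ N M L f) r x s y =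
      siteKernel a γ N M L f s y r x := by
  have hA : ∀ j : Fin (p * N), ContinuousOn (fun w => symbolProd f s L w (Fin.ofNat p y) (Fin.ofNat p j) *
      (dualPoly a M N (j / p)).eval w * (charPoly a (y / p) w / charPoly a (M + N) w)) (trace γ) := fun j =>
    ((hU.continuousOn_symbolProd hf hs le_rfl _ _).mul (Polynomial.continuous _).continuousOn).mul
      (hU.continuousOn_div_charPoly (differentiable_charPoly a _).continuous.continuousOn _)
  have hB : ∀ i : Fin (p * N), ContinuousOn (fun z => charPoly a (i / p) z *
      symbolProd f 0 r z (Fin.ofNat p i) (Fin.ofNat p x) / charPoly a (x / p + 1) z) (trace γ) := fun i =>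
    hU.continuousOn_div_charPoly ((differentiable_charPoly a _).continuous.continuousOn.mul
      (hU.continuousOn_symbolProd hf (Nat.zero_le _) hr _ _)) _
  -- Writing out the kernel through $G^{-1}$ separates $w$ from $z$: the $w$-factor is a Toeplitz
  -- entry towards the end points, the $z$-factor one from the starting points.
  have hint : ∀ w z, (symbolProd f s L w * reproKernel a γ N M L f w z * symbolProd f 0 r z)
        (Fin.ofNat p y) (Fin.ofNat p x) *
        (charPoly a (y / p) w / (charPoly a (M + N) w * charPoly a (x / p + 1) z)) =
      ∑ j : Fin (p * N), ∑ i : Fin (p * N), (-(gram a γ N M L f)⁻¹ j i *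
        (symbolProd f s L w (Fin.ofNat p y) (Fin.ofNat p j) *
          (dualPoly a M N (j / p)).eval w * (charPoly a (y / p) w / charPoly a (M + N) w))) *
        (charPoly a (i / p) z * symbolProd f 0 r z (Fin.ofNat p i) (Fin.ofNat p x) /
          charPoly a (x / p + 1) z) := by
    intro w z
    have e : (reproKernel a γ N M L f w z * symbolProd f 0 r z) = Matrix.of fun α β =>
        ∑ j : Fin (p * N), (if α = Fin.ofNat p j then (dualPoly a M N (j / p)).eval w else 0) *
          ∑ δ, dualRow a γ N M L f j z δ * symbolProd f 0 r z δ β := by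
      ext α β
      simp only [Matrix.mul_apply, reproKernel, dualCombo, Matrix.of_apply, Finset.sum_mul, Finset.mul_sum]
      rw [Finset.sum_comm]
      simp only [mul_assoc]
    rw [Matrix.mul_assoc, e, Matrix.mul_apply]
    simp only [Matrix.of_apply, sum_dualRow_mul, Finset.mul_sum, ite_mul, zero_mul, mul_ite, mul_zero]
    rw [Finset.sum_comm]
    simp only [Finset.sum_ite_eq', Finset.mem_univ, if_true, Finset.sum_mul, mul_neg,
      neg_mul, Finset.mul_sum]
    refine Finset.sum_congr rfl fun j _ => ?_
    rw [← Finset.sum_neg_distrib]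
    refine Finset.sum_congr rfl fun i _ => ?_
    rw [div_mul_eq_div_div]
    ring
  have hdouble : ((2 * Real.pi * Complex.I : ℂ) ^ 2)⁻¹ *
      contourIntegral γ (fun w => contourIntegral γ (fun z =>
        (symbolProd f s L w * reproKernel a γ N M L f w z * symbolProd f 0 r z)
          (Fin.ofNat p y) (Fin.ofNat p x) *
          (charPoly a (y / p) w / (charPoly a (M + N) w * charPoly a (x / p + 1) z)))) =
      cint γ (fun w => cint γ (fun z => (symbolProd f s L w * reproKernel a γ N M L f w z * symbolProd f 0 r z)
          (Fin.ofNat p y) (Fin.ofNat p x) *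
          (charPoly a (y / p) w / (charPoly a (M + N) w * charPoly a (x / p + 1) z)))) := by
    rw [pow_two, mul_inv, mul_assoc]
    simp only [cint]
    congr 1
    simp only [contourIntegral, mul_assoc]
    rw [intervalIntegral.integral_const_mul]
  have hsum : cint γ (fun w => cint γ (fun z =>
      (symbolProd f s L w * reproKernel a γ N M L f w z * symbolProd f 0 r z)
          (Fin.ofNat p y) (Fin.ofNat p x) *
          (charPoly a (y / p) w / (charPoly a (M + N) w * charPoly a (x / p + 1) z)))) =
      ∑ j : Fin (p * N), ∑ i : Fin (p * N), toeplitz a γ (symbolProd f s L) y (p * M + j) *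
        (gram a γ N M L f)⁻¹ j i *
        cint γ (fun z => charPoly a (i / p) z * symbolProd f 0 r z (Fin.ofNat p i) (Fin.ofNat p x) /
          charPoly a (x / p + 1) z) := by
    simp only [hint]
    rw [hU.contour.cint_double_sum (fun j i => -(gram a γ N M L f)⁻¹ j i) hA hB]
    refine Finset.sum_congr rfl fun j _ => Finset.sum_congr rfl fun i _ => ?_
    rw [hU.toeplitz_final]
    ring
  have hfirst : (2 * Real.pi * Complex.I : ℂ)⁻¹ * (a (x / p) : ℂ)⁻¹ *
      contourIntegral γ (fun z => symbolProd f s r z (Fin.ofNat p y) (Fin.ofNat p x) *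
        (charPoly a (y / p) z / charPoly a (x / p + 1) z)) = -toeplitz a γ (symbolProd f s r) y x := by
    rw [toeplitz]
    simp only [mul_comm (symbolProd f s r _ _ _)]
    ring
  have hlast : ∀ i : Fin (p * N), toeplitz a γ (symbolProd f 0 r) i x = -((a (x / p) : ℂ)⁻¹ *
      cint γ (fun z => charPoly a (i / p) z * symbolProd f 0 r z (Fin.ofNat p i) (Fin.ofNat p x) /
          charPoly a (x / p + 1) z)) := by
    intro i
    rw [toeplitz_eq, newtonCoeff, neg_mul]
  rw [corrKernel, siteKernel, hfirst, mul_right_comm _ _ (contourIntegral γ _), hdouble, hsum]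
  simp only [hlast, mul_neg, Finset.sum_neg_distrib]
  rw [Finset.sum_mul]
  simp only [Finset.sum_mul]
  rw [sub_eq_add_neg, add_comm, sub_eq_add_neg]
  congr 1
  · congr 1
    exact Finset.sum_congr rfl fun j _ => Finset.sum_congr rfl fun i _ => by ring
  · split_ifs <;> simp

end Reproducing

/-! ### Riemann-Hilbert problems with unimodular jump -/

section RHP

variable {γ : ℝ → ℂ} {m n : Type*} [Fintype n]

theorem differentiableOn_mul_apply {A : ℂ → Matrix m n ℂ} {B : ℂ → Matrix n n ℂ} {s : Set ℂ}
    (hA : ∀ i j, DifferentiableOn ℂ (fun z => A z i j) s)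
    (hB : ∀ i j, DifferentiableOn ℂ (fun z => B z i j) s) (i : m) (j : n) :
    DifferentiableOn ℂ (fun z => (A z * B z) i j) s := by
  simp only [Matrix.mul_apply]
  exact DifferentiableOn.fun_sum fun k _ => (hA i k).mul (hB k j)

theorem tendsto_matrix_mul {ι : Type*} {F : Filter ι} {A : ι → Matrix m n ℂ} {B : ι → Matrix n n ℂ}
    {A₀ : Matrix m n ℂ} {B₀ : Matrix n n ℂ} (hA : Tendsto A F (𝓝 A₀)) (hB : Tendsto B F (𝓝 B₀)) :
    Tendsto (fun i => A i * B i) F (𝓝 (A₀ * B₀)) := by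
  refine tendsto_pi_nhds.2 fun i => tendsto_pi_nhds.2 fun j => ?_
  simp only [Matrix.mul_apply]
  exact tendsto_finsetSum _ fun k _ => (tendsto_pi_nhds.1 (tendsto_pi_nhds.1 hA i) k).mul
    (tendsto_pi_nhds.1 (tendsto_pi_nhds.1 hB k) j)

variable [DecidableEq n]

theorem differentiableOn_det {A : ℂ → Matrix n n ℂ} {s : Set ℂ}
    (hA : ∀ i j, DifferentiableOn ℂ (fun z => A z i j) s) :
    DifferentiableOn ℂ (fun z => (A z).det) s := by
  simp only [Matrix.det_apply']
  exact DifferentiableOn.fun_sum fun σ _ =>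
    (DifferentiableOn.fun_finsetProd fun i _ => hA (σ i) i).const_mul _

theorem differentiableOn_adjugate {A : ℂ → Matrix n n ℂ} {s : Set ℂ}
    (hA : ∀ i j, DifferentiableOn ℂ (fun z => A z i j) s) (i j : n) :
    DifferentiableOn ℂ (fun z => (A z).adjugate i j) s := by
  simp only [Matrix.adjugate_apply]
  refine differentiableOn_det fun k l => ?_
  simp only [Matrix.updateRow_apply]
  split_ifs
  · exact differentiableOn_const _
  · exact hA k l

/-- The boundary values of `X` at a point of the contour are related by the jump matrix `J`. -/
def HasJump (γ : ℝ → ℂ) (J : Matrix n n ℂ) (X : ℂ → Matrix m n ℂ) (z : ℂ) : Prop :=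
  ∃ Xplus Xminus : Matrix m n ℂ, Tendsto X (𝓝[inside γ] z) (𝓝 Xplus) ∧
    Tendsto X (𝓝[outside γ] z) (𝓝 Xminus) ∧ Xplus = Xminus * J

theorem IsContour.tendsto_compl (hγ : IsContour γ) {E : Type*} [TopologicalSpace E] {f : ℂ → E} {l : E}
    {z : ℂ} (h1 : Tendsto f (𝓝[inside γ] z) (𝓝 l)) (h2 : Tendsto f (𝓝[outside γ] z) (𝓝 l)) :
    Tendsto f (𝓝[(trace γ)ᶜ] z) (𝓝 l) := by
  rw [hγ.inside_union_outside, nhdsWithin_union]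
  exact h1.sup h2

theorem tendsto_matrix_adjugate {ι : Type*} {F : Filter ι} {B : ι → Matrix n n ℂ} {B₀ : Matrix n n ℂ}
    (hB : Tendsto B F (𝓝 B₀)) : Tendsto (fun i => (B i).adjugate) F (𝓝 B₀.adjugate) :=
  ((continuous_id.matrix_adjugate).tendsto B₀).comp hB

/-- $X_+\,\mathrm{adj}(Y_+) = X_- J\,\mathrm{adj}(J)\,\mathrm{adj}(Y_-) = X_-\,\mathrm{adj}(Y_-)$
since $\det J=1$. The adjugate is polynomial in the entries, so its limits exist before
invertibility of $Y$ is known. -/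
theorem HasJump.exists_tendsto (hγ : IsContour γ) {J : Matrix n n ℂ} (hJ : J.det = 1)
    {X : ℂ → Matrix m n ℂ} {Y : ℂ → Matrix n n ℂ} {z : ℂ} (hX : HasJump γ J X z) (hY : HasJump γ J Y z) :
    ∃ l, Tendsto (fun z => X z * (Y z).adjugate) (𝓝[(trace γ)ᶜ] z) (𝓝 l) := by
  obtain ⟨Xp, Xm, hX1, hX2, rfl⟩ := hX
  obtain ⟨Yp, Ym, hY1, hY2, rfl⟩ := hY
  refine ⟨Xm * Ym.adjugate, hγ.tendsto_compl ?_ (tendsto_matrix_mul hX2 (tendsto_matrix_adjugate hY2))⟩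
  have e : Xm * Ym.adjugate = Xm * J * (Ym * J).adjugate := by
    rw [Matrix.adjugate_mul_distrib, Matrix.mul_assoc, ← Matrix.mul_assoc J, Matrix.mul_adjugate, hJ,
      one_smul, Matrix.one_mul]
  rw [e]
  exact tendsto_matrix_mul hX1 (tendsto_matrix_adjugate hY1)

theorem HasJump.exists_tendsto_det (hγ : IsContour γ) {J : Matrix n n ℂ} (hJ : J.det = 1)
    {Y : ℂ → Matrix n n ℂ} {z : ℂ} (hY : HasJump γ J Y z) :
    ∃ l, Tendsto (fun z => (Y z).det) (𝓝[(trace γ)ᶜ] z) (𝓝 l) := by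
  obtain ⟨Yp, Ym, hY1, hY2, rfl⟩ := hY
  have hc : Continuous fun A : Matrix n n ℂ => A.det := continuous_id.matrix_det
  refine ⟨Ym.det, hγ.tendsto_compl ?_ ((hc.tendsto Ym).comp hY2)⟩
  have e : Ym.det = (Ym * J).det := by rw [Matrix.det_mul, hJ, mul_one]
  rw [e]
  exact (hc.tendsto _).comp hY1

/-- Entry by entry, a jump-free bounded function is constant by Liouville's theorem. -/
theorem IsContour.exists_mul_adjugate_eq (hγ : IsContour γ) {J : ℂ → Matrix n n ℂ}
    (hJ : ∀ z, (J z).det = 1) {X : ℂ → Matrix m n ℂ} {Y : ℂ → Matrix n n ℂ}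
    (hXd : ∀ i j, DifferentiableOn ℂ (fun z => X z i j) (trace γ)ᶜ)
    (hYd : ∀ i j, DifferentiableOn ℂ (fun z => Y z i j) (trace γ)ᶜ)
    (hX : ∀ z ∈ trace γ, HasJump γ (J z) X z) (hY : ∀ z ∈ trace γ, HasJump γ (J z) Y z)
    (hb : ∀ i j, (fun z => (X z * (Y z).adjugate) i j) =O[Bornology.cobounded ℂ] (fun _ => (1 : ℂ))) :
    ∃ c : Matrix m n ℂ, ∀ z ∉ trace γ, X z * (Y z).adjugate = c := by
  have h : ∀ i j, ∃ c, ∀ z ∉ trace γ, (X z * (Y z).adjugate) i j = c := fun i j =>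
    hγ.exists_eq_const (differentiableOn_mul_apply hXd (differentiableOn_adjugate hYd) i j)
      (fun z hz => by
        obtain ⟨l, hl⟩ := (hX z hz).exists_tendsto hγ (hJ z) (hY z hz)
        exact ⟨l i j, tendsto_pi_nhds.1 (tendsto_pi_nhds.1 hl i) j⟩) (hb i j)
  choose c hc using h
  exact ⟨Matrix.of c, fun z hz => by ext i j; exact hc i j z hz⟩

end RHP

/-! ### Determinant and uniqueness of the Riemann-Hilbert solution -/

section

variable {γ : ℝ → ℂ} {p N : ℕ} {W : ℂ → Matrix (Fin p) (Fin p) ℂ}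
  {Y Y' : ℂ → Matrix (Fin p ⊕ Fin p) (Fin p ⊕ Fin p) ℂ}

/-- The normalisation at infinity. -/
noncomputable def scaling (p N : ℕ) (z : ℂ) : Matrix (Fin p ⊕ Fin p) (Fin p ⊕ Fin p) ℂ :=
  Matrix.fromBlocks (z ^ N • 1) 0 0 ((z ^ N)⁻¹ • 1)

/-- The inverse of the normalisation at infinity. -/
noncomputable def scalingInv (p N : ℕ) (z : ℂ) : Matrix (Fin p ⊕ Fin p) (Fin p ⊕ Fin p) ℂ :=
  Matrix.fromBlocks ((z ^ N)⁻¹ • 1) 0 0 (z ^ N • 1)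

theorem scaling_mul_scalingInv {z : ℂ} (hz : z ≠ 0) : scaling p N z * scalingInv p N z = 1 := by
  have h : z ^ N ≠ 0 := pow_ne_zero _ hz
  rw [scaling, scalingInv, Matrix.fromBlocks_multiply]
  simp [h, ← Matrix.fromBlocks_one]

theorem det_scaling {z : ℂ} (hz : z ≠ 0) : (scaling p N z).det = 1 := by
  have h : z ^ N ≠ 0 := pow_ne_zero _ hz
  rw [scaling, Matrix.det_fromBlocks_zero₂₁, Matrix.det_smul, Matrix.det_smul, Matrix.det_one, mul_one,
    mul_one, ← mul_pow, mul_inv_cancel₀ h, one_pow]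

theorem adjugate_scaling {z : ℂ} (hz : z ≠ 0) : (scaling p N z).adjugate = scalingInv p N z := by
  calc (scaling p N z).adjugate = (scaling p N z).adjugate * (scaling p N z * scalingInv p N z) := by
        rw [scaling_mul_scalingInv hz, Matrix.mul_one]
    _ = scalingInv p N z := by
        rw [← Matrix.mul_assoc, Matrix.adjugate_mul, det_scaling hz, one_smul, Matrix.one_mul]

theorem eventually_cobounded_ne_zero : ∀ᶠ z : ℂ in Bornology.cobounded ℂ, z ≠ 0 := by
  filter_upwards [tendsto_norm_cobounded_atTop.eventually_gt_atTop (0 : ℝ)] with z hz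
  exact norm_pos_iff.1 hz

theorem IsContour.eventually_notMem (hγ : IsContour γ) : ∀ᶠ z in Bornology.cobounded ℂ, z ∉ trace γ :=
  hγ.isCompact_trace.isBounded

theorem det_jumpMatrix (A : Matrix (Fin p) (Fin p) ℂ) :
    (Matrix.fromBlocks (1 : Matrix (Fin p) (Fin p) ℂ) A 0 1).det = 1 := by
  rw [Matrix.det_fromBlocks_zero₂₁, Matrix.det_one, mul_one]

theorem SolvesRHP.exists_asymptotics (hY : SolvesRHP γ N W Y) :
    ∃ F : ℂ → Matrix (Fin p ⊕ Fin p) (Fin p ⊕ Fin p) ℂ,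
      Tendsto F (Bornology.cobounded ℂ) (𝓝 1) ∧
      ∀ᶠ z in Bornology.cobounded ℂ, Y z = F z * scaling p N z := by
  obtain ⟨E, hE, hYE⟩ := hY.atInfinity
  refine ⟨fun z => 1 + E z, ?_, hYE⟩
  have h0 : Tendsto E (Bornology.cobounded ℂ) (𝓝 0) :=
    tendsto_pi_nhds.2 fun i => tendsto_pi_nhds.2 fun j => (hE i j).trans_tendsto tendsto_inv₀_cobounded
  simpa using (tendsto_const_nhds (x := (1 : Matrix (Fin p ⊕ Fin p) (Fin p ⊕ Fin p) ℂ))).add h0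

/-- Jump and normalisation are unimodular, so the determinant has no jump and tends to 1. -/
theorem SolvesRHP.det_eq_one (hγ : IsContour γ) (hY : SolvesRHP γ N W Y) {z : ℂ} (hz : z ∉ trace γ) :
    (Y z).det = 1 := by
  obtain ⟨F, hF, hYF⟩ := hY.exists_asymptotics
  have hc : Continuous fun A : Matrix (Fin p ⊕ Fin p) (Fin p ⊕ Fin p) ℂ => A.det :=
    continuous_id.matrix_det
  have hlim : Tendsto (fun z => (Y z).det) (Bornology.cobounded ℂ) (𝓝 1) := by
    have h1 := (hc.tendsto 1).comp hF
    rw [Matrix.det_one] at h1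
    refine h1.congr' ?_
    filter_upwards [hYF, eventually_cobounded_ne_zero] with z h2 h3
    rw [h2, Matrix.det_mul, det_scaling h3, mul_one]
    rfl
  obtain ⟨c, hcst⟩ := hγ.exists_eq_const (differentiableOn_det hY.analytic)
    (fun z hz => HasJump.exists_tendsto_det hγ (det_jumpMatrix (W z)) (hY.jump z hz)) (hlim.isBigO_one ℂ)
  rw [hcst z hz]
  refine tendsto_nhds_unique (tendsto_const_nhds.congr' ?_) hlim
  filter_upwards [hγ.eventually_notMem] with z hz
  exact (hcst z hz).symm

theorem SolvesRHP.adjugate_mul (hγ : IsContour γ) (hY : SolvesRHP γ N W Y) {z : ℂ} (hz : z ∉ trace γ) :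
    (Y z).adjugate * Y z = 1 := by
  rw [Matrix.adjugate_mul, hY.det_eq_one hγ hz, one_smul]

theorem SolvesRHP.inv_eq (hγ : IsContour γ) (hY : SolvesRHP γ N W Y) {z : ℂ} (hz : z ∉ trace γ) :
    (Y z)⁻¹ = (Y z).adjugate := by
  rw [Matrix.inv_def, hY.det_eq_one hγ hz, Ring.inverse_one, one_smul]

/-- Uniqueness of the solution of the Riemann-Hilbert problem. -/
theorem SolvesRHP.eqOn (hγ : IsContour γ) (hY : SolvesRHP γ N W Y) (hY' : SolvesRHP γ N W Y') :
    Set.EqOn Y' Y (trace γ)ᶜ := by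
  obtain ⟨F, hF, hYF⟩ := hY.exists_asymptotics
  obtain ⟨F', hF', hYF'⟩ := hY'.exists_asymptotics
  have hlim : Tendsto (fun z => Y' z * (Y z).adjugate) (Bornology.cobounded ℂ) (𝓝 1) := by
    have h1 := tendsto_matrix_mul hF' (tendsto_matrix_adjugate hF)
    rw [Matrix.adjugate_one, Matrix.one_mul] at h1
    refine h1.congr' ?_
    filter_upwards [hYF, hYF', eventually_cobounded_ne_zero] with z h2 h3 h4
    rw [h2, h3, Matrix.adjugate_mul_distrib, adjugate_scaling h4, Matrix.mul_assoc,
      ← Matrix.mul_assoc (scaling p N z), scaling_mul_scalingInv h4, Matrix.one_mul]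
  obtain ⟨c, hc⟩ := hγ.exists_mul_adjugate_eq (J := fun z => Matrix.fromBlocks 1 (W z) 0 1)
    (fun z => det_jumpMatrix (W z)) hY'.analytic hY.analytic hY'.jump hY.jump
    (fun i j => (tendsto_pi_nhds.1 (tendsto_pi_nhds.1 hlim i) j).isBigO_one ℂ)
  have hc1 : c = 1 := by
    refine tendsto_nhds_unique (tendsto_const_nhds.congr' ?_) hlim
    filter_upwards [hγ.eventually_notMem] with z hz
    exact (hc z hz).symm
  intro z hz
  calc Y' z = Y' z * ((Y z).adjugate * Y z) := by rw [hY.adjugate_mul hγ hz, Matrix.mul_one]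
    _ = Y z := by rw [← Matrix.mul_assoc, hc z hz, hc1, Matrix.one_mul]

end

/-! ### The solution of the Riemann-Hilbert problem -/

section Solution

variable {a : ℕ → ℝ} {γ : ℝ → ℂ} {U : Set ℂ} {p N M L : ℕ}
  {f : ℕ → ℂ → Matrix (Fin p) (Fin p) ℂ} {W A B : ℂ → Matrix (Fin p) (Fin p) ℂ}

/-- The row `(A, C(A W))`, where `C` is the Cauchy transform. -/
noncomputable def cauchyRow (γ : ℝ → ℂ) (W A : ℂ → Matrix (Fin p) (Fin p) ℂ) (z : ℂ) :
    Matrix (Fin p) (Fin p ⊕ Fin p) ℂ :=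
  Matrix.fromCols (A z) (Matrix.of fun α β => cauchy γ (fun s => (A s * W s) α β) z)

theorem tendsto_fromCols {ι : Type*} {F : Filter ι} {A B : ι → Matrix (Fin p) (Fin p) ℂ}
    {A₀ B₀ : Matrix (Fin p) (Fin p) ℂ} (hA : Tendsto A F (𝓝 A₀)) (hB : Tendsto B F (𝓝 B₀)) :
    Tendsto (fun i => Matrix.fromCols (A i) (B i)) F (𝓝 (Matrix.fromCols A₀ B₀)) := by
  refine tendsto_pi_nhds.2 fun i => tendsto_pi_nhds.2 fun j => ?_
  rcases j with j | j
  · exact tendsto_pi_nhds.1 (tendsto_pi_nhds.1 hA i) j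
  · exact tendsto_pi_nhds.1 (tendsto_pi_nhds.1 hB i) j

theorem tendsto_fromRows {ι n : Type*} {F : Filter ι} {A B : ι → Matrix (Fin p) n ℂ}
    {A₀ B₀ : Matrix (Fin p) n ℂ} (hA : Tendsto A F (𝓝 A₀)) (hB : Tendsto B F (𝓝 B₀)) :
    Tendsto (fun i => Matrix.fromRows (A i) (B i)) F (𝓝 (Matrix.fromRows A₀ B₀)) := by
  refine tendsto_pi_nhds.2 fun i => ?_
  rcases i with i | i
  · exact tendsto_pi_nhds.1 hA i
  · exact tendsto_pi_nhds.1 hB i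

theorem HasJump.fromRows {n : Type*} [Fintype n] {J : Matrix n n ℂ} {X X' : ℂ → Matrix (Fin p) n ℂ}
    {z : ℂ} (hX : HasJump γ J X z) (hX' : HasJump γ J X' z) :
    HasJump γ J (fun z => Matrix.fromRows (X z) (X' z)) z := by
  obtain ⟨Xp, Xm, h1, h2, rfl⟩ := hX
  obtain ⟨Yp, Ym, h3, h4, rfl⟩ := hX'
  exact ⟨_, _, tendsto_fromRows h1 h3, tendsto_fromRows h2 h4, (Matrix.fromRows_mul _ _ _).symm⟩

theorem IsContour.differentiableOn_cauchyRow (hγ : IsContour γ)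
    (hA : ∀ i j, Differentiable ℂ fun z => A z i j)
    (hAW : ∀ i j, ContinuousOn (fun s => (A s * W s) i j) (trace γ)) (i : Fin p) (j : Fin p ⊕ Fin p) :
    DifferentiableOn ℂ (fun z => cauchyRow γ W A z i j) (trace γ)ᶜ := by
  rcases j with j | j
  · exact (hA i j).differentiableOn
  · exact hγ.differentiableOn_cauchy (hAW i j)

/-- $A$ is entire, so the first block does not jump; the second jumps by $AW$, as the Plemelj
formula requires. -/
theorem IsContour.hasJump_cauchyRow (hγ : IsContour γ) {V : Set ℂ} (hV : IsOpen V) (hsub : trace γ ⊆ V)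
    (hA : ∀ i j, Differentiable ℂ fun z => A z i j)
    (hAW : ∀ i j, DifferentiableOn ℂ (fun s => (A s * W s) i j) V) {z : ℂ} (hz : z ∈ trace γ) :
    HasJump γ (Matrix.fromBlocks 1 (W z) 0 1) (cauchyRow γ W A) z := by
  choose D hD using fun i j => hγ.exists_tendsto_cauchy hV hsub (hAW i j) hz
  have hAc : Tendsto A (𝓝 z) (𝓝 (A z)) := tendsto_pi_nhds.2 fun i => tendsto_pi_nhds.2 fun j =>
    (hA i j).continuous.tendsto z
  refine ⟨Matrix.fromCols (A z) (Matrix.of D + A z * W z), Matrix.fromCols (A z) (Matrix.of D),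
    tendsto_fromCols (hAc.mono_left nhdsWithin_le_nhds)
      (tendsto_pi_nhds.2 fun i => tendsto_pi_nhds.2 fun j => (hD i j).1),
    tendsto_fromCols (hAc.mono_left nhdsWithin_le_nhds)
      (tendsto_pi_nhds.2 fun i => tendsto_pi_nhds.2 fun j => (hD i j).2), ?_⟩
  rw [Matrix.fromCols_mul_fromBlocks]
  simp [add_comm]

/-- With the first $n$ moments zero, $-\int h s^n$ is the leading coefficient, at order
$z^{-(n+1)}$. -/
theorem IsContour.pow_mul_cauchy_add_isBigO (hγ : IsContour γ) {h : ℂ → ℂ}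
    (hh : ContinuousOn h (trace γ)) {n : ℕ} (hmom : ∀ k < n, cint γ (fun s => h s * s ^ k) = 0) :
    (fun z => z ^ (n + 1) * cauchy γ h z + cint γ (fun s => h s * s ^ n))
      =O[Bornology.cobounded ℂ] (fun z => z⁻¹) := by
  have hc : ∀ k, ContinuousOn (fun s => h s * s ^ k) (trace γ) := fun k =>
    hh.mul (continuous_pow k).continuousOn
  refine (hγ.cauchy_isBigO (hc (n + 1))).congr' ?_ (EventuallyEq.refl _ _)
  filter_upwards [hγ.eventually_notMem] with z hz
  rw [pow_succ', mul_assoc, hγ.pow_mul_cauchy hh hz n hmom, hγ.mul_cauchy (hc n) hz, sub_add_cancel]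
  simp only [pow_succ, mul_assoc]

theorem cauchyRow_mul_scalingInv_inl (z : ℂ) (i j : Fin p) :
    (cauchyRow γ W A z * scalingInv p N z) i (Sum.inl j) = (z ^ N)⁻¹ * A z i j := by
  rw [cauchyRow, scalingInv, Matrix.fromCols_mul_fromBlocks]
  simp

theorem cauchyRow_mul_scalingInv_inr (z : ℂ) (i j : Fin p) :
    (cauchyRow γ W A z * scalingInv p N z) i (Sum.inr j) =
      z ^ N * cauchy γ (fun s => (A s * W s) i j) z := by
  rw [cauchyRow, scalingInv, Matrix.fromCols_mul_fromBlocks]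
  simp

theorem one_isBigO_pow (n : ℕ) : (fun _ : ℂ => (1 : ℂ)) =O[Bornology.cobounded ℂ] (fun z => z ^ n) := by
  refine Asymptotics.IsBigO.of_bound 1 ?_
  filter_upwards [tendsto_norm_cobounded_atTop.eventually_ge_atTop (1 : ℝ)] with z hz
  rw [norm_one, one_mul, norm_pow]
  exact one_le_pow₀ hz

theorem charPoly_isBigO (a : ℕ → ℝ) {k n : ℕ} (hk : k ≤ n) :
    (charPoly a k) =O[Bornology.cobounded ℂ] (fun z => z ^ n) := by
  obtain ⟨m, rfl⟩ := Nat.exists_eq_add_of_le hk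
  have h : (charPoly a k) =O[Bornology.cobounded ℂ] (fun z => z ^ k) := by
    induction k with
    | zero => simpa [charPoly] using one_isBigO_pow 0
    | succ k ih =>
      simp only [pow_succ]
      refine ((ih (Nat.le_add_right _ _)).mul
        (g₂ := fun z => z) (f₂ := fun z => 1 - z / (a k : ℂ)) ?_).congr_left fun z => ?_
      · refine Asymptotics.IsBigO.sub (by simpa using one_isBigO_pow 1) ?_
        simp only [div_eq_inv_mul]
        exact (Asymptotics.isBigO_refl _ _).const_mul_left _
      · rw [charPoly_succ]
  simpa [pow_add] using h.mul (one_isBigO_pow m)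

theorem inv_pow_mul_isBigO {g : ℂ → ℂ} {n : ℕ} (hg : g =O[Bornology.cobounded ℂ] (fun z => z ^ n)) :
    (fun z => (z ^ (n + 1))⁻¹ * g z) =O[Bornology.cobounded ℂ] (fun z => z⁻¹) := by
  refine ((Asymptotics.isBigO_refl (fun z : ℂ => (z ^ (n + 1))⁻¹) _).mul hg).congr'
    (EventuallyEq.refl _ _) ?_
  filter_upwards [eventually_cobounded_ne_zero] with z hz
  field_simp
  ring

theorem inv_isBigO_one : (fun z : ℂ => z⁻¹) =O[Bornology.cobounded ℂ] (fun _ => (1 : ℂ)) :=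
  tendsto_inv₀_cobounded.isBigO_one ℂ

theorem NodesIn.exists_isOpen_matrixWeight (hU : NodesIn a γ U)
    (hf : ∀ r < L, ∀ i j, DifferentiableOn ℂ (fun z => f r z i j) U) (N M : ℕ) :
    ∃ V, IsOpen V ∧ trace γ ⊆ V ∧
      ∀ i j, DifferentiableOn ℂ (fun z => matrixWeight a N M L f z i j) V := by
  have hc := differentiable_charPoly a (M + N)
  refine ⟨U ∩ {z | charPoly a (M + N) z ≠ 0},
    hU.isOpen.inter (isOpen_ne_fun hc.continuous continuous_const),
    fun z hz => ⟨hU.trace_subset hz, hU.charPoly_ne_zero hz _⟩, fun i j => ?_⟩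
  simp only [matrixWeight_apply]
  exact ((differentiableOn_symbolProd hf (Nat.zero_le _) le_rfl i j).mono Set.inter_subset_left).div
    hc.differentiableOn fun z hz => hz.2

theorem NodesIn.hasJump_cauchyRow (hU : NodesIn a γ U)
    (hf : ∀ r < L, ∀ i j, DifferentiableOn ℂ (fun z => f r z i j) U)
    (hA : ∀ i j, Differentiable ℂ fun z => A z i j) {z : ℂ} (hz : z ∈ trace γ) :
    HasJump γ (Matrix.fromBlocks 1 (matrixWeight a N M L f z) 0 1)
      (cauchyRow γ (matrixWeight a N M L f) A) z := by
  obtain ⟨V, hV, hsub, hW⟩ := hU.exists_isOpen_matrixWeight hf N M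
  exact hU.contour.hasJump_cauchyRow hV hsub hA
    (differentiableOn_mul_apply (fun i j => (hA i j).differentiableOn) hW) hz

variable [NeZero p]

/-- Only $p_k$ with $k<N$ occur, so the degree is at most $N-1$. -/
theorem dualCombo_isBigO {n : ℕ} (κ : Fin p → Fin (p * (n + 1)) → ℂ) (α β : Fin p) :
    (fun z => dualCombo a γ (n + 1) M L f κ z α β) =O[Bornology.cobounded ℂ] (fun z => z ^ n) := by
  simp only [dualCombo, Matrix.of_apply]
  refine Asymptotics.IsBigO.fun_sum fun j _ => Asymptotics.IsBigO.const_mul_left ?_ _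
  simp only [dualRow]
  refine (Asymptotics.IsBigO.fun_sum fun i _ => ?_).neg_left
  split_ifs
  · have hi : (i : ℕ) / p < n + 1 := Nat.div_lt_of_lt_mul i.2
    exact (charPoly_isBigO a (by omega)).const_mul_left _
  · exact Asymptotics.isBigO_zero _ _

/-- The first row of blocks of the solution of the Riemann-Hilbert problem. -/
noncomputable def monicSolution (a : ℕ → ℝ) (γ : ℝ → ℂ) (N M L : ℕ)
    (f : ℕ → ℂ → Matrix (Fin p) (Fin p) ℂ) (z : ℂ) : Matrix (Fin p) (Fin p) ℂ :=
  z ^ N • 1 - dualCombo a γ N M L f (fun α j => cint γ fun s =>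
    s ^ N * matrixWeight a N M L f s α (Fin.ofNat p j) * (dualPoly a M N (j / p)).eval s) z

/-- The second row of blocks of the solution of the Riemann-Hilbert problem. -/
noncomputable def dualSolution (a : ℕ → ℝ) (γ : ℝ → ℂ) (N M L : ℕ)
    (f : ℕ → ℂ → Matrix (Fin p) (Fin p) ℂ) : ℂ → Matrix (Fin p) (Fin p) ℂ :=
  dualCombo a γ N M L f fun α j =>
    if α = Fin.ofNat p j then -(dualPoly a M N (j / p)).coeff (N - 1) else 0

theorem differentiable_monicSolution (α β : Fin p) :
    Differentiable ℂ (fun z => monicSolution a γ N M L f z α β) := by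
  simp only [monicSolution, Matrix.sub_apply, Matrix.smul_apply, smul_eq_mul]
  exact ((differentiable_id.pow N).mul_const _).sub (differentiable_dualCombo _ α β)

/-- The subtracted combination realises the moments of $s^N$ times the weight; what is left is
orthogonal to all powers below $N$. -/
theorem NodesIn.cint_monicSolution (hU : NodesIn a γ U)
    (hf : ∀ r < L, ∀ i j, DifferentiableOn ℂ (fun z => f r z i j) U)
    (hdet : (gram a γ N M L f).det ≠ 0) (α β : Fin p) {k : ℕ} (hk : k < N) :
    cint γ (fun s => (monicSolution a γ N M L f s * matrixWeight a N M L f s) α β * s ^ k) = 0 := by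
  have hc : ∀ α β, ContinuousOn (fun s => s ^ N * matrixWeight a N M L f s α β) (trace γ) := fun α β =>
    (continuous_pow N).continuousOn.mul (hU.continuousOn_matrixWeight hf α β)
  have h1 := hU.cint_dualCombo hf hdet (fun α β => moment hU.contour _ (hc α β)) (fun _ _ => rfl) α β hk
  have h2 : ∀ s, (monicSolution a γ N M L f s * matrixWeight a N M L f s) α β * s ^ k =
      s ^ N * matrixWeight a N M L f s α β * (Polynomial.X ^ k : Polynomial ℂ).eval s -
        (dualCombo a γ N M L f (fun α j => moment hU.contour _ (hc α (Fin.ofNat p j))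
          (dualPoly a M N (j / p))) s * matrixWeight a N M L f s) α β * s ^ k := by
    intro s
    rw [monicSolution, Matrix.sub_mul, Matrix.sub_apply, Matrix.smul_mul, Matrix.one_mul, Matrix.smul_apply,
      smul_eq_mul, sub_mul, Polynomial.eval_pow, Polynomial.eval_X]
    rfl
  simp only [h2]
  refine (hU.contour.cint_sub ((hc α β).mul (Polynomial.continuous _).continuousOn)
    ((hU.continuousOn_mul_matrixWeight hf (differentiable_dualCombo _) α β).mul
      (continuous_pow k).continuousOn)).trans ?_
  exact sub_eq_zero.2 h1.symm

/-- The prescribed functional is minus the coefficient of $X^{N-1}$; the sign makes the lower right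
block of $Y$ asymptotic to $+z^{-N}I$. -/
theorem NodesIn.cint_dualSolution (hU : NodesIn a γ U)
    (hf : ∀ r < L, ∀ i j, DifferentiableOn ℂ (fun z => f r z i j) U)
    (hdet : (gram a γ N M L f).det ≠ 0) (α β : Fin p) {k : ℕ} (hk : k < N) :
    cint γ (fun s => (dualSolution a γ N M L f s * matrixWeight a N M L f s) α β * s ^ k) =
      if α = β ∧ k = N - 1 then -1 else 0 := by
  rw [dualSolution, hU.cint_dualCombo hf hdet
    (fun α β => if α = β then -Polynomial.lcoeff ℂ (N - 1) else 0) _ α β hk]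
  · by_cases h : α = β
    · simp only [h, if_true, true_and, LinearMap.neg_apply, Polynomial.lcoeff_apply, Polynomial.coeff_X_pow,
        eq_comm (a := N - 1)]
      split_ifs <;> simp
    · simp [h]
  · intro α j
    split_ifs <;> simp

/-- The solution of the Riemann-Hilbert problem. -/
noncomputable def rhpSolution (a : ℕ → ℝ) (γ : ℝ → ℂ) (N M L : ℕ)
    (f : ℕ → ℂ → Matrix (Fin p) (Fin p) ℂ) (z : ℂ) : Matrix (Fin p ⊕ Fin p) (Fin p ⊕ Fin p) ℂ :=
  Matrix.fromRows (cauchyRow γ (matrixWeight a N M L f) (monicSolution a γ N M L f) z)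
    (cauchyRow γ (matrixWeight a N M L f) (dualSolution a γ N M L f) z)

theorem NodesIn.solvesRHP (hU : NodesIn a γ U)
    (hf : ∀ r < L, ∀ i j, DifferentiableOn ℂ (fun z => f r z i j) U)
    (hdet : (gram a γ N M L f).det ≠ 0) (hN : 1 ≤ N) :
    SolvesRHP γ N (matrixWeight a N M L f) (rhpSolution a γ N M L f) := by
  obtain ⟨n, rfl⟩ : ∃ n, N = n + 1 := ⟨N - 1, by omega⟩
  have hP := differentiable_monicSolution (a := a) (γ := γ) (N := n + 1) (M := M) (L := L) (f := f)
  have hQ : ∀ α β, Differentiable ℂ (fun z => dualSolution a γ (n + 1) M L f z α β) :=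
    differentiable_dualCombo _
  have hPW := hU.continuousOn_mul_matrixWeight (N := n + 1) (M := M) hf hP
  have hQW := hU.continuousOn_mul_matrixWeight (N := n + 1) (M := M) hf hQ
  refine ⟨?_, fun z hz => (hU.hasJump_cauchyRow hf hP hz).fromRows (hU.hasJump_cauchyRow hf hQ hz), ?_⟩
  · rintro (i | i) j
    · exact hU.contour.differentiableOn_cauchyRow hP hPW i j
    · exact hU.contour.differentiableOn_cauchyRow hQ hQW i j
  -- The error term is forced: multiply by the inverse scaling and subtract the identity. The left
  -- blocks are controlled by degrees, the right ones by moments.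
  · refine ⟨fun z => rhpSolution a γ (n + 1) M L f z * scalingInv p (n + 1) z - 1, ?_, ?_⟩
    · simp only [rhpSolution, Matrix.fromRows_mul, Matrix.sub_apply]
      rintro (i | i) (j | j)
      · simp only [Matrix.fromRows_apply_inl, cauchyRow_mul_scalingInv_inl]
        refine (inv_pow_mul_isBigO (dualCombo_isBigO (n := n) (M := M) (L := L) (a := a) (γ := γ) (f := f)
          (fun α j => cint γ fun s => s ^ (n + 1) *
            matrixWeight a (n + 1) M L f s α (Fin.ofNat p j) * (dualPoly a M (n + 1) (j / p)).eval s)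
          i j)).neg_left.congr' ?_ (EventuallyEq.refl _ _)
        filter_upwards [eventually_cobounded_ne_zero] with z hz
        have hz' : z ^ (n + 1) ≠ 0 := pow_ne_zero _ hz
        have e : (1 : Matrix (Fin p ⊕ Fin p) (Fin p ⊕ Fin p) ℂ) (Sum.inl i) (Sum.inl j) =
            (1 : Matrix (Fin p) (Fin p) ℂ) i j := by
          simp [Matrix.one_apply]
        rw [monicSolution, Matrix.sub_apply, Matrix.smul_apply, smul_eq_mul, e, mul_sub, ← mul_assoc,
          inv_mul_cancel₀ hz', one_mul]
        ring
      · simp only [Matrix.fromRows_apply_inl, cauchyRow_mul_scalingInv_inr]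
        have h := hU.contour.pow_mul_cauchy_add_isBigO (hPW i j) (n := n) fun k hk =>
          hU.cint_monicSolution hf hdet i j (by omega)
        rw [hU.cint_monicSolution hf hdet i j (Nat.lt_succ_self n)] at h
        simpa [Matrix.one_apply] using h
      · simp only [Matrix.fromRows_apply_inr, cauchyRow_mul_scalingInv_inl]
        have e : (1 : Matrix (Fin p ⊕ Fin p) (Fin p ⊕ Fin p) ℂ) (Sum.inr i) (Sum.inl j) = 0 := by
          simp
        simp only [e, sub_zero]
        exact inv_pow_mul_isBigO (dualCombo_isBigO (n := n) (M := M) (L := L) (a := a)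
          (γ := γ) (f := f) (fun α j =>
            if α = Fin.ofNat p j then -(dualPoly a M (n + 1) (j / p)).coeff n else 0) i j)
      · simp only [Matrix.fromRows_apply_inr, cauchyRow_mul_scalingInv_inr]
        have h := hU.contour.pow_mul_cauchy_add_isBigO (hQW i j) (n := n) fun k hk => by
          rw [hU.cint_dualSolution hf hdet i j (by omega), if_neg]
          simp only [Nat.add_sub_cancel]
          omega
        rw [hU.cint_dualSolution hf hdet i j (Nat.lt_succ_self n)] at h
        refine h.congr_left fun z => ?_
        simp only [Nat.add_sub_cancel, and_true, Matrix.one_apply, Sum.inr.injEq]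
        split_ifs <;> ring
    · filter_upwards [eventually_cobounded_ne_zero] with z hz
      have h2 : scalingInv p (n + 1) z * scaling p (n + 1) z = 1 :=
        mul_eq_one_comm.1 (scaling_mul_scalingInv hz)
      rw [add_sub_cancel, ← scaling, Matrix.mul_assoc, h2, Matrix.mul_one]

/-- The row $((z-w)R(w,z),\,C)$ has the jump of $Y$ and at most its growth, so its product with
$Y^{-1}$ is constant. Comparing the values at $w$ and $z$ gives a Christoffel-Darboux formula. -/
theorem NodesIn.isReproducingKernel (hU : NodesIn a γ U)
    (hf : ∀ r < L, ∀ i j, DifferentiableOn ℂ (fun z => f r z i j) U)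
    (hdet : (gram a γ N M L f).det ≠ 0) (hN : 1 ≤ N) {Y : ℂ → Matrix (Fin p ⊕ Fin p) (Fin p ⊕ Fin p) ℂ}
    (hY : SolvesRHP γ N (matrixWeight a N M L f) Y) :
    IsReproducingKernel γ Y (reproKernel a γ N M L f) := by
  refine ⟨continuous_reproKernel, fun w z hw hz hne => ?_⟩
  obtain ⟨n, rfl⟩ : ∃ n, N = n + 1 := ⟨N - 1, by omega⟩
  have hγ := hU.contour
  set W := matrixWeight a (n + 1) M L f with hW
  have hR : ∀ i j, Differentiable ℂ (fun z => reproKernel a γ (n + 1) M L f w z i j) :=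
    differentiable_dualCombo _
  have hRW := hU.continuousOn_mul_matrixWeight (N := n + 1) (M := M) hf hR
  set A : ℂ → Matrix (Fin p) (Fin p) ℂ := fun z => (z - w) • reproKernel a γ (n + 1) M L f w z with hAdef
  have hA : ∀ i j, Differentiable ℂ (fun z => A z i j) := fun i j =>
    (differentiable_id.sub_const w).mul (hR i j)
  have hAW := hU.continuousOn_mul_matrixWeight (N := n + 1) (M := M) hf hA
  have hAmul : ∀ s i j, (A s * W s) i j = (s - w) * (reproKernel a γ (n + 1) M L f w s * W s) i j := by
    intro s i j
    rw [hAdef, Matrix.smul_mul, Matrix.smul_apply, smul_eq_mul]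
  set X := cauchyRow γ W A with hX
  have hscale : ∀ i j, (fun z => (X z * scalingInv p (n + 1) z) i j)
      =O[Bornology.cobounded ℂ] (fun _ => (1 : ℂ)) := by
    rintro i (j | j)
    · simp only [hX, cauchyRow_mul_scalingInv_inl]
      have h1 : (fun z : ℂ => z - w) =O[Bornology.cobounded ℂ] (fun z => z) :=
        (Asymptotics.isBigO_refl _ _).sub (((Asymptotics.isBigO_refl (fun _ : ℂ => (1 : ℂ)) _).const_mul_left
          w).trans (by simpa using one_isBigO_pow 1) |>.congr_left fun z => by simp)
      have h2 := h1.mul (inv_pow_mul_isBigO (dualCombo_isBigO (n := n) (M := M) (L := L) (a := a) (γ := γ) (f := f)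
        (fun α j => if α = Fin.ofNat p j then (dualPoly a M (n + 1) (j / p)).eval w else 0) i j))
      refine h2.congr' (Eventually.of_forall fun z => ?_) ?_
      · simp only [hAdef, Matrix.smul_apply, smul_eq_mul, reproKernel]
        ring
      · filter_upwards [eventually_cobounded_ne_zero] with z hz
        exact mul_inv_cancel₀ hz
    · simp only [hX, cauchyRow_mul_scalingInv_inr]
      -- For $k<N-1$ the reproducing property gives the moment $w^{k+1}-w\cdot w^k=0$, so the Cauchy
      -- transform is $O(z^{-N})$.
      have h := (hγ.pow_mul_cauchy_add_isBigO (hAW i j) (n := n) fun k hk => by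
        have e : ∀ s, (A s * W s) i j * s ^ k =
            (reproKernel a γ (n + 1) M L f w s * W s) i j * s ^ (k + 1) -
              w * ((reproKernel a γ (n + 1) M L f w s * W s) i j * s ^ k) := by
          intro s
          rw [hAmul]; ring
        simp only [← hW, e]
        refine (hγ.cint_sub ((hRW i j).mul (continuous_pow (k + 1)).continuousOn)
          (((hRW i j).mul (continuous_pow k).continuousOn).const_smul w)).trans ?_
        change cint γ (fun s => (reproKernel a γ (n + 1) M L f w s * W s) i j * s ^ (k + 1)) -
          cint γ (fun s => w * ((reproKernel a γ (n + 1) M L f w s * W s) i j * s ^ k)) = 0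
        rw [cint_const_mul, hU.cint_reproKernel hf hdet w i j (by omega), hU.cint_reproKernel hf hdet w i j (by omega)]
        split_ifs <;> ring).trans inv_isBigO_one
      exact (h.sub (Asymptotics.isBigO_const_const
        (cint γ fun s => (A s * matrixWeight a (n + 1) M L f s) i j * s ^ n) one_ne_zero _)).congr_left
          fun z => by rw [add_sub_cancel_right]
  obtain ⟨F, hF, hYF⟩ := hY.exists_asymptotics
  obtain ⟨c, hc⟩ := hγ.exists_mul_adjugate_eq (J := fun z => Matrix.fromBlocks 1 (W z) 0 1)
    (fun z => det_jumpMatrix (W z)) (hγ.differentiableOn_cauchyRow hA hAW) hY.analytic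
    (fun z hz => hU.hasJump_cauchyRow hf hA hz) hY.jump (fun i j => by
      have hF' := tendsto_matrix_adjugate hF
      have h : (fun z => ∑ k, (X z * scalingInv p (n + 1) z) i k * (F z).adjugate k j)
          =O[Bornology.cobounded ℂ] (fun _ => (1 : ℂ)) :=
        Asymptotics.IsBigO.fun_sum fun k _ => by
          simpa using (hscale i k).mul ((tendsto_pi_nhds.1 (tendsto_pi_nhds.1 hF' k) j).isBigO_one ℂ)
      refine h.congr' ?_ (EventuallyEq.refl _ _)
      filter_upwards [hYF, eventually_cobounded_ne_zero] with z h1 h2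
      rw [← Matrix.mul_apply, h1, Matrix.adjugate_mul_distrib, adjugate_scaling h2, Matrix.mul_assoc])
  -- At $z=w$ the first block vanishes, and in the second the factor $s-w$ cancels the Cauchy
  -- kernel, leaving the zeroth moment, the identity.
  have hXw : X w =
      Matrix.fromCols (0 : Matrix (Fin p) (Fin p) ℂ) (1 : Matrix (Fin p) (Fin p) ℂ) := by
    ext i j
    rcases j with j | j
    · simp [hX, cauchyRow, hAdef]
    · have h0 := hU.cint_reproKernel hf hdet w i j (Nat.succ_pos n)
      simp only [pow_zero, mul_one] at h0
      rw [hX, cauchyRow, Matrix.fromCols_apply_inr, Matrix.fromCols_apply_inr, Matrix.of_apply, cauchy,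
        Matrix.one_apply, ← h0]
      refine cint_congr fun s hs => ?_
      have hsw : s - w ≠ 0 := sub_ne_zero.2 fun e => hw (e ▸ hs)
      rw [hAmul, mul_div_cancel_left₀ _ hsw]
  have hXz : X z = Matrix.fromCols (0 : Matrix (Fin p) (Fin p) ℂ) (1 : Matrix (Fin p) (Fin p) ℂ) * (Y w)⁻¹ * Y z := by
    rw [hY.inv_eq hγ hw, ← hXw, hc w hw, ← hc z hz, Matrix.mul_assoc, hY.adjugate_mul hγ hz, Matrix.mul_one]
  rw [← hXz, hX, cauchyRow, Matrix.fromCols_mul_fromRows, Matrix.mul_one, Matrix.mul_zero, add_zero, hAdef,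
    smul_smul, inv_mul_cancel₀ (sub_ne_zero.2 hne.symm), one_smul]

end Solution

end LineEnsemble

open LineEnsemble MeasureTheory
-- The main theorem
theorem mainTheorem11 (a : ℕ → ℝ) (ha_inf : 0 < ⨅ k, a k) (ha_sup : BddAbove (Set.range a))
    (R₀ : ℝ) (hR₀ : (⨆ k, a k) - (⨅ k, a k) < R₀)
    (γ : ℝ → ℂ) (hγ : IsContour γ) (hγ_half : ∀ z ∈ trace γ, -R₀ < z.re)
    (hγ_a : ∀ k, (a k : ℂ) ∈ inside γ)
    (p N M L : ℕ) [NeZero p] (hN : 1 ≤ N) (hL : 2 ≤ L)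
    (f : ℕ → ℂ → Matrix (Fin p) (Fin p) ℂ)
    (hf : ∀ r < L, ∀ i j, DifferentiableOn ℂ (fun z => f r z i j) {z : ℂ | -R₀ < z.re})
    {Ω : Type*} [MeasurableSpace Ω] (P : Measure Ω) [IsProbabilityMeasure P]
    (X : Set.Icc 1 (L - 1) → Ω → WeylChamber (p * N)) (hX : ∀ t, Measurable (X t))
    (Z : ℝ) (hZ : 0 < Z)
    (hlaw : ∀ x : Set.Icc 1 (L - 1) → WeylChamber (p * N),
      ((P.real {ω | ∀ t, X t ω = x t} : ℝ) : ℂ) = (Z : ℂ)⁻¹ * pathWeight a γ N M L f x) :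
    ∃ Y : ℂ → Matrix (Fin p ⊕ Fin p) (Fin p ⊕ Fin p) ℂ,
      SolvesRHP γ N (matrixWeight a N M L f) Y ∧
      (∀ Y', SolvesRHP γ N (matrixWeight a N M L f) Y' → Set.EqOn Y' Y (trace γ)ᶜ) ∧
      (∀ z, z ∉ trace γ → IsUnit (Y z)) ∧
      ∃ R : ℂ → ℂ → Matrix (Fin p) (Fin p) ℂ, IsReproducingKernel γ Y R ∧
        ∀ n : ℕ, 1 ≤ n → ∀ (t : Fin n → Set.Icc 1 (L - 1)) (x : Fin n → ℕ),
          Function.Injective (fun i => (t i, x i)) →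
          ((P.real {ω | ∃ l : Fin n → Fin (p * N), ∀ i, (X (t i) ω).1 (l i) = x i} : ℝ) : ℂ) =
            Matrix.det (Matrix.of fun i j : Fin n =>
              corrKernel a γ N M L f R (t i) (x i) (t j) (x j)) := by
  obtain ⟨U, hU, hUsub⟩ := exists_nodesIn ha_inf ha_sup hR₀ hγ hγ_half hγ_a
  have hf' : ∀ r < L, ∀ i j, DifferentiableOn ℂ (fun z => f r z i j) U := fun r hr i j =>
    (hf r hr i j).mono hUsub
  -- The probabilistic hypothesis enters the analytic part only here, through $\det G = Z > 0$.
  have hdet : (gram a γ N M L f).det ≠ 0 := by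
    rw [hU.det_gram (by omega) hf' hX hZ hlaw]
    exact_mod_cast hZ.ne'
  have hY := hU.solvesRHP hf' hdet hN
  refine ⟨_, hY, fun Y' hY' => hY.eqOn hγ hY', fun z hz => ?_, _,
    hU.isReproducingKernel hf' hdet hN hY, fun n _ t x hinj => ?_⟩
  · rw [Matrix.isUnit_iff_isUnit_det, hY.det_eq_one hγ hz]
    exact isUnit_one
  · rw [hU.correlation_eq_det (by omega) hf' hX hZ hlaw t x hinj]
    congr 2
    ext i j
    have h1 : ∀ i, (t i : ℕ) ≤ L := fun i => (t i).2.2.trans (Nat.sub_le _ _)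
    exact (hU.corrKernel_eq hf' (h1 i) (h1 j) _ _).symm
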